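/- Let $d\ge 2$ and $\lambda\in(0,1)$. Let $\mathbb{E}^d$ be the set of edges $[x,x+e_i]$ ($x\in\mathbb{Z}^d$, $1\le i\le d$) of the lattice $\mathbb{Z}^d$, and put $\nabla\zeta([x,x+e_i])=\zeta(x+e_i)-\zeta(x)$ for $\zeta:\mathbb{Z}^d\to\mathbb{R}$ and $\nabla^*\xi(x)=\sum_{i=1}^d\big(\xi([x-e_i,x])-\xi([x,x+e_i])\big)$ for $\xi:\mathbb{E}^d\to\mathbb{R}$. Let $\Omega=[\lambda,1]^{\mathbb{E}^d}$, with the product $\sigma$-algebra, be the space of uniformly elliptic coefficient fields. For $a\in\Omega$ and $d>2$, let $G(\cdot,y)=G(a;\cdot,y)$ be the Green function, i.e. the unique solution of $\nabla^*(a\nabla G(\cdot,y))(x)=\delta(x-y)$ ($x\in\mathbb{Z}^d$) with $G(x,y)\to0$ as $|x|\to\infty$; here $\delta(0)=1$ and $\delta(x)=0$ for $x\ne0$. Write $\nabla G(e,y)$ for its gradient in the first variable along the edge $e$. For $d=2$, let $\nabla G(e,y)=\lim_{T\to\infty}\nabla G_T(e,y)$, where, for $T>0$, $G_T(\cdot,y)$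 is the unique summable solution of $\frac1T G_T(\cdot,y)+\nabla^*(a\nabla G_T(\cdot,y))=\delta(\cdot-y)$, and $\nabla G_T(e,y)$ is its gradient in the first variable along $e$. In both cases $\nabla\nabla G(e,b)$ denotes the gradient of $y\mapsto\nabla G(e,y)$ along the edge $b$. Let $|e-y|$ and $|e-b|$ be the Euclidean distances from the mid-point of $e$ to $y$ and to the mid-point of $b$, respectively. These objects are well defined for every $a\in\Omega$ (the solutions exist and are unique, and the limit for $d=2$ exists). Moreover, there is a constant $C=C(d,\lambda)$, depending only on $d$ and $\lambda$, such that for every probability measure on $\Omega$, with expectation $\langle\cdot\rangle$, that is stationary (for all $x\in\mathbb{Z}^d$, $a$ and $a(\cdot+x)$ have the same distribution), the random variables $|\nabla G(e,y)|^2$ and $|\nabla\nabla G(e,b)|$ are integrable and $$\langle|\nabla G(e,y)|^2\rangle^{1/2}\le C\,(|e-y|+1)^{1-d},\qquad \langle|\nabla\nabla G(e,b)|\rangle\le C\,(|e-b|+1)^{-d}$$ for all $e,b\in\mathbb{E}^d$ and all $y\in\mathbb{Z}^d$. -/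

import Mathlib

open Filter Topology MeasureTheory

namespace AnnealedGreen

/-- Vertices of the lattice `ℤ^d`. -/
abbrev Vertex (d : ℕ) : Type := Fin d → ℤ

/-- Edges of the lattice: the pair `(x, i)` stands for the edge `[x, x + e_i]`. The group `ℤ^d`
acts on the edges by moving the base point. -/
abbrev Edge (d : ℕ) : Type := Vertex d × Fin d

/-- The canonical basis vector `e_i`. -/
def basisVec {d : ℕ} (i : Fin d) : Vertex d := Pi.single i 1

/-- The discrete gradient, `∇ζ([x, x + e_i]) = ζ(x + e_i) - ζ(x)`. -/
def grad {d : ℕ} (ζ : Vertex d → ℝ) (e : Edge d) : ℝ := ζ (e.1 + basisVec e.2) - ζ e.1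

/-- The discrete (negative) divergence, `∇^*ξ(x) = ∑ i, (ξ([x - e_i, x]) - ξ([x, x + e_i]))`. -/
def negDiv {d : ℕ} (ξ : Edge d → ℝ) (x : Vertex d) : ℝ :=
  ∑ i : Fin d, (ξ (x - basisVec i, i) - ξ (x, i))

/-- The operator `∇^* a ∇`. -/
def ellipticOp {d : ℕ} (a : Edge d → ℝ) (u : Vertex d → ℝ) : Vertex d → ℝ :=
  negDiv (fun e => a e * grad u e)

/-- The discrete Dirac at the origin. -/
def dirac {d : ℕ} (x : Vertex d) : ℝ := if x = 0 then 1 else 0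

/-- The space `Ω = [lam, 1]^{E^d}` of uniformly elliptic coefficient fields; as a function type it
carries the product σ-algebra. -/
abbrev CoeffField (d : ℕ) (lam : ℝ) : Type := Edge d → Set.Icc lam 1

/-- The underlying real-valued field on edges. -/
def CoeffField.toReal {d : ℕ} {lam : ℝ} (a : CoeffField d lam) : Edge d → ℝ := fun e => (a e : ℝ)

/-- The shifted coefficient field `a(· + x)`. -/
def shift {d : ℕ} {lam : ℝ} (x : Vertex d) (a : CoeffField d lam) : CoeffField d lam :=
  fun e => a (e.1 + x, e.2)

/-- Stationarity: `a` and `a(· + x)` have the same distribution for all `x ∈ ℤ^d`. -/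
def Stationary {d : ℕ} {lam : ℝ} (P : Measure (CoeffField d lam)) : Prop :=
  ∀ x : Vertex d, MeasurePreserving (shift x) P P

/-- `g = G(·, y)` is the fundamental solution of `∇^* a ∇` with pole `y` that vanishes at
infinity. This is the Green function in dimension `d > 2`. -/
def IsGreen {d : ℕ} (a : Edge d → ℝ) (y : Vertex d) (g : Vertex d → ℝ) : Prop :=
  (∀ x, ellipticOp a g x = dirac (x - y)) ∧ Tendsto g cofinite (𝓝 0)

open Classical in
/-- The Green function `G(x, y)` (for `d > 2`). -/
noncomputable def green {d : ℕ} (a : Edge d → ℝ) (x y : Vertex d) : ℝ :=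
  if h : ∃ g, IsGreen a y g then h.choose x else 0

/-- `g = G_T(·, y)` is the Green function with massive term: the summable solution of
`(1/T) g + ∇^* a ∇ g = δ(· - y)`. -/
def IsMassiveGreen {d : ℕ} (T : ℝ) (a : Edge d → ℝ) (y : Vertex d) (g : Vertex d → ℝ) : Prop :=
  (∀ x, 1 / T * g x + ellipticOp a g x = dirac (x - y)) ∧ Summable g

open Classical in
/-- The massive Green function `G_T(x, y)`. -/
noncomputable def massiveGreen {d : ℕ} (T : ℝ) (a : Edge d → ℝ) (x y : Vertex d) : ℝ :=
  if h : ∃ g, IsMassiveGreen T a y g then h.choose x else 0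

/-- `∇G(e, y)`, the gradient of the Green function in its first variable along the edge `e`.
For `d = 2`, where there is no Green function that vanishes at infinity, it is the limit of
`∇G_T(e, y)` as `T → ∞`. -/
noncomputable def gradGreen {d : ℕ} (a : Edge d → ℝ) (e : Edge d) (y : Vertex d) : ℝ :=
  if d = 2 then limUnder atTop (fun T : ℝ => grad (fun x => massiveGreen T a x y) e)
  else grad (fun x => green a x y) e

/-- `∇∇G(e, b)`, the mixed second derivative: one derivative in the first variable along `e`, one
in the second variable along `b`. -/
noncomputable def gradGradGreen {d : ℕ} (a : Edge d → ℝ) (e b : Edge d) : ℝ :=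
  grad (fun y => gradGreen a e y) b

/-- The Green function of the field `a` (for `d > 2`), respectively its gradient (for `d = 2`), is
well defined. -/
def GreenWellDefined {d : ℕ} (a : Edge d → ℝ) : Prop :=
  (2 < d → ∀ y, ∃! g, IsGreen a y g) ∧
  (d = 2 → ∀ y, (∀ T : ℝ, 0 < T → ∃! g, IsMassiveGreen T a y g) ∧
    ∀ e : Edge d, ∃ l : ℝ,
      Tendsto (fun T : ℝ => grad (fun x => massiveGreen T a x y) e) atTop (𝓝 l))

/-- A vertex as a point of Euclidean space. -/
noncomputable def vertexPoint {d : ℕ} (x : Vertex d) : EuclideanSpace ℝ (Fin d) :=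
  WithLp.toLp 2 (fun j => (x j : ℝ))

/-- The mid-point of an edge. -/
noncomputable def edgeMidpoint {d : ℕ} (e : Edge d) : EuclideanSpace ℝ (Fin d) :=
  midpoint ℝ (vertexPoint e.1) (vertexPoint (e.1 + basisVec e.2))

end AnnealedGreen

open AnnealedGreen

namespace AnnealedGreen

variable {d : ℕ}

/-! ### Finitely supported functions on the lattice -/

/-! Put A = ∇^*a∇ and κ = 1/(4d). Then P = 1 - κA is the one-step operator of a lazy random walk
with conductances a. With p_n(·, y) = P^n δ_y (`heat`), the geometric series for A = (1 - P)/κ gives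
∇G = κ ∑_n ∇p_n. A mass 1/T inserts s^{n+1} with s = (1 + κ/T)⁻¹, so T → ∞ is an Abel limit. The
walk has finite range, so each p_n has finite support and each is measurable in a. The work is to
bound gradients of p_n, summed over blocks of times n ~ 4^j, where the natural length scale is 2^j.

Quenched input, using ellipticity only. The energy identity and a Nash inequality give ∑_x p_n² ≲
2^{-jd} (`exists_heat_sq_le`). Repeating the energy estimate with the weight exp(|x - y|/2^j), whose
growth over times ~ 4^j costs only a constant, gives the same bound in weighted ℓ²
(`exists_weighted_heat_le`). Telescoping it over a block gives ∑_n ∑_x ω |∇p_n(x)|² ≲ 2^{-jd} for a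
fixed pole (`exists_weighted_energy_le`).

Annealed step. By Chapman–Kolmogorov, ∇p_{k+l}(e, y) = ∑_z ∇p_k(e, z) p_l(z, y), and the mixed
gradient is ∑_z ∇p_k(e, z) ∇p_l(b, z). Here the edge is fixed and the pole z varies. Under the
expectation, stationarity moves the pole to 0, which turns the sum over poles into a sum over
parallel edges, and the quenched energy bound applies (`exists_annealed_energy_le`). Weighted
Cauchy–Schwarz in z and the triangle inequality then bound a block of second moments of ∇p_n by
2^{-2jd} exp(-|e - y|/2^j), and a block of first moments of ∇∇p_n by 2^{-jd} exp(-|e - b|/2^{j+1}).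
Cauchy–Schwarz over the ~ 4^j times makes the first of these 2^{-j(d-1)} in L². Summing over j
yields the powers 1-d and -d (`exists_dyadic_sum_le`), and Fatou's lemma passes to the infinite
series.

Convergence for every fixed a is a separate matter. For d > 2 the on-diagonal bound makes p_n
summable in n, uniformly in space. For d = 2 energy estimates and Cauchy–Schwarz only bound each
block of ∑|∇p_n| by a constant. Widman's hole filling on squares supplies a factor θ^j with θ < 1
for the block of squares, which makes the series converge (`summable_abs_grad_heat_two`). Uniqueness
of the Green functions is the maximum principle. -/

theorem finite_support_of_local {u f : Vertex d → ℝ} (hu : (Function.support u).Finite)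
    (hf : ∀ x, u x = 0 → (∀ i, u (x + basisVec i) = 0) → (∀ i, u (x - basisVec i) = 0) → f x = 0) :
    (Function.support f).Finite := by
  have h1 : ∀ v : Vertex d, {x | u (x + v) ≠ 0}.Finite := fun v =>
    hu.preimage ((add_left_injective v).injOn)
  have h2 : (Function.support u ∪ (⋃ i : Fin d, {x | u (x + basisVec i) ≠ 0}) ∪
      ⋃ i : Fin d, {x | u (x + -basisVec i) ≠ 0}).Finite :=
    (hu.union (Set.finite_iUnion fun i => h1 _)).union (Set.finite_iUnion fun i => h1 _)
  refine h2.subset fun x hx => ?_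
  by_contra hcon
  simp only [Set.mem_union, Function.mem_support, Set.mem_iUnion, Set.mem_ofPred_eq, not_or,
    not_exists, not_not] at hcon
  exact hx (hf x hcon.1.1 hcon.1.2 fun i => by rw [sub_eq_add_neg]; exact hcon.2 i)

theorem tsum_add_right (f : Vertex d → ℝ) (v : Vertex d) : ∑' x, f (x + v) = ∑' x, f x :=
  (Equiv.addRight v).tsum_eq f

theorem grad_apply (u : Vertex d → ℝ) (x : Vertex d) (i : Fin d) :
    grad u (x, i) = u (x + basisVec i) - u x := rfl

theorem ellipticOp_apply (a : Edge d → ℝ) (u : Vertex d → ℝ) (x : Vertex d) :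
    ellipticOp a u x = ∑ i, (a (x - basisVec i, i) * (u x - u (x - basisVec i))
      - a (x, i) * (u (x + basisVec i) - u x)) := by
  simp [ellipticOp, negDiv, grad]

/-- Summation by parts for the operator `∇^* a ∇`. -/
theorem tsum_mul_ellipticOp (a : Edge d → ℝ) (u : Vertex d → ℝ) {v : Vertex d → ℝ}
    (hv : (Function.support v).Finite) :
    ∑' x, v x * ellipticOp a u x =
      ∑' x, ∑ i, a (x, i) * grad u (x, i) * (v (x + basisVec i) - v x) := by
  set ξ : Edge d → ℝ := fun e => a e * grad u e with hξ
  have e1 : ∀ x, v x * ellipticOp a u x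
      = ∑ i, (v x * ξ (x - basisVec i, i) - v x * ξ (x, i)) := fun x => by
    simp [ellipticOp, negDiv, Finset.mul_sum, mul_sub, hξ]
  have e2 : ∀ x, ∑ i, a (x, i) * grad u (x, i) * (v (x + basisVec i) - v x)
      = ∑ i, (v (x + basisVec i) * ξ (x, i) - v x * ξ (x, i)) := fun x =>
    Finset.sum_congr rfl fun i _ => by simp only [hξ]; ring
  have s1 : ∀ i, Summable fun x => v x * ξ (x - basisVec i, i) := fun i =>
    summable_of_hasFiniteSupport (finite_support_of_local hv fun x h _ _ => by simp [h])
  have s2 : ∀ i, Summable fun x => v x * ξ (x, i) := fun i =>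
    summable_of_hasFiniteSupport (finite_support_of_local hv fun x h _ _ => by simp [h])
  have s3 : ∀ i, Summable fun x => v (x + basisVec i) * ξ (x, i) := fun i =>
    summable_of_hasFiniteSupport (finite_support_of_local hv fun x _ h _ => by simp [h])
  simp only [e1, e2]
  rw [Summable.tsum_finsetSum fun i _ => (s1 i).sub (s2 i),
    Summable.tsum_finsetSum fun i _ => (s3 i).sub (s2 i)]
  refine Finset.sum_congr rfl fun i _ => ?_
  rw [(s1 i).tsum_sub (s2 i), (s3 i).tsum_sub (s2 i)]
  congr 1
  rw [← tsum_add_right _ (basisVec i)]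
  simp

theorem tsum_mul_ellipticOp_comm (a : Edge d → ℝ) {u v : Vertex d → ℝ}
    (hu : (Function.support u).Finite) (hv : (Function.support v).Finite) :
    ∑' x, v x * ellipticOp a u x = ∑' x, u x * ellipticOp a v x := by
  rw [tsum_mul_ellipticOp a u hv, tsum_mul_ellipticOp a v hu]
  refine tsum_congr fun x => Finset.sum_congr rfl fun i _ => ?_
  simp only [grad]; ring

theorem sq_ellipticOp_le (a : Edge d → ℝ) (u : Vertex d → ℝ) (x : Vertex d) :
    ellipticOp a u x ^ 2 ≤ 2 * d * ∑ i, ((a (x - basisVec i, i) * grad u (x - basisVec i, i)) ^ 2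
      + (a (x, i) * grad u (x, i)) ^ 2) := by
  unfold ellipticOp negDiv
  have h := sq_sum_le_card_mul_sum_sq (s := (Finset.univ : Finset (Fin d)))
    (f := fun i => a (x - basisVec i, i) * grad u (x - basisVec i, i) - a (x, i) * grad u (x, i))
  simp only [Finset.card_univ, Fintype.card_fin] at h
  refine h.trans ?_
  rw [mul_comm 2 (d : ℝ), mul_assoc]
  refine mul_le_mul_of_nonneg_left ?_ (Nat.cast_nonneg d)
  rw [Finset.mul_sum]
  refine Finset.sum_le_sum fun i _ => ?_
  nlinarith [sq_nonneg (a (x - basisVec i, i) * grad u (x - basisVec i, i)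
    + a (x, i) * grad u (x, i))]

/-- Weighted bound for `∇^* a ∇ u` by the energy density. -/
theorem tsum_weight_sq_ellipticOp_le (a : Edge d → ℝ) {u : Vertex d → ℝ} (s : Vertex d → ℝ)
    (hs : ∀ x, 0 ≤ s x) (hu : (Function.support u).Finite) :
    ∑' x, s x * ellipticOp a u x ^ 2 ≤
      2 * d * ∑' x, ∑ i, (s x + s (x + basisVec i)) * (a (x, i) * grad u (x, i)) ^ 2 := by
  have s1 : ∀ i, Summable fun x =>
      s x * (a (x - basisVec i, i) * grad u (x - basisVec i, i)) ^ 2 := fun i =>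
    summable_of_hasFiniteSupport (finite_support_of_local hu fun x h _ h' => by simp [grad, h, h'])
  have s2 : ∀ i, Summable fun x => s x * (a (x, i) * grad u (x, i)) ^ 2 := fun i =>
    summable_of_hasFiniteSupport (finite_support_of_local hu fun x h h' _ => by simp [grad, h, h'])
  have s3 : ∀ i, Summable fun x => s (x + basisVec i) * (a (x, i) * grad u (x, i)) ^ 2 := fun i =>
    summable_of_hasFiniteSupport (finite_support_of_local hu fun x h h' _ => by simp [grad, h, h'])
  have s4 : Summable fun x => s x * ellipticOp a u x ^ 2 :=
    summable_of_hasFiniteSupport (finite_support_of_local hu fun x h h' h'' => by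
      simp [ellipticOp_apply, h, h', h''])
  have e1 : ∀ x, s x * ellipticOp a u x ^ 2 ≤ 2 * d * ∑ i,
      (s x * (a (x - basisVec i, i) * grad u (x - basisVec i, i)) ^ 2
        + s x * (a (x, i) * grad u (x, i)) ^ 2) := fun x => by
    refine (mul_le_mul_of_nonneg_left (sq_ellipticOp_le a u x) (hs x)).trans (le_of_eq ?_)
    rw [mul_left_comm, Finset.mul_sum]
    simp only [mul_add]
  refine (s4.tsum_le_tsum e1 ((summable_sum fun i _ => (s1 i).add (s2 i)).mul_left _)).trans
    (le_of_eq ?_)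
  rw [tsum_mul_left]
  congr 1
  simp only [add_mul]
  rw [Summable.tsum_finsetSum fun i _ => (s1 i).add (s2 i),
    Summable.tsum_finsetSum fun i _ => (s2 i).add (s3 i)]
  refine Finset.sum_congr rfl fun i _ => ?_
  rw [(s1 i).tsum_add (s2 i), (s2 i).tsum_add (s3 i), add_comm]
  congr 1
  rw [← tsum_add_right _ (basisVec i)]
  simp

theorem tsum_sum_add_endpoints (f u : Vertex d → ℝ) (hu : (Function.support u).Finite)
    (hf : ∀ x, u x = 0 → f x = 0) :
    ∑' x, ∑ i : Fin d, (f x + f (x + basisVec i)) = 2 * d * ∑' x, f x := by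
  have hs : Summable f := summable_of_hasFiniteSupport (finite_support_of_local hu fun x h _ _ => hf x h)
  have hs' : ∀ i : Fin d, Summable fun x => f (x + basisVec i) := fun i =>
    summable_of_hasFiniteSupport (finite_support_of_local hu fun x _ h _ => hf _ (h i))
  rw [Summable.tsum_finsetSum fun i _ => hs.add (hs' i)]
  simp only [hs.tsum_add (hs' _), tsum_add_right]
  simp; ring

/-! ### The lazy random walk -/

/-- Fields that are uniformly elliptic with lower bound `lam`. -/
def UnifElliptic (lam : ℝ) (a : Edge d → ℝ) : Prop := ∀ e, lam ≤ a e ∧ a e ≤ 1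

/-- One step of the lazy random walk with conductances `a`. -/
noncomputable def step (a : Edge d → ℝ) (u : Vertex d → ℝ) (x : Vertex d) : ℝ :=
  u x - (4 * d : ℝ)⁻¹ * ellipticOp a u x

theorem step_finite {a : Edge d → ℝ} {u : Vertex d → ℝ} (hu : (Function.support u).Finite) :
    (Function.support (step a u)).Finite :=
  finite_support_of_local hu fun x h h' h'' => by simp [step, ellipticOp_apply, h, h', h'']

/-- The edgewise inequality behind the weighted energy estimate. -/
theorem weighted_edge_le {s t δ a u v : ℝ} (hs : 0 < s) (ht : 0 < t) (ha : 0 ≤ a) (ha1 : a ≤ 1)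
    (h : (t - s) ^ 2 ≤ δ * (s * t)) :
    -2 * (a * (v - u) * (t * v - s * u)) + 1 / 2 * ((s + t) * (a * (v - u)) ^ 2) ≤
      -(1 / 4) * (a * (s + t) * (v - u) ^ 2) + 2 * δ * (s * u ^ 2 + t * v ^ 2) := by
  have hδ : 0 ≤ δ := by
    by_contra hneg
    have := mul_pos hs ht
    nlinarith [sq_nonneg (t - s)]
  -- Uses t v - s u = ½(s + t)(v - u) + ½(t - s)(v + u). The first part dissipates a(s + t)(v - u)².
  -- The second is an error, and Young's inequality charges a quarter of the dissipation for it. The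
  -- quadratic term takes another half because a ≤ 1, which leaves the stated quarter.
  have k1 : -((t - s) * (v - u) * (v + u)) ≤
      1 / 4 * ((s + t) * (v - u) ^ 2) + (t - s) ^ 2 * (v + u) ^ 2 / (s + t) := by
    have hst : 0 < s + t := by positivity
    have : 0 ≤ ((s + t) * (v - u) / 2 + (t - s) * (v + u)) ^ 2 / (s + t) := by positivity
    have e : ((s + t) * (v - u) / 2 + (t - s) * (v + u)) ^ 2 / (s + t)
      = 1 / 4 * ((s + t) * (v - u) ^ 2) + (t - s) * (v - u) * (v + u)
        + (t - s) ^ 2 * (v + u) ^ 2 / (s + t) := by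
      field_simp; ring
    linarith
  have k2 : (t - s) ^ 2 * (v + u) ^ 2 / (s + t) ≤ 2 * δ * (s * u ^ 2 + t * v ^ 2) := by
    rw [div_le_iff₀ (by positivity)]
    calc (t - s) ^ 2 * (v + u) ^ 2 ≤ δ * (s * t) * (2 * (u ^ 2 + v ^ 2)) := by
          apply mul_le_mul h _ (sq_nonneg _) (by positivity)
          nlinarith [sq_nonneg (u - v)]
      _ ≤ 2 * δ * (s * u ^ 2 + t * v ^ 2) * (s + t) := by
          have : 0 ≤ 2 * δ * (s ^ 2 * u ^ 2 + t ^ 2 * v ^ 2) := by positivity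
          nlinarith
  have k3 : 0 ≤ a * (1 - a) * ((s + t) * (v - u) ^ 2) := by
    have : 0 ≤ 1 - a := by linarith
    positivity
  have k4 : 0 ≤ (1 - a) * (2 * δ * (s * u ^ 2 + t * v ^ 2)) := by
    have : 0 ≤ 1 - a := by linarith
    positivity
  nlinarith [mul_le_mul_of_nonneg_left (k1.trans (add_le_add_right k2 _)) ha]

/-- Weighted energy estimate for one step of the random walk. -/
theorem weighted_step (hd : 0 < d) {a : Edge d → ℝ} (ha : ∀ e, 0 ≤ a e ∧ a e ≤ 1)
    {u : Vertex d → ℝ} (hu : (Function.support u).Finite) {s : Vertex d → ℝ} (hs : ∀ x, 0 < s x)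
    {δ : ℝ} (hδ : ∀ x (i : Fin d), (s (x + basisVec i) - s x) ^ 2 ≤
      δ * (s x * s (x + basisVec i))) :
    ∑' x, s x * step a u x ^ 2 + (4 * d : ℝ)⁻¹ / 4 *
      ∑' x, ∑ i, a (x, i) * (s x + s (x + basisVec i)) * grad u (x, i) ^ 2 ≤
      (1 + δ) * ∑' x, s x * u x ^ 2 := by
  set κ : ℝ := (4 * d : ℝ)⁻¹ with hκ
  have hd' : (0 : ℝ) < d := Nat.cast_pos.2 hd
  have hκ0 : 0 < κ := by positivity
  have hκd : κ * d = 1 / 4 := by rw [hκ]; field_simp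
  have hsu : (Function.support fun x => s x * u x).Finite :=
    finite_support_of_local hu fun x h _ _ => by simp [h]
  have S : ∀ f : Vertex d → ℝ, (∀ x, u x = 0 → (∀ i, u (x + basisVec i) = 0) →
      (∀ i, u (x - basisVec i) = 0) → f x = 0) → Summable f := fun f hf =>
    summable_of_hasFiniteSupport (finite_support_of_local hu hf)
  have z0 : ∀ x, u x = 0 → (∀ i, u (x + basisVec i) = 0) →
      (∀ i, u (x - basisVec i) = 0) → ellipticOp a u x = 0 := fun x h h' h'' => by
    simp [ellipticOp_apply, h, h', h'']
  have e1 : ∑' x, s x * step a u x ^ 2 = ∑' x, s x * u x ^ 2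
      - 2 * κ * ∑' x, (s x * u x) * ellipticOp a u x
      + κ ^ 2 * ∑' x, s x * ellipticOp a u x ^ 2 := by
    rw [← tsum_mul_left, ← tsum_mul_left, ← Summable.tsum_sub, ← Summable.tsum_add]
    · refine tsum_congr fun x => ?_
      simp only [step]; ring
    · exact S _ fun x h h' h'' => by simp [h]
    · exact S _ fun x h h' h'' => by simp [z0 x h h' h'']
    · exact S _ fun x h h' h'' => by simp [h]
    · exact S _ fun x h h' h'' => by simp [h]
  have e2 := tsum_weight_sq_ellipticOp_le a s (fun x => (hs x).le) hu
  have e3 := tsum_mul_ellipticOp a u hsu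
  have e4 := tsum_sum_add_endpoints (fun x => s x * u x ^ 2) u hu (fun x h => by simp [h])
  have e5 : -2 * ∑' x, ∑ i, a (x, i) * grad u (x, i) *
        (s (x + basisVec i) * u (x + basisVec i) - s x * u x)
      + 1 / 2 * ∑' x, ∑ i, (s x + s (x + basisVec i)) * (a (x, i) * grad u (x, i)) ^ 2
      ≤ -(1 / 4) * ∑' x, ∑ i, a (x, i) * (s x + s (x + basisVec i)) * grad u (x, i) ^ 2
      + 2 * δ * ∑' x, ∑ i, (s x * u x ^ 2 + s (x + basisVec i) * u (x + basisVec i) ^ 2) := by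
    rw [← tsum_mul_left, ← tsum_mul_left, ← tsum_mul_left, ← tsum_mul_left, ← Summable.tsum_add,
      ← Summable.tsum_add]
    · refine Summable.tsum_le_tsum (fun x => ?_) ?_ ?_
      · simp only [Finset.mul_sum, ← Finset.sum_add_distrib]
        refine Finset.sum_le_sum fun i _ => ?_
        exact weighted_edge_le (hs x) (hs _) (ha _).1 (ha _).2 (hδ x i)
      · exact S _ fun x h h' h'' => by simp [grad, h, h']
      · exact S _ fun x h h' h'' => by simp [grad, h, h']
    all_goals exact S _ fun x h h' h'' => by simp [grad, h, h']
  rw [e1, e3]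
  rw [e4] at e5
  have e6 := mul_le_mul_of_nonneg_left e2 (sq_nonneg κ)
  have e7 := mul_le_mul_of_nonneg_left e5 hκ0.le
  -- The step size enters here: κd = 1/4 gives κ²·2d = κ/2, small enough for the second-order term
  -- to be absorbed by the first-order dissipation.
  have e8 : ∀ t : ℝ, κ ^ 2 * (2 * d * t) = κ * (1 / 2 * t) := fun t => by
    linear_combination (2 * κ * t) * hκd
  rw [e8] at e6
  have e9 : ∀ t : ℝ, κ * (2 * δ * (2 * d * t)) = δ * t := fun t => by
    linear_combination (4 * δ * t) * hκd
  rw [mul_add κ (-(1 / 4) * _), e9] at e7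
  linarith

theorem ellipticOp_sub (a : Edge d → ℝ) (u v : Vertex d → ℝ) (x : Vertex d) :
    ellipticOp a (fun x => u x - v x) x = ellipticOp a u x - ellipticOp a v x := by
  simp only [ellipticOp_apply, ← Finset.sum_sub_distrib]
  exact Finset.sum_congr rfl fun i _ => by ring

theorem ellipticOp_const_mul (a : Edge d → ℝ) (c : ℝ) (u : Vertex d → ℝ) (x : Vertex d) :
    ellipticOp a (fun x => c * u x) x = c * ellipticOp a u x := by
  simp only [ellipticOp_apply, Finset.mul_sum]
  exact Finset.sum_congr rfl fun i _ => by ring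

theorem ellipticOp_finite {a : Edge d → ℝ} {u : Vertex d → ℝ} (hu : (Function.support u).Finite) :
    (Function.support (ellipticOp a u)).Finite :=
  finite_support_of_local hu fun x h h' h'' => by simp [ellipticOp_apply, h, h', h'']

theorem tsum_mul_step_comm (a : Edge d → ℝ) {u v : Vertex d → ℝ}
    (hu : (Function.support u).Finite) (hv : (Function.support v).Finite) :
    ∑' x, step a u x * v x = ∑' x, u x * step a v x := by
  have S : ∀ f : Vertex d → ℝ, (∀ x, u x = 0 → (∀ i, u (x + basisVec i) = 0) →
      (∀ i, u (x - basisVec i) = 0) → f x = 0) → Summable f := fun f hf =>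
    summable_of_hasFiniteSupport (finite_support_of_local hu hf)
  have z0 : ∀ x, u x = 0 → (∀ i, u (x + basisVec i) = 0) →
      (∀ i, u (x - basisVec i) = 0) → ellipticOp a u x = 0 := fun x h h' h'' => by
    simp [ellipticOp_apply, h, h', h'']
  have e := tsum_mul_ellipticOp_comm a hu hv
  have e1 : ∀ x, step a u x * v x = u x * v x - (4 * d : ℝ)⁻¹ * (v x * ellipticOp a u x) :=
    fun x => by simp only [step]; ring
  have e2 : ∀ x, u x * step a v x = u x * v x - (4 * d : ℝ)⁻¹ * (u x * ellipticOp a v x) :=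
    fun x => by simp only [step]; ring
  simp only [e1, e2]
  rw [Summable.tsum_sub, Summable.tsum_sub, tsum_mul_left, tsum_mul_left, e]
  · exact S _ fun x h h' h'' => by simp [h]
  · exact S _ fun x h h' h'' => by simp [h]
  · exact S _ fun x h h' h'' => by simp [h]
  · exact S _ fun x h h' h'' => by simp [z0 x h h' h'']

theorem step_eq (hd : 0 < d) (a : Edge d → ℝ) (u : Vertex d → ℝ) (x : Vertex d) :
    step a u x = ∑ i : Fin d, (4 * d : ℝ)⁻¹ * ((4 - a (x - basisVec i, i) - a (x, i)) * u x
      + a (x - basisVec i, i) * u (x - basisVec i) + a (x, i) * u (x + basisVec i)) := by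
  have hd' : (d : ℝ) ≠ 0 := Nat.cast_ne_zero.2 hd.ne'
  have : u x = ∑ i : Fin d, (4 * d : ℝ)⁻¹ * (4 * u x) := by
    simp; field_simp
  rw [step, ellipticOp_apply, this, Finset.mul_sum, ← Finset.sum_sub_distrib, ← this]
  exact Finset.sum_congr rfl fun i _ => by ring

theorem step_nonneg (hd : 0 < d) {a : Edge d → ℝ} (ha : ∀ e, 0 ≤ a e ∧ a e ≤ 1)
    {u : Vertex d → ℝ} (hu : ∀ x, 0 ≤ u x) (x : Vertex d) : 0 ≤ step a u x := by
  rw [step_eq hd]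
  refine Finset.sum_nonneg fun i _ => mul_nonneg (by positivity) ?_
  have h1 := ha (x - basisVec i, i)
  have h2 := ha (x, i)
  have h3 : 0 ≤ 4 - a (x - basisVec i, i) - a (x, i) := by linarith
  have := mul_nonneg h3 (hu x)
  have := mul_nonneg h1.1 (hu (x - basisVec i))
  have := mul_nonneg h2.1 (hu (x + basisVec i))
  linarith

theorem tsum_step (a : Edge d → ℝ) {u : Vertex d → ℝ} (hu : (Function.support u).Finite) :
    ∑' x, step a u x = ∑' x, u x := by
  have h0 : ∑' x, ellipticOp a u x = 0 := by
    have s1 : ∀ i, Summable fun x => a (x - basisVec i, i) * grad u (x - basisVec i, i) := fun i =>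
      summable_of_hasFiniteSupport (finite_support_of_local hu fun x h _ h' => by
        simp [grad, h, h'])
    have s2 : ∀ i, Summable fun x => a (x, i) * grad u (x, i) := fun i =>
      summable_of_hasFiniteSupport (finite_support_of_local hu fun x h h' _ => by
        simp [grad, h, h'])
    simp only [ellipticOp, negDiv]
    rw [Summable.tsum_finsetSum fun i _ => (s1 i).sub (s2 i)]
    refine Finset.sum_eq_zero fun i _ => ?_
    rw [(s1 i).tsum_sub (s2 i), ← tsum_add_right _ (basisVec i)]
    simp
  simp only [step]
  rw [Summable.tsum_sub (summable_of_hasFiniteSupport hu)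
    ((summable_of_hasFiniteSupport (ellipticOp_finite hu)).mul_left _), tsum_mul_left, h0]
  simp

/-- The transition probabilities of the lazy random walk: `heat a n y x` is the probability to go
from `y` to `x` in `n` steps. -/
noncomputable def heat (a : Edge d → ℝ) (n : ℕ) (y : Vertex d) : Vertex d → ℝ :=
  (step a)^[n] fun x => dirac (x - y)

theorem heat_zero (a : Edge d → ℝ) (y x : Vertex d) : heat a 0 y x = dirac (x - y) := rfl

theorem heat_succ (a : Edge d → ℝ) (n : ℕ) (y : Vertex d) :
    heat a (n + 1) y = step a (heat a n y) := Function.iterate_succ_apply' _ _ _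

theorem heat_finite (a : Edge d → ℝ) (n : ℕ) (y : Vertex d) :
    (Function.support (heat a n y)).Finite := by
  induction n with
  | zero =>
    refine (Set.finite_singleton y).subset fun x hx => ?_
    by_contra h
    exact hx (by simp [heat_zero, dirac, sub_eq_zero, Set.mem_singleton_iff.not.1 h])
  | succ n ih => rw [heat_succ]; exact step_finite ih

theorem heat_nonneg (hd : 0 < d) {a : Edge d → ℝ} (ha : ∀ e, 0 ≤ a e ∧ a e ≤ 1) (n : ℕ)
    (y x : Vertex d) : 0 ≤ heat a n y x := by
  induction n generalizing x with
  | zero => rw [heat_zero, dirac]; split_ifs <;> norm_num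
  | succ n ih => rw [heat_succ]; exact step_nonneg hd ha ih x

theorem tsum_dirac_mul (f : Vertex d → ℝ) (y : Vertex d) :
    ∑' x, dirac (x - y) * f x = f y := by
  rw [tsum_eq_single y fun x hx => by simp [dirac, sub_eq_zero, hx]]
  simp [dirac]

theorem tsum_heat (a : Edge d → ℝ) (n : ℕ) (y : Vertex d) : ∑' x, heat a n y x = 1 := by
  induction n with
  | zero => simpa [heat_zero] using tsum_dirac_mul (fun _ => (1 : ℝ)) y
  | succ n ih => rw [heat_succ, tsum_step a (heat_finite a n y), ih]

/-- The Chapman–Kolmogorov identity, in the symmetric form. -/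
theorem tsum_heat_mul_heat (a : Edge d → ℝ) (k l : ℕ) (x y : Vertex d) :
    ∑' z, heat a k x z * heat a l y z = heat a (k + l) y x := by
  induction k generalizing l with
  | zero => rw [zero_add]; exact tsum_dirac_mul _ x
  | succ k ih =>
    rw [heat_succ, tsum_mul_step_comm a (heat_finite a k x) (heat_finite a l y), ← heat_succ, ih,
      show k + (l + 1) = k + 1 + l by ring]

theorem heat_comm (a : Edge d → ℝ) (n : ℕ) (x y : Vertex d) : heat a n x y = heat a n y x := by
  rw [← add_zero n, ← tsum_heat_mul_heat a n 0 x y]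
  simp only [heat_zero, mul_comm (heat a n x _)]
  rw [tsum_dirac_mul, add_zero]

theorem heat_shift (a : Edge d → ℝ) (n : ℕ) (y x z : Vertex d) :
    heat (fun e => a (e.1 + z, e.2)) n y x = heat a n (y + z) (x + z) := by
  induction n generalizing x with
  | zero => simp [heat_zero]
  | succ n ih =>
    simp only [heat_succ, step, ellipticOp_apply, ih]
    have h1 : ∀ i : Fin d, x - basisVec i + z = x + z - basisVec i := fun i => by abel
    have h2 : ∀ i : Fin d, x + basisVec i + z = x + z + basisVec i := fun i => by abel
    simp only [h1, h2]

/-- The `ℓ^1` norm on the lattice. -/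
def nrm (x : Vertex d) : ℕ := ∑ i, (x i).natAbs

theorem nrm_add_le (x y : Vertex d) : nrm (x + y) ≤ nrm x + nrm y := by
  rw [nrm, nrm, nrm, ← Finset.sum_add_distrib]
  exact Finset.sum_le_sum fun i _ => Int.natAbs_add_le _ _

theorem nrm_neg (x : Vertex d) : nrm (-x) = nrm x := by simp [nrm]

theorem nrm_basisVec (i : Fin d) : nrm (basisVec i) = 1 := by
  rw [nrm, Finset.sum_eq_single i (fun j _ hj => by simp [basisVec, hj]) (by simp)]
  simp [basisVec]

/-- Finite propagation speed. It lets sums over intermediate points run over a ball independent of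
a, so that they commute with expectation, and it handles the few small times far from the pole. -/
theorem heat_eq_zero (a : Edge d → ℝ) (n : ℕ) (y x : Vertex d) (h : n < nrm (x - y)) :
    heat a n y x = 0 := by
  induction n generalizing x with
  | zero =>
    have : x - y ≠ 0 := fun h0 => by rw [h0] at h; simp [nrm] at h
    simp [heat_zero, dirac, this]
  | succ n ih =>
    have h1 : ∀ i, heat a n y (x + basisVec i) = 0 := fun i => ih _ <| by
      have := nrm_add_le (x + basisVec i - y) (-basisVec i)
      rw [show x + basisVec i - y + -basisVec i = x - y by abel, nrm_neg, nrm_basisVec] at this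
      omega
    have h2 : ∀ i, heat a n y (x - basisVec i) = 0 := fun i => ih _ <| by
      have := nrm_add_le (x - basisVec i - y) (basisVec i)
      rw [show x - basisVec i - y + basisVec i = x - y by abel, nrm_basisVec] at this
      omega
    have h3 : heat a n y x = 0 := ih _ (by omega)
    simp [heat_succ, step, ellipticOp_apply, h1, h2, h3]

theorem finite_nrm_le (n : ℕ) (y : Vertex d) : {x : Vertex d | nrm (x - y) ≤ n}.Finite := by
  refine (Set.finite_Icc (fun i => y i - (n : ℤ)) (fun i => y i + (n : ℤ))).subset fun x hx => ?_
  have h : ∀ i, (x i - y i).natAbs ≤ n := fun i =>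
    (Finset.single_le_sum (f := fun i => ((x - y) i).natAbs) (fun j _ => Nat.zero_le _)
      (Finset.mem_univ i)).trans hx
  exact ⟨fun i => by have := h i; show y i - (n : ℤ) ≤ x i; omega,
    fun i => by have := h i; show x i ≤ y i + (n : ℤ); omega⟩

theorem heat_le_one (hd : 0 < d) {a : Edge d → ℝ} (ha : ∀ e, 0 ≤ a e ∧ a e ≤ 1) (n : ℕ)
    (y x : Vertex d) : heat a n y x ≤ 1 := by
  rw [← tsum_heat a n y]
  exact (summable_of_hasFiniteSupport (heat_finite a n y)).le_tsum x
    fun z _ => heat_nonneg hd ha n y z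

theorem measurable_heat {lam : ℝ} (n : ℕ) (y x : Vertex d) :
    Measurable fun a : CoeffField d lam => heat a.toReal n y x := by
  induction n generalizing x with
  | zero => exact measurable_const
  | succ n ih =>
    have h0 : ∀ e : Edge d, Measurable fun a : CoeffField d lam => a.toReal e := fun e =>
      measurable_subtype_coe.comp (measurable_pi_apply e)
    simp only [heat_succ, step, ellipticOp_apply]
    refine (ih x).sub (Measurable.const_mul (Finset.measurable_fun_sum _ fun i _ => ?_) _)
    exact ((h0 _).mul ((ih _).sub (ih _))).sub ((h0 _).mul ((ih _).sub (ih _)))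

/-! ### Energy estimates without weight -/

/-- The Dirichlet energy. -/
noncomputable def energy (a : Edge d → ℝ) (u : Vertex d → ℝ) : ℝ :=
  ∑' x, ∑ i, a (x, i) * grad u (x, i) ^ 2

theorem energy_eq (a : Edge d → ℝ) {u : Vertex d → ℝ} (hu : (Function.support u).Finite) :
    energy a u = ∑' x, u x * ellipticOp a u x := by
  rw [tsum_mul_ellipticOp a u hu, energy]
  exact tsum_congr fun x => Finset.sum_congr rfl fun i _ => by simp only [grad]; ring

theorem energy_nonneg {a : Edge d → ℝ} (ha : ∀ e, 0 ≤ a e ∧ a e ≤ 1) (u : Vertex d → ℝ) :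
    0 ≤ energy a u :=
  tsum_nonneg fun x => Finset.sum_nonneg fun i _ => mul_nonneg (ha _).1 (sq_nonneg _)

theorem energy_le {a : Edge d → ℝ} (ha : ∀ e, 0 ≤ a e ∧ a e ≤ 1) {u : Vertex d → ℝ}
    (hu : (Function.support u).Finite) : energy a u ≤ 4 * d * ∑' x, u x ^ 2 := by
  have e4 := tsum_sum_add_endpoints (fun x => u x ^ 2) u hu (fun x h => by simp [h])
  have : energy a u ≤ ∑' x, 2 * ∑ i : Fin d, (u x ^ 2 + u (x + basisVec i) ^ 2) := by
    refine Summable.tsum_le_tsum (fun x => ?_)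
      (summable_of_hasFiniteSupport (finite_support_of_local hu fun x h h' _ => by
        simp [grad, h, h']))
      (summable_of_hasFiniteSupport (finite_support_of_local hu fun x h h' _ => by simp [h, h']))
    rw [Finset.mul_sum]
    refine Finset.sum_le_sum fun i _ => ?_
    have h1 : a (x, i) * grad u (x, i) ^ 2 ≤ 1 * grad u (x, i) ^ 2 :=
      mul_le_mul_of_nonneg_right (ha _).2 (sq_nonneg _)
    have h2 := sq_nonneg (u x + u (x + basisVec i))
    simp only [grad] at h1 ⊢
    nlinarith
  rw [tsum_mul_left, e4] at this
  linarith

theorem tsum_sq_step (hd : 0 < d) {a : Edge d → ℝ} (ha : ∀ e, 0 ≤ a e ∧ a e ≤ 1)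
    {u : Vertex d → ℝ} (hu : (Function.support u).Finite) :
    ∑' x, step a u x ^ 2 + (8 * d : ℝ)⁻¹ * energy a u ≤ ∑' x, u x ^ 2 := by
  have h := weighted_step hd ha hu (s := fun _ => 1) (fun _ => one_pos) (δ := 0) (by simp)
  have e : ∀ x : Vertex d, ∑ i, a (x, i) * (1 + 1) * grad u (x, i) ^ 2
      = 2 * ∑ i, a (x, i) * grad u (x, i) ^ 2 := fun x => by
    rw [Finset.mul_sum]; exact Finset.sum_congr rfl fun i _ => by ring
  simp only [e, one_mul, add_zero, tsum_mul_left] at h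
  refine le_trans (le_of_eq ?_) h
  rw [energy, mul_inv, mul_inv]; ring

/-- Since P is a polynomial in the symmetric A, E(Pu) = E(u) - 2κ‖Au‖² + κ²E(Au), and E(Au) ≤
4d‖Au‖² with 4dκ = 1 gives back at most half of the loss. The consequence needed later is that ‖A
p_n‖² is summable in time, with sum controlled by the energy. -/
theorem energy_step (hd : 0 < d) {a : Edge d → ℝ} (ha : ∀ e, 0 ≤ a e ∧ a e ≤ 1)
    {u : Vertex d → ℝ} (hu : (Function.support u).Finite) :
    energy a (step a u) + (4 * d : ℝ)⁻¹ * ∑' x, ellipticOp a u x ^ 2 ≤ energy a u := by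
  set κ : ℝ := (4 * d : ℝ)⁻¹ with hκ
  have hd' : (0 : ℝ) < d := Nat.cast_pos.2 hd
  have hκ0 : 0 < κ := by positivity
  have hκd : κ * (4 * d) = 1 := by rw [hκ]; field_simp
  have hA := ellipticOp_finite (a := a) hu
  have hAA := ellipticOp_finite (a := a) hA
  have e0 : ∀ x, ellipticOp a (step a u) x
      = ellipticOp a u x - κ * ellipticOp a (ellipticOp a u) x := fun x => by
    have := ellipticOp_sub a u (fun x => κ * ellipticOp a u x) x
    rw [ellipticOp_const_mul] at this
    exact this
  have sS : ∀ {f g : Vertex d → ℝ}, (Function.support f).Finite → Summable fun x => f x * g x :=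
    fun {f g} hf => summable_of_hasFiniteSupport (finite_support_of_local hf fun x h _ _ => by
      simp [h])
  have e1 : energy a (step a u) = energy a u - 2 * κ * ∑' x, ellipticOp a u x ^ 2
      + κ ^ 2 * energy a (ellipticOp a u) := by
    rw [energy_eq a (step_finite hu), energy_eq a hu, energy_eq a hA]
    have c := tsum_mul_ellipticOp_comm a hu hA
    have : ∀ x, step a u x * ellipticOp a (step a u) x = u x * ellipticOp a u x
        - κ * (ellipticOp a u x * ellipticOp a u x) - κ * (u x * ellipticOp a (ellipticOp a u) x)
        + κ ^ 2 * (ellipticOp a u x * ellipticOp a (ellipticOp a u) x) := fun x => by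
      rw [e0]; simp only [step]; ring
    simp only [this, sq (ellipticOp a u _)]
    rw [Summable.tsum_add (((sS hu).sub ((sS hA).mul_left _)).sub ((sS hu).mul_left _))
      ((sS hA).mul_left _), Summable.tsum_sub ((sS hu).sub ((sS hA).mul_left _))
      ((sS hu).mul_left _), Summable.tsum_sub (sS hu) ((sS hA).mul_left _), tsum_mul_left,
      tsum_mul_left, tsum_mul_left, ← c]
    ring
  have e2 := mul_le_mul_of_nonneg_left (energy_le ha hA) (sq_nonneg κ)
  have e3 : κ ^ 2 * (4 * d * ∑' x, ellipticOp a u x ^ 2) = κ * ∑' x, ellipticOp a u x ^ 2 := by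
    linear_combination (κ * ∑' x, ellipticOp a u x ^ 2) * hκd
  rw [e3] at e2
  linarith

/-! ### Nash inequality and on-diagonal decay -/

/-- A Poincaré inequality for translations: the shift is a composition of k unit shifts, each
costing at most the square root of the Dirichlet sum in ℓ², so the triangle inequality gives the
factor k². -/
theorem tsum_sq_shift_le {u : Vertex d → ℝ} (hu : (Function.support u).Finite) (k : ℕ)
    (m : Fin d → ℕ) (hm : ∑ i, m i = k) :
    ∑' x, (u (x + fun i => (m i : ℤ)) - u x) ^ 2 ≤ k ^ 2 * ∑' x, ∑ i, grad u (x, i) ^ 2 := by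
  have fin_shift : ∀ v : Vertex d, (Function.support fun x => u (x + v)).Finite := fun v =>
    hu.preimage ((add_left_injective v).injOn)
  have hS2 : ∀ v w : Vertex d, Summable fun x => (u (x + v) - u (x + w)) ^ 2 := fun v w =>
    summable_of_hasFiniteSupport <| ((fin_shift v).union (fin_shift w)).subset fun x hx => by
      by_contra h
      simp only [Set.mem_union, Function.mem_support, not_or, not_not] at h
      exact hx (by simp [h.1, h.2])
  induction k generalizing m with
  | zero =>
    have : (fun i => (m i : ℤ)) = (0 : Vertex d) := by
      funext i
      simpa using Finset.sum_eq_zero_iff.1 hm i (Finset.mem_univ i)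
    simp [this]
  | succ k ih =>
    obtain ⟨i, hi⟩ : ∃ i, m i ≠ 0 := by
      by_contra h
      push Not at h
      simp [h] at hm
    set m' : Fin d → ℕ := Function.update m i (m i - 1) with hm'
    have hmm : ∑ j, m' j = k := by
      have h1 := Finset.add_sum_erase Finset.univ m (Finset.mem_univ i)
      have h2 := Finset.add_sum_erase Finset.univ m' (Finset.mem_univ i)
      have h3 : ∑ j ∈ Finset.univ.erase i, m' j = ∑ j ∈ Finset.univ.erase i, m j :=
        Finset.sum_congr rfl fun j hj => by simp [hm', Finset.ne_of_mem_erase hj]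
      have h4 : m' i = m i - 1 := by simp [hm']
      omega
    set z : Vertex d := fun i => (m' i : ℤ) with hz
    have hzz : (fun i => (m i : ℤ)) = z + basisVec i := by
      funext j
      by_cases hj : j = i
      · subst hj
        simp [hz, hm', basisVec]
        omega
      · simp [hz, hm', basisVec, hj]
    have hA : ∑' x, (u (x + z + basisVec i) - u (x + z)) ^ 2
        ≤ ∑' x, ∑ i, grad u (x, i) ^ 2 := by
      rw [tsum_add_right (fun x => (u (x + basisVec i) - u x) ^ 2) z]
      refine Summable.tsum_le_tsum (fun x => ?_) (by simpa using hS2 (basisVec i) 0)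
        (summable_sum fun j _ => by simpa [grad] using hS2 (basisVec j) 0)
      exact Finset.single_le_sum (f := fun i => grad u (x, i) ^ 2) (fun _ _ => sq_nonneg _)
        (Finset.mem_univ i)
    have hB := ih m' hmm
    rw [hzz]
    simp only [← add_assoc]
    rcases Nat.eq_zero_or_pos k with rfl | hk
    · have hz0 : z = 0 := by
        funext j
        simpa [hz] using Finset.sum_eq_zero_iff.1 hmm j (Finset.mem_univ j)
      simp only [hz0, add_zero] at hA ⊢
      simpa using hA
    · have hk' : (0 : ℝ) < k := Nat.cast_pos.2 hk
      -- Convexity of the square with weights 1/(k+1) and k/(k+1), chosen so that (k+1) +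
      -- ((k+1)/k)·k² = (k+1)².
      have hpt : ∀ x, (u (x + z + basisVec i) - u x) ^ 2 ≤
          (k + 1) * (u (x + z + basisVec i) - u (x + z)) ^ 2
          + ((k + 1) / k) * (u (x + z) - u x) ^ 2 := fun x => by
        have h0 : 0 ≤ (k * (u (x + z + basisVec i) - u (x + z)) - (u (x + z) - u x)) ^ 2 / k := by
          positivity
        have e : (k + 1) * (u (x + z + basisVec i) - u (x + z)) ^ 2
          + ((k + 1) / k) * (u (x + z) - u x) ^ 2 = (u (x + z + basisVec i) - u x) ^ 2 +
          (k * (u (x + z + basisVec i) - u (x + z)) - (u (x + z) - u x)) ^ 2 / k := by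
          field_simp; ring
        linarith
      have s1 : Summable fun x => (u (x + z + basisVec i) - u (x + z)) ^ 2 := by
        simpa only [add_assoc] using hS2 (z + basisVec i) z
      have s2 : Summable fun x => (u (x + z) - u x) ^ 2 := by simpa using hS2 z 0
      have s3 : Summable fun x => (u (x + z + basisVec i) - u x) ^ 2 := by
        simpa only [add_assoc, add_zero] using hS2 (z + basisVec i) 0
      have h := s3.tsum_le_tsum hpt ((s1.mul_left _).add (s2.mul_left _))
      rw [Summable.tsum_add (s1.mul_left _) (s2.mul_left _), tsum_mul_left, tsum_mul_left] at h
      refine h.trans ?_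
      set D := ∑' x, ∑ i, grad u (x, i) ^ 2
      have h1 := mul_le_mul_of_nonneg_left hA (by positivity : (0 : ℝ) ≤ k + 1)
      have h2 := mul_le_mul_of_nonneg_left hB (by positivity : (0 : ℝ) ≤ (k + 1) / k)
      have h3 : ((k : ℝ) + 1) / k * (k ^ 2 * D) = (k + 1) * k * D := by field_simp
      push_cast
      nlinarith

/-- A Nash-type inequality for probability densities. -/
theorem nash_inequality {u : Vertex d → ℝ} (hu : (Function.support u).Finite)
    (hu0 : ∀ x, 0 ≤ u x) (hu1 : ∑' x, u x = 1) (R : ℕ) (hR : 1 ≤ R) :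
    ∑' x, u x ^ 2 ≤ ((R : ℝ) ^ d)⁻¹ + (d * R : ℝ) ^ 2 / 2 * ∑' x, ∑ i, grad u (x, i) ^ 2 := by
  set D := ∑' x, ∑ i, grad u (x, i) ^ 2 with hD
  have hD0 : 0 ≤ D := tsum_nonneg fun x => Finset.sum_nonneg fun i _ => sq_nonneg _
  set z : (Fin d → Fin R) → Vertex d := fun m i => ((m i : ℕ) : ℤ) with hz
  have hzinj : Function.Injective z := fun m m' h => by
    funext i
    have := congrFun h i
    simp only [hz, Nat.cast_inj] at this
    exact Fin.ext this
  have fin_shift : ∀ v : Vertex d, (Function.support fun x => u (x + v)).Finite := fun v =>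
    hu.preimage ((add_left_injective v).injOn)
  have s0 : Summable fun x => u x ^ 2 := summable_of_hasFiniteSupport
    (finite_support_of_local hu fun x h _ _ => by simp [h])
  have sv : ∀ v : Vertex d, Summable fun x => u x * u (x + v) := fun v =>
    summable_of_hasFiniteSupport (finite_support_of_local hu fun x h _ _ => by simp [h])
  have sv2 : ∀ v : Vertex d, Summable fun x => u (x + v) ^ 2 := fun v =>
    summable_of_hasFiniteSupport
      (finite_support_of_local (fin_shift v) fun x h _ _ => by simp [h])
  -- Polarization: ‖u‖² is the correlation with a translate plus half the squared distance to it.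
  -- Translates by a cube of side R are then averaged.
  have key : ∀ v : Vertex d, ∑' x, u x ^ 2 =
      ∑' x, u x * u (x + v) + (∑' x, (u (x + v) - u x) ^ 2) / 2 := fun v => by
    have e : ∀ x, (u (x + v) - u x) ^ 2 = u (x + v) ^ 2 + u x ^ 2 - 2 * (u x * u (x + v)) :=
      fun x => by ring
    simp only [e]
    rw [Summable.tsum_sub ((sv2 v).add s0) ((sv v).mul_left _), Summable.tsum_add (sv2 v) s0,
      tsum_mul_left, tsum_add_right (fun x => u x ^ 2) v]
    ring
  have key2 : ∀ m : Fin d → Fin R, ∑' x, u x ^ 2 ≤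
      ∑' x, u x * u (x + z m) + (d * R : ℝ) ^ 2 / 2 * D := fun m => by
    rw [key (z m)]
    have h := tsum_sq_shift_le hu _ (fun i => (m i : ℕ)) rfl
    have h2 : (((∑ i, (m i : ℕ) : ℕ) : ℝ)) ≤ d * R := by
      have : ∑ i, (m i : ℕ) ≤ ∑ _i : Fin d, R := Finset.sum_le_sum fun i _ => (m i).2.le
      simp only [Finset.sum_const, Finset.card_univ, Fintype.card_fin, smul_eq_mul] at this
      exact_mod_cast this
    have h3 : (((∑ i, (m i : ℕ) : ℕ) : ℝ)) ^ 2 ≤ (d * R : ℝ) ^ 2 := by gcongr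
    have h4 := mul_le_mul_of_nonneg_right h3 hD0
    linarith
  have key3 := Finset.sum_le_sum fun m (_ : m ∈ (Finset.univ : Finset (Fin d → Fin R))) => key2 m
  rw [Finset.sum_add_distrib, ← Summable.tsum_finsetSum fun m _ => sv (z m)] at key3
  simp only [Finset.sum_const, Finset.card_univ, Fintype.card_pi, Fintype.card_fin,
    Finset.prod_const, nsmul_eq_mul, Nat.cast_pow] at key3
  -- The R^d translates of a point are distinct, so together they see at most the total mass 1. This
  -- is where the term R^{-d} comes from.
  have key4 : ∑' x, ∑ m, u x * u (x + z m) ≤ 1 := by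
    rw [← hu1]
    refine Summable.tsum_le_tsum (fun x => ?_) (summable_sum fun m _ => sv _)
      (summable_of_hasFiniteSupport hu)
    rw [← Finset.mul_sum]
    refine mul_le_of_le_one_right (hu0 x) ?_
    rw [← hu1]
    have hi : Function.Injective fun m => x + z m := (add_right_injective x).comp hzinj
    have hsu : Summable u := summable_of_hasFiniteSupport hu
    have := hsu.sum_le_tsum (Finset.univ.map ⟨_, hi⟩) (fun y _ => hu0 y)
    simpa using this
  have hRd : (0 : ℝ) < (R : ℝ) ^ d := by positivity
  rw [← mul_le_mul_iff_right₀ hRd, mul_add, mul_inv_cancel₀ hRd.ne']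
  linarith

/-- At scale R = 2^i, as long as m exceeds 2·2^{-id} each step loses at least c·2^{-id}/4^i. Over
3·4^{p+i} steps the loss is 3c·4^p·2^{-id}, and p is fixed so large that this exceeds the value at
the start. Hence m must drop below the threshold in every fourfold increase of time. -/
theorem decay_of_nash {c : ℝ} (hc : 0 < c) (d : ℕ) :
    ∃ K : ℝ, 0 < K ∧ ∀ m : ℕ → ℝ, Antitone m → (∀ n, m n ≤ 1) →
      (∀ n R : ℕ, 1 ≤ R → c * (m n - ((R : ℝ) ^ d)⁻¹) ≤ (R : ℝ) ^ 2 * (m n - m (n + 1))) →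
      ∀ j n, 4 ^ j ≤ n → m n ≤ K * ((2 : ℝ) ^ (j * d))⁻¹ := by
  obtain ⟨p, hp⟩ : ∃ p : ℕ, 2 * 2 ^ d / (3 * c) < (4 : ℝ) ^ p :=
    pow_unbounded_of_one_lt _ (by norm_num)
  rw [div_lt_iff₀ (by positivity)] at hp
  refine ⟨2 * 2 ^ d * 2 ^ (p * d), by positivity, fun m hm h1 hN => ?_⟩
  have main : ∀ i : ℕ, m (4 ^ (p + i)) ≤ 2 * 2 ^ d * ((2 : ℝ) ^ (i * d))⁻¹ := by
    intro i
    induction i with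
    | zero =>
      refine (h1 _).trans ?_
      have : (1 : ℝ) ≤ 2 ^ d := one_le_pow₀ (by norm_num)
      simp; linarith
    | succ i ih =>
      set q : ℝ := ((2 : ℝ) ^ (i * d))⁻¹ with hq
      have hq0 : 0 < q := by positivity
      have hq1 : 2 * 2 ^ d * ((2 : ℝ) ^ ((i + 1) * d))⁻¹ = 2 * q := by
        rw [add_mul, one_mul, pow_add, hq]; field_simp
      rw [hq1]
      by_contra hcon
      push Not at hcon
      have hdec : ∀ n, n ≤ 4 ^ (p + (i + 1)) → c * q / 4 ^ i ≤ m n - m (n + 1) := fun n hn => by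
        have h2 := hN n (2 ^ i) Nat.one_le_two_pow
        have h3 : (((2 ^ i : ℕ) : ℝ) ^ d)⁻¹ = q := by rw [hq, pow_mul]; norm_num
        have h4 : ((2 ^ i : ℕ) : ℝ) ^ 2 = 4 ^ i := by
          push_cast; rw [← pow_mul, mul_comm, pow_mul]; norm_num
        rw [h3, h4] at h2
        rw [div_le_iff₀ (by positivity)]
        have h5 := hm hn
        have h6 : c * q ≤ c * (m n - q) := by
          apply mul_le_mul_of_nonneg_left _ hc.le
          linarith
        linarith
      have hsum : ∀ k : ℕ, 4 ^ (p + i) + k ≤ 4 ^ (p + (i + 1)) →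
          k * (c * q / 4 ^ i) ≤ m (4 ^ (p + i)) - m (4 ^ (p + i) + k) := by
        intro k
        induction k with
        | zero => simp
        | succ k ihk =>
          intro hk
          have h7 := ihk (by omega)
          have h8 := hdec (4 ^ (p + i) + k) (by omega)
          push_cast
          rw [add_assoc] at h8
          linarith
      have h9 := hsum (3 * 4 ^ (p + i)) (by rw [← add_assoc, pow_succ]; omega)
      have h10 : 4 ^ (p + i) + 3 * 4 ^ (p + i) = 4 ^ (p + (i + 1)) := by
        rw [← add_assoc p, pow_succ]; ring
      rw [h10] at h9
      have h11 : ((3 * 4 ^ (p + i) : ℕ) : ℝ) * (c * q / 4 ^ i) = 4 ^ p * (3 * c) * q := by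
        push_cast; rw [pow_add]; field_simp
      rw [h11] at h9
      have h12 := mul_lt_mul_of_pos_right hp hq0
      linarith
  intro j n hn
  rcases lt_or_ge j p with hj | hj
  · refine (h1 n).trans ?_
    rw [← div_eq_mul_inv, le_div_iff₀ (by positivity), one_mul]
    have h2 : (2 : ℝ) ^ (j * d) ≤ 2 ^ (p * d) :=
      pow_le_pow_right₀ (by norm_num) (Nat.mul_le_mul_right d hj.le)
    have h3 : (1 : ℝ) ≤ 2 ^ d := one_le_pow₀ (by norm_num)
    have h4 : (0 : ℝ) < 2 ^ (p * d) := by positivity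
    nlinarith
  · obtain ⟨i, rfl⟩ := Nat.exists_eq_add_of_le hj
    refine (hm hn).trans ((main i).trans (le_of_eq ?_))
    rw [add_mul, pow_add]; field_simp

/-- On-diagonal decay of the transition probabilities. -/
theorem exists_heat_sq_le (hd : 0 < d) {lam : ℝ} (hlam : 0 < lam) :
    ∃ K : ℝ, 0 < K ∧ ∀ a : Edge d → ℝ, UnifElliptic lam a → ∀ y j n, 4 ^ j ≤ n →
      ∑' x, heat a n y x ^ 2 ≤ K * ((2 : ℝ) ^ (j * d))⁻¹ := by
  have hd' : (0 : ℝ) < d := Nat.cast_pos.2 hd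
  -- The constant combines (dR)²/2 from the Nash inequality, 8d from the dissipation and 1/lam from
  -- ellipticity.
  obtain ⟨K, hK, h⟩ := decay_of_nash (c := lam / (4 * d ^ 3)) (by positivity) d
  refine ⟨K, hK, fun a ha y => ?_⟩
  have ha' : ∀ e, 0 ≤ a e ∧ a e ≤ 1 := fun e => ⟨hlam.le.trans (ha e).1, (ha e).2⟩
  have hstep : ∀ n, ∑' x, heat a (n + 1) y x ^ 2 + (8 * d : ℝ)⁻¹ * energy a (heat a n y)
      ≤ ∑' x, heat a n y x ^ 2 := fun n => by
    rw [heat_succ]; exact tsum_sq_step hd ha' (heat_finite a n y)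
  refine h (fun n => ∑' x, heat a n y x ^ 2) (antitone_nat_of_succ_le fun n => ?_) (fun n => ?_)
    (fun n R hR => ?_)
  · have := hstep n
    have := energy_nonneg ha' (heat a n y)
    have : 0 ≤ (8 * d : ℝ)⁻¹ * energy a (heat a n y) := by positivity
    linarith
  · rw [← tsum_heat a n y]
    refine Summable.tsum_le_tsum (fun x => ?_) (summable_of_hasFiniteSupport
      (finite_support_of_local (heat_finite a n y) fun x h _ _ => by simp [h]))
      (summable_of_hasFiniteSupport (heat_finite a n y))
    have h0 := heat_nonneg hd ha' n y x
    have h1 := heat_le_one hd ha' n y x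
    nlinarith
  · have h1 := nash_inequality (heat_finite a n y) (heat_nonneg hd ha' n y) (tsum_heat a n y) R hR
    have h2 : lam * ∑' x, ∑ i, grad (heat a n y) (x, i) ^ 2 ≤ energy a (heat a n y) := by
      rw [energy, ← tsum_mul_left]
      refine Summable.tsum_le_tsum (fun x => ?_) (summable_of_hasFiniteSupport
        (finite_support_of_local (heat_finite a n y) fun x h h' _ => by simp [grad, h, h']))
        (summable_of_hasFiniteSupport
        (finite_support_of_local (heat_finite a n y) fun x h h' _ => by simp [grad, h, h']))
      rw [Finset.mul_sum]
      exact Finset.sum_le_sum fun i _ => mul_le_mul_of_nonneg_right (ha _).1 (sq_nonneg _)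
    have h3 := hstep n
    set M := ∑' x, heat a n y x ^ 2
    set D := ∑' x, ∑ i, grad (heat a n y) (x, i) ^ 2
    set M' := ∑' x, heat a (n + 1) y x ^ 2
    set E := energy a (heat a n y)
    have h4 : (8 * d : ℝ)⁻¹ * E ≤ M - M' := by linarith
    have h5 : lam / (4 * d ^ 3) * (M - ((R : ℝ) ^ d)⁻¹) ≤
        lam / (4 * d ^ 3) * ((d * R : ℝ) ^ 2 / 2 * D) :=
      mul_le_mul_of_nonneg_left (by linarith) (by positivity)
    have h6 : lam / (4 * d ^ 3) * ((d * R : ℝ) ^ 2 / 2 * D)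
        = (R : ℝ) ^ 2 * ((8 * d : ℝ)⁻¹ * (lam * D)) := by field_simp; ring
    rw [h6] at h5
    refine h5.trans (mul_le_mul_of_nonneg_left (le_trans ?_ h4) (by positivity))
    exact mul_le_mul_of_nonneg_left h2 (by positivity)

/-! ### Exponentially weighted estimates -/

/-- The exponential weight with rate `γ` centred at `y`. -/
noncomputable def expWeight (γ : ℝ) (y x : Vertex d) : ℝ := Real.exp (γ * nrm (x - y))

theorem expWeight_pos (γ : ℝ) (y x : Vertex d) : 0 < expWeight γ y x := Real.exp_pos _

theorem abs_nrm_add_basisVec_sub (x : Vertex d) (i : Fin d) :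
    |(nrm (x + basisVec i) : ℝ) - nrm x| ≤ 1 := by
  have h1 := nrm_add_le x (basisVec i)
  have h2 := nrm_add_le (x + basisVec i) (-basisVec i)
  rw [nrm_neg, add_neg_cancel_right] at h2
  rw [nrm_basisVec] at h1 h2
  have h1' : (nrm (x + basisVec i) : ℝ) ≤ nrm x + 1 := by exact_mod_cast h1
  have h2' : (nrm x : ℝ) ≤ nrm (x + basisVec i) + 1 := by exact_mod_cast h2
  rw [abs_le]
  constructor <;> linarith

/-- One lattice step changes the exponent by t with |t| ≤ γ ≤ 1, so (e^t - 1)² ≤ 4γ² and 1 ≤ 3e^t.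
Their product is the 12γ², the value of δ that `weighted_step` requires. -/
theorem expWeight_sq_sub_le {γ : ℝ} (h0 : 0 ≤ γ) (h1 : γ ≤ 1) (y x : Vertex d) (i : Fin d) :
    (expWeight γ y (x + basisVec i) - expWeight γ y x) ^ 2 ≤
      12 * γ ^ 2 * (expWeight γ y x * expWeight γ y (x + basisVec i)) := by
  set t : ℝ := γ * ((nrm (x - y + basisVec i) : ℝ) - nrm (x - y)) with ht
  have hx : expWeight γ y (x + basisVec i) = expWeight γ y x * Real.exp t := by
    rw [expWeight, expWeight, ← Real.exp_add, ht, show x + basisVec i - y = x - y + basisVec i by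
      abel]
    congr 1; ring
  have ht1 : |t| ≤ γ := by
    rw [ht, abs_mul, abs_of_nonneg h0]
    exact mul_le_of_le_one_right h0 (abs_nrm_add_basisVec_sub _ _)
  have h2 : |Real.exp t - 1| ≤ 2 * |t| := Real.abs_exp_sub_one_le (ht1.trans h1)
  have h3 : (Real.exp t - 1) ^ 2 ≤ 4 * γ ^ 2 := by
    rw [← sq_abs]
    calc |Real.exp t - 1| ^ 2 ≤ (2 * γ) ^ 2 := by gcongr; linarith
      _ = 4 * γ ^ 2 := by ring
  have h4 : 1 ≤ 3 * Real.exp t := by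
    have h5 : Real.exp (-t) ≤ 3 := by
      refine (Real.exp_le_exp.2 ((neg_le_abs t).trans (ht1.trans h1))).trans ?_
      linarith [Real.exp_one_lt_d9]
    calc (1 : ℝ) = Real.exp (-t) * Real.exp t := by rw [← Real.exp_add]; simp
      _ ≤ 3 * Real.exp t := by gcongr
  rw [hx]
  have h6 : 0 ≤ expWeight γ y x ^ 2 := sq_nonneg _
  calc (expWeight γ y x * Real.exp t - expWeight γ y x) ^ 2
      = expWeight γ y x ^ 2 * (Real.exp t - 1) ^ 2 := by ring
    _ ≤ expWeight γ y x ^ 2 * (4 * γ ^ 2) := by gcongr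
    _ ≤ expWeight γ y x ^ 2 * (4 * γ ^ 2) * (3 * Real.exp t) :=
        le_mul_of_one_le_right (by positivity) h4
    _ = _ := by ring

theorem summable_expWeight_mul_heat_sq (γ : ℝ) (a : Edge d → ℝ) (n : ℕ) (y : Vertex d) :
    Summable fun x => expWeight γ y x * heat a n y x ^ 2 :=
  summable_of_hasFiniteSupport
    (finite_support_of_local (heat_finite a n y) fun x h _ _ => by simp [h])

theorem weighted_heat_step (hd : 0 < d) {lam : ℝ} (hlam : 0 < lam) {a : Edge d → ℝ}
    (ha : UnifElliptic lam a) {γ : ℝ} (h0 : 0 ≤ γ) (h1 : γ ≤ 1) (y : Vertex d) (n : ℕ) :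
    ∑' x, expWeight γ y x * heat a (n + 1) y x ^ 2 + lam * (16 * d : ℝ)⁻¹ *
      ∑' x, ∑ i, expWeight γ y x * grad (heat a n y) (x, i) ^ 2 ≤
      (1 + 12 * γ ^ 2) * ∑' x, expWeight γ y x * heat a n y x ^ 2 := by
  have ha' : ∀ e, 0 ≤ a e ∧ a e ≤ 1 := fun e => ⟨hlam.le.trans (ha e).1, (ha e).2⟩
  have h := weighted_step hd ha' (heat_finite a n y) (expWeight_pos γ y)
    (expWeight_sq_sub_le h0 h1 y)
  rw [← heat_succ] at h
  refine le_trans ?_ h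
  have : lam * ∑' x, ∑ i, expWeight γ y x * grad (heat a n y) (x, i) ^ 2 ≤
      ∑' x, ∑ i, a (x, i) * (expWeight γ y x + expWeight γ y (x + basisVec i)) *
        grad (heat a n y) (x, i) ^ 2 := by
    rw [← tsum_mul_left]
    refine Summable.tsum_le_tsum (fun x => ?_) (summable_of_hasFiniteSupport
        (finite_support_of_local (heat_finite a n y) fun x h h' _ => by simp [grad, h, h']))
        (summable_of_hasFiniteSupport
        (finite_support_of_local (heat_finite a n y) fun x h h' _ => by simp [grad, h, h']))
    rw [Finset.mul_sum]
    refine Finset.sum_le_sum fun i _ => ?_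
    rw [← mul_assoc]
    refine mul_le_mul_of_nonneg_right ?_ (sq_nonneg _)
    refine mul_le_mul (ha _).1 ?_ (expWeight_pos _ _ _).le (ha' _).1
    linarith [expWeight_pos γ y (x + basisVec i)]
  have h2 := mul_le_mul_of_nonneg_left this (by positivity : 0 ≤ (4 * d : ℝ)⁻¹ / 4)
  refine add_le_add_right (le_trans (le_of_eq ?_) h2) _
  rw [mul_inv, mul_inv]; ring

/-- Drops the dissipation in `weighted_heat_step` and iterates. Over k ≲ γ⁻² steps the growth factor
is bounded by a constant, which is the parabolic scaling behind the choice γ = 2^{-j} at times of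
order 4^j. -/
theorem weighted_heat_growth (hd : 0 < d) {lam : ℝ} (hlam : 0 < lam) {a : Edge d → ℝ}
    (ha : UnifElliptic lam a) {γ : ℝ} (h0 : 0 ≤ γ) (h1 : γ ≤ 1) (y : Vertex d) (n k : ℕ) :
    ∑' x, expWeight γ y x * heat a (n + k) y x ^ 2 ≤
      Real.exp (12 * γ ^ 2 * k) * ∑' x, expWeight γ y x * heat a n y x ^ 2 := by
  induction k with
  | zero => simp
  | succ k ih =>
    have h := weighted_heat_step hd hlam ha h0 h1 y (n + k)
    have hE : 0 ≤ ∑' x, ∑ i, expWeight γ y x * grad (heat a (n + k) y) (x, i) ^ 2 :=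
      tsum_nonneg fun x => Finset.sum_nonneg fun i _ =>
        mul_nonneg (expWeight_pos _ _ _).le (sq_nonneg _)
    have hE' : 0 ≤ lam * (16 * d : ℝ)⁻¹ *
      ∑' x, ∑ i, expWeight γ y x * grad (heat a (n + k) y) (x, i) ^ 2 := by positivity
    rw [← add_assoc]
    have h2 : 1 + 12 * γ ^ 2 ≤ Real.exp (12 * γ ^ 2) := by
      linarith [Real.add_one_le_exp (12 * γ ^ 2)]
    calc _ ≤ (1 + 12 * γ ^ 2) * ∑' x, expWeight γ y x * heat a (n + k) y x ^ 2 := by linarith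
      _ ≤ Real.exp (12 * γ ^ 2) * (Real.exp (12 * γ ^ 2 * k) *
          ∑' x, expWeight γ y x * heat a n y x ^ 2) :=
        mul_le_mul h2 ih (tsum_nonneg fun x => mul_nonneg (expWeight_pos _ _ _).le (sq_nonneg _))
          (Real.exp_pos _).le
      _ = _ := by
        rw [← mul_assoc, ← Real.exp_add]; push_cast; congr 2; ring

/-- Off-diagonal decay of the transition probabilities in weighted `ℓ²`. -/
theorem exists_weighted_heat_le (hd : 0 < d) {lam : ℝ} (hlam : 0 < lam) :
    ∃ B : ℝ, 0 < B ∧ ∀ a : Edge d → ℝ, UnifElliptic lam a → ∀ y j n, 4 ^ j ≤ n → n ≤ 4 ^ (j + 2) →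
      ∑' x, expWeight ((2 ^ j)⁻¹) y x * heat a n y x ^ 2 ≤ B * ((2 : ℝ) ^ (j * d))⁻¹ := by
  obtain ⟨K, hK, hon⟩ := exists_heat_sq_le hd hlam
  set E : ℝ := Real.exp (12 * 16) with hE
  have hE0 : 0 < E := Real.exp_pos _
  have h4 : ∀ j : ℕ, (((2 : ℝ) ^ j)⁻¹) ^ 2 = (4 ^ j)⁻¹ := fun j => by
    rw [inv_pow, ← pow_mul, mul_comm, pow_mul]; norm_num
  have hγ1 : ∀ j : ℕ, ((2 : ℝ) ^ j)⁻¹ ≤ 1 := fun j => inv_le_one_of_one_le₀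
    (one_le_pow₀ (by norm_num))
  -- The summand E covers scale 0, where n ≤ 16. The summand K(E·2^d)² closes the induction.
  refine ⟨K * (E * 2 ^ d) ^ 2 + E, by positivity, fun a ha y j => ?_⟩
  set B : ℝ := K * (E * 2 ^ d) ^ 2 + E with hB
  induction j with
  | zero =>
    intro n _ hn
    have h := weighted_heat_growth hd hlam ha (zero_le_one (α := ℝ)) le_rfl y 0 n
    have h0 : ∑' x, expWeight 1 y x * heat a 0 y x ^ 2 = 1 := by
      have : ∀ x, expWeight 1 y x * heat a 0 y x ^ 2
          = dirac (x - y) * expWeight 1 y x := fun x => by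
        rw [heat_zero, dirac]; split_ifs <;> simp
      simp only [this, tsum_dirac_mul]
      simp [expWeight, nrm]
    rw [h0, zero_add, mul_one] at h
    simp only [pow_zero, inv_one, zero_mul, mul_one]
    have hEB : E ≤ B := by
      have : 0 < K * (E * 2 ^ d) ^ 2 := by positivity
      rw [hB]; linarith
    refine h.trans (le_trans (Real.exp_le_exp.2 ?_) hEB)
    have : (n : ℝ) ≤ 16 := by exact_mod_cast (by simpa using hn)
    linarith
  | succ j ih =>
    intro n hn1 hn2
    have hn0 : 4 ^ j ≤ n := le_trans (Nat.pow_le_pow_right (by norm_num) (Nat.le_succ j)) hn1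
    obtain ⟨k, rfl⟩ := Nat.exists_eq_add_of_le hn0
    set γ : ℝ := (2 ^ (j + 1))⁻¹ with hγ
    have hg := weighted_heat_growth hd hlam ha (by positivity : 0 ≤ γ) (hγ1 _) y (4 ^ j) k
    -- The evolution restarts at time 4^j, and the remaining k ≤ 16·4^{j+1} steps cost at most E at
    -- rate γ = 2^{-(j+1)}.
    have hexp : Real.exp (12 * γ ^ 2 * k) ≤ E := by
      rw [hE, Real.exp_le_exp, mul_assoc]
      refine mul_le_mul_of_nonneg_left ?_ (by norm_num)
      rw [hγ, h4, inv_mul_le_iff₀ (by positivity)]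
      have : k ≤ 4 ^ (j + 1) * 16 := by
        have : 4 ^ (j + 1 + 2) = 4 ^ (j + 1) * 16 := by rw [pow_add]; norm_num
        omega
      exact_mod_cast this
    set q : ℝ := ((2 : ℝ) ^ (j * d))⁻¹ with hq
    have hq0 : 0 < q := by positivity
    have hq1 : B * ((2 : ℝ) ^ ((j + 1) * d))⁻¹ = B * q / 2 ^ d := by
      rw [add_mul j, one_mul, pow_add, hq]; field_simp
    have i1 := ih (4 ^ j) le_rfl (Nat.pow_le_pow_right (by norm_num) (by omega))
    have i2 := hon a ha y j (4 ^ j) le_rfl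
    rw [← hq] at i2
    -- With this Young parameter the contribution of the previous scale is exactly half of the
    -- target, despite the growth factor E and the loss 2^d in the decay.
    set t : ℝ := (E * 2 ^ d)⁻¹ with ht
    have ht0 : 0 < t := by positivity
    -- Halving the rate takes the square root of the weight. The new weighted norm is therefore
    -- interpolated between the weighted norm at scale j and the unweighted on-diagonal bound.
    have hsq : ∀ x, expWeight ((2 ^ j)⁻¹) y x = expWeight γ y x ^ 2 := fun x => by
      rw [expWeight, expWeight, ← Real.exp_nat_mul, hγ, pow_succ]
      congr 1
      push_cast
      field_simp
    have hcs : ∑' x, expWeight γ y x * heat a (4 ^ j) y x ^ 2 ≤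
        t / 2 * ∑' x, expWeight ((2 ^ j)⁻¹) y x * heat a (4 ^ j) y x ^ 2
        + t⁻¹ / 2 * ∑' x, heat a (4 ^ j) y x ^ 2 := by
      have s2 : Summable fun x => heat a (4 ^ j) y x ^ 2 := summable_of_hasFiniteSupport
        (finite_support_of_local (heat_finite a (4 ^ j) y) fun x h _ _ => by simp [h])
      rw [← tsum_mul_left, ← tsum_mul_left, ← Summable.tsum_add
        ((summable_expWeight_mul_heat_sq _ _ _ _).mul_left _) (s2.mul_left _)]
      refine Summable.tsum_le_tsum (fun x => ?_) (summable_expWeight_mul_heat_sq _ _ _ _)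
        (((summable_expWeight_mul_heat_sq _ _ _ _).mul_left _).add (s2.mul_left _))
      rw [hsq]
      have h1 : expWeight γ y x ≤ t / 2 * expWeight γ y x ^ 2 + t⁻¹ / 2 := by
        have : 0 ≤ (t * expWeight γ y x - 1) ^ 2 / (2 * t) := by positivity
        have e : (t * expWeight γ y x - 1) ^ 2 / (2 * t)
          = t / 2 * expWeight γ y x ^ 2 + t⁻¹ / 2 - expWeight γ y x := by field_simp; ring
        linarith
      have h2 := mul_le_mul_of_nonneg_right h1 (sq_nonneg (heat a (4 ^ j) y x))
      linarith
    rw [hq1]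
    have hW0 : 0 ≤ ∑' x, expWeight γ y x * heat a (4 ^ j) y x ^ 2 :=
      tsum_nonneg fun x => mul_nonneg (expWeight_pos _ _ _).le (sq_nonneg _)
    calc _ ≤ E * (t / 2 * (B * q) + t⁻¹ / 2 * (K * q)) := by
          refine hg.trans (mul_le_mul hexp (hcs.trans ?_) hW0 hE0.le)
          gcongr
      _ = (B + K * (E * 2 ^ d) ^ 2) / 2 * q / 2 ^ d := by
          rw [ht]; field_simp
      _ ≤ B * q / 2 ^ d := by
          have : K * (E * 2 ^ d) ^ 2 ≤ B := by rw [hB]; linarith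
          gcongr
          linarith

/-- Weighted bound for the gradient of the transition probabilities, summed over a dyadic block of
times. -/
theorem exists_weighted_energy_le (hd : 0 < d) {lam : ℝ} (hlam : 0 < lam) :
    ∃ B : ℝ, 0 < B ∧ ∀ a : Edge d → ℝ, UnifElliptic lam a → ∀ y j,
      ∑ k ∈ Finset.Ico (4 ^ j) (4 ^ (j + 2)),
        ∑' x, ∑ i, expWeight ((2 ^ j)⁻¹) y x * grad (heat a k y) (x, i) ^ 2
        ≤ B * ((2 : ℝ) ^ (j * d))⁻¹ := by
  obtain ⟨B, hB, hW⟩ := exists_weighted_heat_le hd hlam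
  have hd' : (0 : ℝ) < d := Nat.cast_pos.2 hd
  -- 193 = 1 + 12·16: one from the telescoped initial value, and at most 16·4^j times the error 12γ²
  -- with γ² = 4^{-j}.
  refine ⟨(lam * (16 * d : ℝ)⁻¹)⁻¹ * (193 * B), by positivity, fun a ha y j => ?_⟩
  set γ : ℝ := (2 ^ j)⁻¹ with hγ
  have hγ1 : γ ≤ 1 := inv_le_one_of_one_le₀ (one_le_pow₀ (by norm_num))
  have hγ4 : γ ^ 2 = (4 ^ j)⁻¹ := by
    rw [hγ, inv_pow, ← pow_mul, mul_comm, pow_mul]; norm_num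
  set q : ℝ := ((2 : ℝ) ^ (j * d))⁻¹ with hq
  set c := lam * (16 * d : ℝ)⁻¹ with hc
  have hc0 : 0 < c := by positivity
  rw [mul_assoc, ← div_eq_inv_mul, le_div_iff₀ hc0, mul_comm, Finset.mul_sum]
  set W : ℕ → ℝ := fun n => ∑' x, expWeight γ y x * heat a n y x ^ 2 with hWdef
  have hW0 : ∀ n, 0 ≤ W n := fun n =>
    tsum_nonneg fun x => mul_nonneg (expWeight_pos _ _ _).le (sq_nonneg _)
  have hle : 4 ^ j ≤ 4 ^ (j + 2) := Nat.pow_le_pow_right (by norm_num) (by omega)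
  have h1 : ∀ k ∈ Finset.Ico (4 ^ j) (4 ^ (j + 2)),
      c * ∑' x, ∑ i, expWeight γ y x * grad (heat a k y) (x, i) ^ 2
      ≤ (W k - W (k + 1)) + 12 * γ ^ 2 * (B * q) := fun k hk => by
    rw [Finset.mem_Ico] at hk
    have h2 := weighted_heat_step hd hlam ha (by positivity : 0 ≤ γ) hγ1 y k
    have h3 : W k ≤ B * q := hW a ha y j k hk.1 hk.2.le
    have h4 := mul_le_mul_of_nonneg_left h3 (by positivity : 0 ≤ 12 * γ ^ 2)
    simp only [hWdef] at h4 ⊢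
    linarith
  refine (Finset.sum_le_sum h1).trans ?_
  rw [Finset.sum_add_distrib, Finset.sum_const, Nat.card_Ico, nsmul_eq_mul]
  have h5 : ∑ k ∈ Finset.Ico (4 ^ j) (4 ^ (j + 2)), (W k - W (k + 1))
      = W (4 ^ j) - W (4 ^ (j + 2)) := by
    rw [← neg_inj, ← Finset.sum_neg_distrib]
    simp only [neg_sub]
    exact Finset.sum_Ico_sub W hle
  have h6 : W (4 ^ j) ≤ B * q := hW a ha y j _ le_rfl hle
  have h7 : ((4 ^ (j + 2) - 4 ^ j : ℕ) : ℝ) ≤ 16 * 4 ^ j := by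
    have : 4 ^ (j + 2) - 4 ^ j ≤ 16 * 4 ^ j := by rw [pow_add]; omega
    exact_mod_cast this
  have h8 : ((4 ^ (j + 2) - 4 ^ j : ℕ) : ℝ) * (12 * γ ^ 2 * (B * q)) ≤ 192 * (B * q) := by
    calc _ ≤ 16 * 4 ^ j * (12 * γ ^ 2 * (B * q)) := by gcongr
      _ = 192 * (B * q) := by rw [hγ4]; field_simp; ring
  rw [h5]
  linarith [hW0 (4 ^ (j + 2))]

/-! ### Dyadic sums -/

theorem sum_range_four_pow (f : ℕ → ℝ) (J : ℕ) :
    ∑ n ∈ Finset.range (4 ^ (J + 1)), f n = ∑ n ∈ Finset.range 4, f n +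
      ∑ j ∈ Finset.range J, ∑ n ∈ Finset.Ico (4 ^ (j + 1)) (4 ^ (j + 2)), f n := by
  induction J with
  | zero => simp
  | succ J ih =>
    rw [Finset.sum_range_succ _ J, ← add_assoc, ← ih,
      Finset.sum_range_add_sum_Ico _ (Nat.pow_le_pow_right (by norm_num) (by omega))]

theorem summable_of_four_pow_blocks {f : ℕ → ℝ} (hf : ∀ n, 0 ≤ f n) {b : ℕ → ℝ} (hb : Summable b)
    (h : ∀ j, ∑ n ∈ Finset.Ico (4 ^ (j + 1)) (4 ^ (j + 2)), f n ≤ b j) : Summable f := by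
  have hb0 : ∀ j, 0 ≤ b j := fun j => (Finset.sum_nonneg fun n _ => hf n).trans (h j)
  refine summable_of_sum_range_le (c := ∑ n ∈ Finset.range 4, f n + ∑' j, b j) hf fun n => ?_
  have hn : n ≤ 4 ^ (n + 1) := (Nat.lt_pow_self (by norm_num)).le.trans
    (Nat.pow_le_pow_right (by norm_num) (Nat.le_succ n))
  refine (Finset.sum_le_sum_of_subset_of_nonneg (Finset.range_mono hn) fun i _ _ => hf i).trans ?_
  rw [sum_range_four_pow]
  exact add_le_add_right ((Finset.sum_le_sum fun j _ => h j).trans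
    (hb.sum_le_tsum _ fun j _ => hb0 j)) _

theorem sum_half_pow_le (J : ℕ) : ∑ j ∈ Finset.range J, ((2 : ℝ) ^ j)⁻¹ ≤ 2 := by
  have := sum_geometric_two_le J
  simpa only [one_div, inv_pow] using this

/-- The terms decay geometrically away from 2^j ≈ r. The correction -1/r makes the induction on J
close: replacing r by r/2 doubles it, and the surplus 1/r pays for the term j = 0. -/
theorem sum_min_two_pow_le (J : ℕ) {r : ℝ} (hr : 1 ≤ r) :
    ∑ j ∈ Finset.range J, min (r / 2 ^ j) (2 ^ j / r) ≤ 4 - 1 / r := by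
  induction J generalizing r with
  | zero =>
    have : 1 / r ≤ 1 := by rw [div_le_one (by linarith)]; exact hr
    simp only [Finset.range_zero, Finset.sum_empty]
    linarith
  | succ J ih =>
    have hr0 : 0 < r := by linarith
    rw [Finset.sum_range_succ']
    have e : ∀ j : ℕ, min (r / 2 ^ (j + 1)) (2 ^ (j + 1) / r)
        = min (r / 2 / 2 ^ j) (2 ^ j / (r / 2)) := fun j => by
      congr 1
      · rw [pow_succ]; field_simp
      · rw [pow_succ]; field_simp
    simp only [e, pow_zero, div_one]
    have h0 : min r (1 / r) ≤ 1 / r := min_le_right _ _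
    rcases le_or_gt 2 r with h2 | h2
    · have := ih (r := r / 2) (by linarith)
      have e2 : 1 / (r / 2) = 2 * (1 / r) := by field_simp
      rw [e2] at this
      linarith
    · have h1 : ∑ j ∈ Finset.range J, min (r / 2 / 2 ^ j) (2 ^ j / (r / 2)) ≤ r := by
        calc _ ≤ ∑ j ∈ Finset.range J, r / 2 * ((2 : ℝ) ^ j)⁻¹ :=
              Finset.sum_le_sum fun j _ => by rw [← div_eq_mul_inv]; exact min_le_left _ _
          _ = r / 2 * ∑ j ∈ Finset.range J, ((2 : ℝ) ^ j)⁻¹ := by rw [Finset.mul_sum]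
          _ ≤ r / 2 * 2 := by gcongr; exact sum_half_pow_le J
          _ = r := by ring
      have h3 : r + 2 * (1 / r) ≤ 4 := by
        rw [show r + 2 * (1 / r) = (r ^ 2 + 2) / r by field_simp, div_le_iff₀ hr0]
        nlinarith
      linarith

/-- Summing Gaussian-type bounds over dyadic scales gives a power law. -/
theorem exists_dyadic_sum_le (p : ℕ) (hp : 1 ≤ p) : ∃ C : ℝ, 0 < C ∧ ∀ ρ J : ℕ,
    ∑ j ∈ Finset.range J, ((2 : ℝ) ^ (j * p))⁻¹ * Real.exp (-((2 ^ j)⁻¹ * ρ / 2)) ≤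
      C * (((ρ : ℝ) + 1) ^ p)⁻¹ := by
  set F : ℝ := (p + 1).factorial * 2 ^ (p + 1) with hF
  have hF1 : 1 ≤ F := by
    have h1 : (1 : ℝ) ≤ (p + 1).factorial := by exact_mod_cast (Nat.factorial_pos _)
    have h2 : (1 : ℝ) ≤ 2 ^ (p + 1) := one_le_pow₀ (by norm_num)
    rw [hF]; nlinarith
  have hF0 : 0 < F := by linarith
  refine ⟨2 * F * 4, by positivity, fun ρ J => ?_⟩
  set r : ℝ := (ρ : ℝ) + 1 with hr
  have hr1 : 1 ≤ r := by rw [hr]; linarith [(Nat.cast_nonneg ρ : (0 : ℝ) ≤ ρ)]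
  have hr0 : 0 < r := by linarith
  have hterm : ∀ j : ℕ, ((2 : ℝ) ^ (j * p))⁻¹ * Real.exp (-((2 ^ j)⁻¹ * ρ / 2)) ≤
      2 * F * (r ^ p)⁻¹ * min (r / 2 ^ j) (2 ^ j / r) := fun j => by
    set t : ℝ := r / 2 ^ j with ht
    have h2j : (0 : ℝ) < 2 ^ j := by positivity
    have h2j1 : (1 : ℝ) ≤ 2 ^ j := one_le_pow₀ (by norm_num)
    have ht0 : 0 < t := by positivity
    have e1 : (2 : ℝ) ^ j / r = t⁻¹ := by rw [ht, inv_div]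
    have e2 : ((2 : ℝ) ^ (j * p))⁻¹ = (r ^ p)⁻¹ * t ^ p := by
      rw [ht, div_pow, ← pow_mul]; field_simp
    -- Replacing ρ by r = ρ + 1 in the exponent costs a factor e^{1/2^{j+1}} ≤ 2, and keeps r ≥ 1
    -- also at ρ = 0.
    have e3 : Real.exp (-((2 ^ j)⁻¹ * ρ / 2)) ≤ 2 * Real.exp (-(t / 2)) := by
      have : -((2 ^ j)⁻¹ * ρ / 2) = (2 ^ j)⁻¹ / 2 + -(t / 2) := by
        rw [ht, hr]; field_simp; ring
      rw [this, Real.exp_add]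
      refine mul_le_mul_of_nonneg_right ?_ (Real.exp_pos _).le
      have h3 : ((2 : ℝ) ^ j)⁻¹ ≤ 1 := inv_le_one_of_one_le₀ h2j1
      have h4 : |Real.exp ((2 ^ j)⁻¹ / 2) - 1| ≤ 2 * |((2 : ℝ) ^ j)⁻¹ / 2| :=
        Real.abs_exp_sub_one_le (by rw [abs_of_nonneg (by positivity)]; linarith)
      rw [abs_of_nonneg (by positivity : (0 : ℝ) ≤ (2 ^ j)⁻¹ / 2)] at h4
      linarith [le_abs_self (Real.exp ((2 ^ j)⁻¹ / 2) - 1)]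
    -- For t ≤ 1 the power gives decay, since p ≥ 1. For t > 1 one term of the exponential series,
    -- of order p + 1, gives t^{p+1} ≤ F e^{t/2}, hence the choice of F.
    have e4 : t ^ p * Real.exp (-(t / 2)) ≤ F * min t t⁻¹ := by
      rw [Real.exp_neg, ← div_eq_mul_inv, div_le_iff₀ (Real.exp_pos _)]
      have h5 : (t / 2) ^ (p + 1) / (p + 1).factorial ≤ Real.exp (t / 2) :=
        Real.pow_div_factorial_le_exp _ (by positivity) _
      have h6 : t ^ (p + 1) ≤ F * Real.exp (t / 2) := by
        rw [div_le_iff₀ (by positivity), div_pow, div_le_iff₀ (by positivity)] at h5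
        rw [hF]; linarith
      rcases le_or_gt t 1 with h1 | h1
      · rw [min_eq_left (h1.trans (one_le_inv_iff₀.2 ⟨ht0, h1⟩))]
        have h7 : t ^ p ≤ t := pow_le_of_le_one ht0.le h1 (by omega)
        have h8 : 1 ≤ Real.exp (t / 2) := Real.one_le_exp (by positivity)
        calc t ^ p ≤ 1 * t * 1 := by linarith
          _ ≤ F * t * Real.exp (t / 2) := by gcongr
      · rw [min_eq_right ((inv_le_one_of_one_le₀ h1.le).trans h1.le)]
        rw [mul_right_comm, ← div_eq_mul_inv, le_div_iff₀ ht0, ← pow_succ]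
        exact h6
    rw [e1, e2]
    calc (r ^ p)⁻¹ * t ^ p * Real.exp (-((2 ^ j)⁻¹ * ρ / 2))
        ≤ (r ^ p)⁻¹ * t ^ p * (2 * Real.exp (-(t / 2))) := by gcongr
      _ = 2 * (r ^ p)⁻¹ * (t ^ p * Real.exp (-(t / 2))) := by ring
      _ ≤ 2 * (r ^ p)⁻¹ * (F * min t t⁻¹) := by gcongr
      _ = 2 * F * (r ^ p)⁻¹ * min t t⁻¹ := by ring
  refine (Finset.sum_le_sum fun j _ => hterm j).trans ?_
  rw [← Finset.mul_sum]
  have h9 : ∑ j ∈ Finset.range J, min (r / 2 ^ j) (2 ^ j / r) ≤ 4 :=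
    (sum_min_two_pow_le J hr1).trans (by have : 0 ≤ 1 / r := by positivity
                                         linarith)
  calc _ ≤ 2 * F * (r ^ p)⁻¹ * 4 := by gcongr
    _ = _ := by ring

/-! ### Gradients via the Chapman–Kolmogorov identity -/

theorem summable_heat_mul (a : Edge d → ℝ) (n : ℕ) (y : Vertex d) (f : Vertex d → ℝ) :
    Summable fun z => f z * heat a n y z :=
  summable_of_hasFiniteSupport
    (finite_support_of_local (heat_finite a n y) fun x h _ _ => by simp [h])

/-- The gradient falls on the factor whose pole is the summation variable; symmetry of the
transition probabilities permits this. That is the form in which stationarity becomes useful. -/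
theorem grad_heat_add (a : Edge d → ℝ) (k l : ℕ) (y : Vertex d) (e : Edge d) :
    grad (heat a (k + l) y) e = ∑' z, grad (heat a k z) e * heat a l y z := by
  have h : ∀ x, heat a (k + l) y x = ∑' z, heat a k z x * heat a l y z := fun x => by
    rw [← tsum_heat_mul_heat a k l x y]
    exact tsum_congr fun z => by rw [heat_comm]
  rw [grad, h, h, ← Summable.tsum_sub (summable_heat_mul a l y _) (summable_heat_mul a l y _)]
  exact tsum_congr fun z => by rw [grad]; ring

theorem gradGrad_heat_add (a : Edge d → ℝ) (k l : ℕ) (e b : Edge d) :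
    grad (fun y => grad (heat a (k + l) y) e) b =
      ∑' z, grad (heat a k z) e * grad (heat a l z) b := by
  rw [grad]
  simp only [grad_heat_add]
  rw [← Summable.tsum_sub (summable_heat_mul a l _ _) (summable_heat_mul a l _ _)]
  exact tsum_congr fun z => by
    rw [grad_apply (heat a l z) b.1 b.2, heat_comm a l z, heat_comm a l z]; ring

/-- The finite set of lattice points at distance at most `n` from `y`. -/
noncomputable def latticeBall (y : Vertex d) (n : ℕ) : Finset (Vertex d) :=
  (finite_nrm_le n y).toFinset

theorem mem_latticeBall {y x : Vertex d} {n : ℕ} : x ∈ latticeBall y n ↔ nrm (x - y) ≤ n := by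
  simp [latticeBall]

theorem exp_half_triangle {γ : ℝ} (h0 : 0 ≤ γ) (x y z : Vertex d) :
    γ * nrm (x - y) ≤ γ * nrm (x - z) + γ * nrm (z - y) := by
  rw [← mul_add]
  refine mul_le_mul_of_nonneg_left ?_ h0
  have := nrm_add_le (x - z) (z - y)
  rw [sub_add_sub_cancel] at this
  exact_mod_cast this

theorem nrm_sub_comm (x y : Vertex d) : nrm (x - y) = nrm (y - x) := by
  rw [← nrm_neg, neg_sub]

/-- Cauchy–Schwarz in the intermediate point, with the weight centred at e on the gradient and its
inverse on p_l. By the triangle inequality the inverse weight is at most exp(-γ|e - y|) times the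
weight centred at y. -/
theorem sq_grad_heat_add_le (a : Edge d → ℝ) {γ : ℝ} (h0 : 0 ≤ γ) (k l : ℕ) (y : Vertex d)
    (e : Edge d) :
    grad (heat a (k + l) y) e ^ 2 ≤ Real.exp (-(γ * nrm (e.1 - y))) *
      (∑' z, expWeight γ y z * heat a l y z ^ 2) *
      ∑ z ∈ latticeBall y l, expWeight γ e.1 z * grad (heat a k z) e ^ 2 := by
  have hz : ∀ z ∉ latticeBall y l, heat a l y z = 0 := fun z hz =>
    heat_eq_zero a l y z (by rw [mem_latticeBall] at hz; omega)
  rw [grad_heat_add, tsum_eq_sum (s := latticeBall y l) fun z h => by rw [hz z h, mul_zero],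
    tsum_eq_sum (s := latticeBall y l) fun z h => by rw [hz z h]; simp]
  refine (Finset.sum_sq_le_sum_mul_sum_of_sq_le_mul (latticeBall y l)
    (f := fun z => (expWeight γ e.1 z)⁻¹ * heat a l y z ^ 2)
    (g := fun z => expWeight γ e.1 z * grad (heat a k z) e ^ 2)
    (fun z _ => mul_nonneg (inv_nonneg.2 (expWeight_pos _ _ _).le) (sq_nonneg _))
    (fun z _ => mul_nonneg (expWeight_pos _ _ _).le (sq_nonneg _)) (fun z _ => ?_)).trans ?_
  · have := (expWeight_pos γ e.1 z).ne'
    refine le_of_eq ?_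
    field_simp
  · refine mul_le_mul_of_nonneg_right ?_ (Finset.sum_nonneg fun z _ =>
      mul_nonneg (expWeight_pos _ _ _).le (sq_nonneg _))
    rw [Finset.mul_sum]
    refine Finset.sum_le_sum fun z _ => ?_
    rw [← mul_assoc]
    refine mul_le_mul_of_nonneg_right ?_ (sq_nonneg _)
    rw [expWeight, expWeight, ← Real.exp_neg, ← Real.exp_add, Real.exp_le_exp]
    have := exp_half_triangle h0 e.1 y z
    rw [nrm_sub_comm e.1 z] at this
    linarith

/-- Both factors are gradients and each receives the square root of its own weight, so the triangle
inequality yields only half of the exponential rate. The ball depends on N and not on l, so that one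
set of poles serves a whole block of times. -/
theorem abs_gradGrad_heat_add_le (a : Edge d → ℝ) {γ : ℝ} (h0 : 0 ≤ γ) (k l : ℕ)
    (e b : Edge d) {N : ℕ} (hN : l ≤ N) :
    |grad (fun y => grad (heat a (k + l) y) e) b| ≤ Real.exp (-(γ * nrm (e.1 - b.1) / 2)) *
      ((∑ z ∈ latticeBall b.1 (N + 1), expWeight γ e.1 z * grad (heat a k z) e ^ 2) +
       ∑ z ∈ latticeBall b.1 (N + 1), expWeight γ b.1 z * grad (heat a l z) b ^ 2) := by
  have hz : ∀ z ∉ latticeBall b.1 (N + 1), grad (heat a l z) b = 0 := fun z hz => by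
    rw [mem_latticeBall] at hz
    have h1 : heat a l z b.1 = 0 := heat_eq_zero a l z _ (by rw [nrm_sub_comm]; omega)
    have h2 : heat a l z (b.1 + basisVec b.2) = 0 := heat_eq_zero a l z _ (by
      have := nrm_add_le (z - (b.1 + basisVec b.2)) (basisVec b.2)
      rw [show z - (b.1 + basisVec b.2) + basisVec b.2 = z - b.1 by abel, nrm_basisVec] at this
      rw [nrm_sub_comm]
      omega)
    rw [grad, h1, h2, sub_zero]
  rw [gradGrad_heat_add, tsum_eq_sum (s := latticeBall b.1 (N + 1)) fun z h => by
    rw [hz z h, mul_zero]]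
  refine (Finset.abs_sum_le_sum_abs _ _).trans ?_
  rw [← Finset.sum_add_distrib, Finset.mul_sum]
  refine Finset.sum_le_sum fun z _ => ?_
  set α := grad (heat a k z) e
  set β := grad (heat a l z) b
  set s : ℝ := Real.exp (γ * nrm (z - e.1) / 2) with hs
  set t : ℝ := Real.exp (γ * nrm (z - b.1) / 2) with ht
  have hs2 : expWeight γ e.1 z = s ^ 2 := by
    rw [expWeight, hs, ← Real.exp_nat_mul]; congr 1; push_cast; ring
  have ht2 : expWeight γ b.1 z = t ^ 2 := by
    rw [expWeight, ht, ← Real.exp_nat_mul]; congr 1; push_cast; ring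
  have h1 : 1 ≤ Real.exp (-(γ * nrm (e.1 - b.1) / 2)) * (s * t) := by
    rw [hs, ht, ← Real.exp_add, ← Real.exp_add]
    refine Real.one_le_exp ?_
    have := exp_half_triangle h0 e.1 b.1 z
    rw [nrm_sub_comm e.1 z] at this
    linarith
  rw [hs2, ht2, abs_mul]
  calc |α| * |β| ≤ Real.exp (-(γ * nrm (e.1 - b.1) / 2)) * (s * t) * (|α| * |β|) :=
        le_mul_of_one_le_left (by positivity) h1
    _ = Real.exp (-(γ * nrm (e.1 - b.1) / 2)) * ((s * |α|) * (t * |β|)) := by ring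
    _ ≤ Real.exp (-(γ * nrm (e.1 - b.1) / 2)) * (s ^ 2 * α ^ 2 + t ^ 2 * β ^ 2) := by
        gcongr
        rw [← sq_abs α, ← sq_abs β, ← mul_pow, ← mul_pow]
        nlinarith [sq_nonneg (s * |α| - t * |β|), sq_nonneg (s * |α|), sq_nonneg (t * |β|)]

/-! ### Annealed estimates -/

theorem unifElliptic_toReal {lam : ℝ} (a : CoeffField d lam) : UnifElliptic lam a.toReal :=
  fun e => (a e).2

theorem measurable_grad_heat {lam : ℝ} (n : ℕ) (y : Vertex d) (e : Edge d) :
    Measurable fun a : CoeffField d lam => grad (heat a.toReal n y) e :=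
  (measurable_heat n y _).sub (measurable_heat n y _)

theorem abs_grad_heat_le (hd : 0 < d) {a : Edge d → ℝ} (ha : ∀ e, 0 ≤ a e ∧ a e ≤ 1) (n : ℕ)
    (y : Vertex d) (e : Edge d) : |grad (heat a n y) e| ≤ 1 := by
  have h1 := heat_nonneg hd ha n y e.1
  have h2 := heat_nonneg hd ha n y (e.1 + basisVec e.2)
  have h3 := heat_le_one hd ha n y e.1
  have h4 := heat_le_one hd ha n y (e.1 + basisVec e.2)
  rw [grad, abs_le]
  constructor <;> linarith

theorem integrable_sq_grad_heat (hd : 0 < d) {lam : ℝ} (hlam : 0 < lam)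
    (P : Measure (CoeffField d lam)) [IsProbabilityMeasure P] (n : ℕ) (y : Vertex d)
    (e : Edge d) : Integrable (fun a : CoeffField d lam => grad (heat a.toReal n y) e ^ 2) P := by
  refine Integrable.of_bound ((measurable_grad_heat n y e).pow_const 2).aestronglyMeasurable 1
    (ae_of_all _ fun a => ?_)
  rw [Real.norm_eq_abs, abs_of_nonneg (sq_nonneg _), ← sq_abs]
  exact pow_le_one₀ (abs_nonneg _) (abs_grad_heat_le hd
    (fun e => ⟨hlam.le.trans (unifElliptic_toReal a e).1, (unifElliptic_toReal a e).2⟩) n y e)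

theorem grad_heat_shift {lam : ℝ} (a : CoeffField d lam) (n : ℕ) (x z : Vertex d) (i : Fin d) :
    grad (heat a.toReal n z) (x, i) = grad (heat (shift z a).toReal n 0) (x - z, i) := by
  have h : ∀ x, heat (shift z a).toReal n 0 x = heat a.toReal n z (x + z) := fun x => by
    have := heat_shift a.toReal n 0 x z
    rw [zero_add] at this
    exact this
  rw [grad, grad, h, h]
  simp only
  congr 2
  · abel
  · abel

/-- The only use of stationarity: changing the pole at a fixed edge has the same law as changing the
edge at pole 0. -/
theorem integral_sq_grad_heat_shift {lam : ℝ} {P : Measure (CoeffField d lam)}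
    (hP : Stationary P) (n : ℕ) (x z : Vertex d) (i : Fin d) :
    ∫ a, grad (heat a.toReal n z) (x, i) ^ 2 ∂P =
      ∫ a, grad (heat a.toReal n 0) (x - z, i) ^ 2 ∂P := by
  conv_rhs => rw [← (hP z).map_eq]
  rw [integral_map (hP z).measurable.aemeasurable
    ((measurable_grad_heat n 0 (x - z, i)).pow_const 2).aestronglyMeasurable]
  exact integral_congr_ae (ae_of_all _ fun a => by simp only [grad_heat_shift a n x z i])

/-- By stationarity, the sum over the pole is controlled by the quenched energy. -/
theorem exists_annealed_energy_le (hd : 0 < d) {lam : ℝ} (hlam : 0 < lam) :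
    ∃ B : ℝ, 0 < B ∧ ∀ (P : Measure (CoeffField d lam)) [IsProbabilityMeasure P], Stationary P →
      ∀ (e : Edge d) (Z : Finset (Vertex d)) (j : ℕ),
        ∑ k ∈ Finset.Ico (4 ^ j) (4 ^ (j + 2)), ∑ z ∈ Z, expWeight ((2 ^ j)⁻¹) e.1 z *
          ∫ a, grad (heat a.toReal k z) e ^ 2 ∂P ≤ B * ((2 : ℝ) ^ (j * d))⁻¹ := by
  obtain ⟨B, hB, h⟩ := exists_weighted_energy_le hd hlam
  refine ⟨B, hB, fun P _ hP e Z j => ?_⟩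
  obtain ⟨x, i⟩ := e
  have hint := fun k y e => integrable_sq_grad_heat hd hlam P k y e
  simp only [integral_sq_grad_heat_shift hP _ x _ i, ← integral_const_mul]
  have e1 : ∀ k, ∑ z ∈ Z, ∫ a, expWeight ((2 ^ j)⁻¹) x z *
      grad (heat a.toReal k 0) (x - z, i) ^ 2 ∂P = ∫ a, ∑ z ∈ Z, expWeight ((2 ^ j)⁻¹) x z *
      grad (heat a.toReal k 0) (x - z, i) ^ 2 ∂P := fun k =>
    (integral_finsetSum _ fun z _ => (hint k 0 (x - z, i)).const_mul _).symm
  simp only [e1]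
  rw [← integral_finsetSum _ fun k _ =>
    integrable_finsetSum _ fun z _ => (hint k 0 (x - z, i)).const_mul _]
  refine (integral_mono (integrable_finsetSum _ fun k _ =>
    integrable_finsetSum _ fun z _ => (hint k 0 (x - z, i)).const_mul _)
    (integrable_const (B * ((2 : ℝ) ^ (j * d))⁻¹)) fun a => ?_).trans (by simp)
  refine le_trans (Finset.sum_le_sum fun k _ => ?_) (h a.toReal (unifElliptic_toReal a) 0 j)
  have hs : Summable fun w => expWeight ((2 ^ j)⁻¹) 0 w * grad (heat a.toReal k 0) (w, i) ^ 2 :=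
    summable_of_hasFiniteSupport
      (finite_support_of_local (heat_finite a.toReal k 0) fun x h h' _ => by simp [grad, h, h'])
  have hs' : Summable fun w => ∑ i, expWeight ((2 ^ j)⁻¹) 0 w *
      grad (heat a.toReal k 0) (w, i) ^ 2 :=
    summable_of_hasFiniteSupport
      (finite_support_of_local (heat_finite a.toReal k 0) fun x h h' _ => by simp [grad, h, h'])
  have hnn : ∀ w i, 0 ≤ expWeight ((2 ^ j)⁻¹) 0 w * grad (heat a.toReal k 0) (w, i) ^ 2 :=
    fun w i => mul_nonneg (expWeight_pos _ _ _).le (sq_nonneg _)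
  calc _ = ∑ w ∈ Z.map ⟨fun z => x - z, sub_right_injective⟩,
        expWeight ((2 ^ j)⁻¹) 0 w * grad (heat a.toReal k 0) (w, i) ^ 2 := by
        rw [Finset.sum_map]
        refine Finset.sum_congr rfl fun z _ => ?_
        simp only [Function.Embedding.coeFn_mk, expWeight, sub_zero]
        rw [nrm_sub_comm]
    _ ≤ ∑' w, expWeight ((2 ^ j)⁻¹) 0 w * grad (heat a.toReal k 0) (w, i) ^ 2 :=
        hs.sum_le_tsum _ fun w _ => hnn w i
    _ ≤ _ := hs.tsum_le_tsum (fun w => Finset.single_le_sum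
        (f := fun i => expWeight ((2 ^ j)⁻¹) 0 w * grad (heat a.toReal k 0) (w, i) ^ 2)
        (fun i _ => hnn w i) (Finset.mem_univ i)) hs'

/-- Write n = k + 4^j. The factor p_{4^j} is bounded in weighted ℓ² for every field, so it leaves
the expectation. The factor ∇p_k is summed over k by the annealed energy bound. Each contributes
2^{-jd}. -/
theorem exists_annealed_block_sq_le (hd : 0 < d) {lam : ℝ} (hlam : 0 < lam) :
    ∃ B : ℝ, 0 < B ∧ ∀ (P : Measure (CoeffField d lam)) [IsProbabilityMeasure P], Stationary P →
      ∀ (e : Edge d) (y : Vertex d) (j : ℕ),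
        ∑ n ∈ Finset.Ico (4 ^ (j + 1)) (4 ^ (j + 2)), ∫ a, grad (heat a.toReal n y) e ^ 2 ∂P
          ≤ B * (((2 : ℝ) ^ (j * d))⁻¹) ^ 2 * Real.exp (-((2 ^ j)⁻¹ * nrm (e.1 - y))) := by
  obtain ⟨B, hB, h⟩ := exists_annealed_energy_le hd hlam
  obtain ⟨B', hB', h'⟩ := exists_weighted_heat_le hd hlam
  refine ⟨B' * B, by positivity, fun P _ hP e y j => ?_⟩
  set γ : ℝ := (2 ^ j)⁻¹ with hγ
  set q : ℝ := ((2 : ℝ) ^ (j * d))⁻¹ with hq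
  have hint := fun k y e => integrable_sq_grad_heat hd hlam P k y e
  have hE := (Real.exp_pos (-(γ * nrm (e.1 - y)))).le
  set Z := latticeBall y (4 ^ j)
  have h1 : ∀ k, ∫ a, grad (heat a.toReal (k + 4 ^ j) y) e ^ 2 ∂P ≤
      Real.exp (-(γ * nrm (e.1 - y))) * (B' * q) * ∑ z ∈ Z, expWeight γ e.1 z *
          ∫ a, grad (heat a.toReal k z) e ^ 2 ∂P := fun k => by
    simp only [← integral_const_mul]
    rw [← integral_finsetSum _ fun z _ => (hint k z e).const_mul _, ← integral_const_mul]
    refine integral_mono (hint _ _ _) ((integrable_finsetSum _ fun z _ =>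
      (hint k z e).const_mul _).const_mul _) fun a => ?_
    refine (sq_grad_heat_add_le a.toReal (by positivity : 0 ≤ γ) k (4 ^ j) y e).trans ?_
    refine mul_le_mul_of_nonneg_right ?_ (Finset.sum_nonneg fun z _ =>
      mul_nonneg (expWeight_pos _ _ _).le (sq_nonneg _))
    exact mul_le_mul_of_nonneg_left (h' a.toReal (unifElliptic_toReal a) y j (4 ^ j) le_rfl
      (Nat.pow_le_pow_right (by norm_num) (by omega))) hE
  have e1 : (4 : ℕ) ^ (j + 1) = 3 * 4 ^ j + 4 ^ j := by rw [pow_succ]; ring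
  have e2 : (4 : ℕ) ^ (j + 2) = 15 * 4 ^ j + 4 ^ j := by rw [pow_add]; ring
  have h2 : ∑ n ∈ Finset.Ico (4 ^ (j + 1)) (4 ^ (j + 2)), ∫ a, grad (heat a.toReal n y) e ^ 2 ∂P
      = ∑ k ∈ Finset.Ico (3 * 4 ^ j) (15 * 4 ^ j),
        ∫ a, grad (heat a.toReal (k + 4 ^ j) y) e ^ 2 ∂P := by
    rw [e1, e2, ← Finset.sum_Ico_add' _ _ _ (4 ^ j)]
  rw [h2]
  refine (Finset.sum_le_sum fun k _ => h1 k).trans ?_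
  rw [← Finset.mul_sum]
  have h3 : ∑ k ∈ Finset.Ico (3 * 4 ^ j) (15 * 4 ^ j), ∑ z ∈ Z, expWeight γ e.1 z *
      ∫ a, grad (heat a.toReal k z) e ^ 2 ∂P ≤ B * q := by
    refine (Finset.sum_le_sum_of_subset_of_nonneg (fun k hk => ?_) fun k _ _ =>
      Finset.sum_nonneg fun z _ => mul_nonneg (expWeight_pos _ _ _).le
        (integral_nonneg fun a => sq_nonneg _)).trans (h P hP e Z j)
    rw [Finset.mem_Ico] at hk ⊢
    constructor <;> omega
  calc _ ≤ Real.exp (-(γ * nrm (e.1 - y))) * (B' * q) * (B * q) := by gcongr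
    _ = _ := by ring

/-- Counts fibres of size at most two. It is applied to the two halves n/2 and n - n/2 of a time, so
that a sum over n controls a sum over each half. -/
theorem sum_comp_le_two_mul {s t : Finset ℕ} {F : ℕ → ℝ} (hF : ∀ k, 0 ≤ F k) {g : ℕ → ℕ}
    (hg : ∀ n ∈ s, g n ∈ t) {c : ℕ → ℕ} (hc : ∀ n, n = c (g n) ∨ n = c (g n) + 1) :
    ∑ n ∈ s, F (g n) ≤ 2 * ∑ k ∈ t, F k := by
  rw [← Finset.sum_fiberwise_of_maps_to hg, Finset.mul_sum]
  refine Finset.sum_le_sum fun k _ => ?_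
  have h1 : ∑ n ∈ s with g n = k, F (g n) = ∑ n ∈ s with g n = k, F k :=
    Finset.sum_congr rfl fun n hn => by rw [(Finset.mem_filter.1 hn).2]
  rw [h1, Finset.sum_const, nsmul_eq_mul]
  refine mul_le_mul_of_nonneg_right ?_ (hF k)
  have h2 : (s.filter fun n => g n = k) ⊆ {c k, c k + 1} := fun n hn => by
    rw [← (Finset.mem_filter.1 hn).2]
    simpa using hc n
  exact_mod_cast (Finset.card_le_card h2).trans Finset.card_le_two

/-- Both gradients are controlled only after summation in time, so neither time may be frozen. Hence
n is split into halves that both run through [4^j, 4^{j+2}). The factor 4 is two halves times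
multiplicity two. -/
theorem exists_annealed_block_mixed_le (hd : 0 < d) {lam : ℝ} (hlam : 0 < lam) :
    ∃ B : ℝ, 0 < B ∧ ∀ (P : Measure (CoeffField d lam)) [IsProbabilityMeasure P], Stationary P →
      ∀ (e b : Edge d) (j : ℕ), ∑ n ∈ Finset.Ico (4 ^ (j + 1)) (4 ^ (j + 2)),
        ∫ a, |grad (fun y => grad (heat a.toReal n y) e) b| ∂P
          ≤ B * ((2 : ℝ) ^ (j * d))⁻¹ * Real.exp (-((2 ^ j)⁻¹ * nrm (e.1 - b.1) / 2)) := by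
  obtain ⟨B, hB, h⟩ := exists_annealed_energy_le hd hlam
  refine ⟨4 * B, by positivity, fun P _ hP e b j => ?_⟩
  set γ : ℝ := (2 ^ j)⁻¹ with hγ
  set q : ℝ := ((2 : ℝ) ^ (j * d))⁻¹ with hq
  have hint := fun k y e => integrable_sq_grad_heat hd hlam P k y e
  have hE := (Real.exp_pos (-(γ * nrm (e.1 - b.1) / 2))).le
  set Z := latticeBall b.1 (4 ^ (j + 2) + 1)
  set S : Edge d → ℕ → ℝ := fun e k => ∑ z ∈ Z, expWeight γ e.1 z *
          ∫ a, grad (heat a.toReal k z) e ^ 2 ∂P with hS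
  have hS0 : ∀ e k, 0 ≤ S e k := fun e k => Finset.sum_nonneg fun z _ =>
    mul_nonneg (expWeight_pos _ _ _).le (integral_nonneg fun a => sq_nonneg _)
  have h1 : ∀ n ∈ Finset.Ico (4 ^ (j + 1)) (4 ^ (j + 2)),
      ∫ a, |grad (fun y => grad (heat a.toReal n y) e) b| ∂P ≤
      Real.exp (-(γ * nrm (e.1 - b.1) / 2)) * (S e (n / 2) + S b (n - n / 2)) := fun n hn => by
    simp only [hS, ← integral_const_mul]
    rw [← integral_finsetSum _ fun z _ => (hint _ z e).const_mul _,
      ← integral_finsetSum _ fun z _ => (hint _ z b).const_mul _,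
      ← integral_add (integrable_finsetSum _ fun z _ => (hint _ z e).const_mul _)
        (integrable_finsetSum _ fun z _ => (hint _ z b).const_mul _), ← integral_const_mul]
    refine integral_mono_of_nonneg (ae_of_all _ fun a => abs_nonneg _)
      (((integrable_finsetSum _ fun z _ => (hint _ z e).const_mul _).add
        (integrable_finsetSum _ fun z _ => (hint _ z b).const_mul _)).const_mul _)
      (ae_of_all _ fun a => ?_)
    rw [Finset.mem_Ico] at hn
    have := abs_gradGrad_heat_add_le a.toReal (by positivity : 0 ≤ γ) (n / 2) (n - n / 2) e b
      (N := 4 ^ (j + 2)) (by omega)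
    rwa [show n / 2 + (n - n / 2) = n by omega] at this
  refine (Finset.sum_le_sum h1).trans ?_
  rw [← Finset.mul_sum, Finset.sum_add_distrib]
  have e1 : (4 : ℕ) ^ (j + 1) = 4 * 4 ^ j := by rw [pow_succ]; ring
  have e2 : (4 : ℕ) ^ (j + 2) = 16 * 4 ^ j := by rw [pow_add]; ring
  have h2 : ∑ n ∈ Finset.Ico (4 ^ (j + 1)) (4 ^ (j + 2)), S e (n / 2) ≤ 2 * (B * q) := by
    refine (sum_comp_le_two_mul (hS0 e) (t := Finset.Ico (4 ^ j) (4 ^ (j + 2)))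
      (g := fun n => n / 2) (fun n hn => ?_) (c := fun k => 2 * k) fun n => ?_).trans ?_
    · rw [Finset.mem_Ico] at hn ⊢
      constructor <;> omega
    · omega
    · exact mul_le_mul_of_nonneg_left (h P hP e Z j) (by norm_num)
  have h3 : ∑ n ∈ Finset.Ico (4 ^ (j + 1)) (4 ^ (j + 2)), S b (n - n / 2) ≤ 2 * (B * q) := by
    -- The fibre of n ↦ n - n/2 over k is {2k - 1, 2k}; over k = 0 the truncated 2k - 1 is 0, which
    -- still covers n = 0.
    refine (sum_comp_le_two_mul (hS0 b) (t := Finset.Ico (4 ^ j) (4 ^ (j + 2)))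
      (g := fun n => n - n / 2) (fun n hn => ?_) (c := fun k => 2 * k - 1) fun n => ?_).trans ?_
    · rw [Finset.mem_Ico] at hn ⊢
      constructor <;> omega
    · omega
    · exact mul_le_mul_of_nonneg_left (h P hP b Z j) (by norm_num)
  calc _ ≤ Real.exp (-(γ * nrm (e.1 - b.1) / 2)) * (2 * (B * q) + 2 * (B * q)) := by gcongr
    _ = _ := by ring

/-- Fatou's lemma, giving integrability of the limit together with the uniform bound. No domination
in a is needed. -/
theorem integrable_of_tendsto_of_integral_le {Ω : Type*} [MeasurableSpace Ω] {μ : Measure Ω}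
    {f : ℕ → Ω → ℝ} {g : Ω → ℝ} (hm : ∀ n, Measurable (f n)) (hf : ∀ n, Integrable (f n) μ)
    (h0 : ∀ n a, 0 ≤ f n a) (hlim : ∀ a, Tendsto (fun n => f n a) atTop (𝓝 (g a))) {B : ℝ}
    (hB : ∀ n, ∫ a, f n a ∂μ ≤ B) : Integrable g μ ∧ ∫ a, g a ∂μ ≤ B := by
  have hB0 : 0 ≤ B := (integral_nonneg (h0 0)).trans (hB 0)
  have hg0 : ∀ a, 0 ≤ g a := fun a => ge_of_tendsto' (hlim a) fun n => h0 n a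
  have hgm : Measurable g := measurable_of_tendsto_metrizable hm (tendsto_pi_nhds.2 hlim)
  have key : ∫⁻ a, ENNReal.ofReal (g a) ∂μ ≤ ENNReal.ofReal B := by
    have h1 : ∀ a, ENNReal.ofReal (g a) = liminf (fun n => ENNReal.ofReal (f n a)) atTop :=
      fun a => ((ENNReal.continuous_ofReal.tendsto _).comp (hlim a)).liminf_eq.symm
    simp only [h1]
    refine (lintegral_liminf_le fun n => (hm n).ennreal_ofReal).trans ?_
    refine (liminf_le_liminf (Eventually.of_forall fun n => ?_)).trans
      (liminf_const (f := atTop (α := ℕ)) (ENNReal.ofReal B)).le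
    rw [← ofReal_integral_eq_lintegral_ofReal (hf n) (ae_of_all _ (h0 n))]
    exact ENNReal.ofReal_le_ofReal (hB n)
  have hint : Integrable g μ := by
    refine ⟨hgm.aestronglyMeasurable, ?_⟩
    rw [hasFiniteIntegral_iff_ofReal (ae_of_all _ hg0)]
    exact key.trans_lt ENNReal.ofReal_lt_top
  refine ⟨hint, ?_⟩
  rw [← ofReal_integral_eq_lintegral_ofReal hint (ae_of_all _ hg0)] at key
  exact (ENNReal.ofReal_le_ofReal_iff hB0).1 key

theorem grad_heat_eq_zero (a : Edge d → ℝ) (n : ℕ) (y : Vertex d) (e : Edge d)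
    (h : n + 1 < nrm (e.1 - y)) : grad (heat a n y) e = 0 := by
  have h2 : heat a n y (e.1 + basisVec e.2) = 0 := heat_eq_zero a n y _ (by
    have := nrm_add_le (e.1 + basisVec e.2 - y) (-basisVec e.2)
    rw [show e.1 + basisVec e.2 - y + -basisVec e.2 = e.1 - y by abel, nrm_neg,
      nrm_basisVec] at this
    omega)
  rw [grad, h2, heat_eq_zero a n y _ (by omega), sub_zero]

/-- The dyadic blocks start at time 4. For earlier times the gradient is at most 1 and vanishes
beyond distance 4, so any power law holds. -/
theorem abs_grad_heat_le_of_lt_four (hd : 0 < d) {a : Edge d → ℝ} (ha : ∀ e, 0 ≤ a e ∧ a e ≤ 1)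
    {n : ℕ} (hn : n < 4) (p : ℕ) (y : Vertex d) (e : Edge d) :
    |grad (heat a n y) e| ≤ 5 ^ p * (((nrm (e.1 - y) : ℝ) + 1) ^ p)⁻¹ := by
  rcases le_or_gt (nrm (e.1 - y)) 4 with h | h
  · refine (abs_grad_heat_le hd ha n y e).trans ?_
    rw [← div_eq_mul_inv, one_le_div (by positivity)]
    have : (nrm (e.1 - y) : ℝ) ≤ 4 := by exact_mod_cast h
    gcongr
    linarith
  · rw [grad_heat_eq_zero a n y e (by omega), abs_zero]
    positivity

theorem abs_gradGrad_heat_le_of_lt_four (hd : 0 < d) {a : Edge d → ℝ}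
    (ha : ∀ e, 0 ≤ a e ∧ a e ≤ 1) {n : ℕ} (hn : n < 4) (p : ℕ) (e b : Edge d) :
    |grad (fun y => grad (heat a n y) e) b| ≤
      2 * 6 ^ p * (((nrm (e.1 - b.1) : ℝ) + 1) ^ p)⁻¹ := by
  rcases le_or_gt (nrm (e.1 - b.1)) 5 with h | h
  · rw [grad]
    refine (abs_sub _ _).trans ((add_le_add (abs_grad_heat_le hd ha n _ e)
      (abs_grad_heat_le hd ha n _ e)).trans ?_)
    rw [mul_assoc, ← div_eq_mul_inv]
    have h1 : 1 ≤ 6 ^ p / ((nrm (e.1 - b.1) : ℝ) + 1) ^ p := by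
      rw [one_le_div (by positivity)]
      have : (nrm (e.1 - b.1) : ℝ) ≤ 5 := by exact_mod_cast h
      gcongr
      linarith
    linarith
  · have h2 : grad (heat a n (b.1 + basisVec b.2)) e = 0 := grad_heat_eq_zero a n _ e (by
      have := nrm_add_le (e.1 - (b.1 + basisVec b.2)) (basisVec b.2)
      rw [show e.1 - (b.1 + basisVec b.2) + basisVec b.2 = e.1 - b.1 by abel, nrm_basisVec] at this
      omega)
    rw [grad, h2, grad_heat_eq_zero a n _ e (by omega), sub_zero, abs_zero]
    positivity

/-- A triangle inequality in L² over the dyadic blocks, carried out as a weighted Cauchy–Schwarz.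
The weight W_j is the expected L² size of block j: 12·4^j times the block of second moments is at
most a constant times W_j². Then ∑ W_j is the dyadic sum with exponent d - 1, which is positive
because d ≥ 2. -/
theorem exists_annealed_sum_sq_le (hd : 2 ≤ d) {lam : ℝ} (hlam : 0 < lam) :
    ∃ C : ℝ, 0 < C ∧ ∀ (P : Measure (CoeffField d lam)) [IsProbabilityMeasure P], Stationary P →
      ∀ (e : Edge d) (y : Vertex d) (J : ℕ),
        ∫ a, (∑ n ∈ Finset.range (4 ^ (J + 1)), grad (heat a.toReal n y) e) ^ 2 ∂P
          ≤ C * ((((nrm (e.1 - y) : ℝ) + 1) ^ (d - 1))⁻¹) ^ 2 := by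
  have hd0 : 0 < d := by omega
  obtain ⟨B, hB, h⟩ := exists_annealed_block_sq_le hd0 hlam
  obtain ⟨S, hS, hsum⟩ := exists_dyadic_sum_le (d - 1) (by omega)
  refine ⟨2 * (4 * 5 ^ (d - 1)) ^ 2 + 2 * (12 * B * S ^ 2), by positivity,
    fun P _ hP e y J => ?_⟩
  set ρ := nrm (e.1 - y) with hρ
  set V : ℝ := (((ρ : ℝ) + 1) ^ (d - 1))⁻¹ with hV
  have hint := fun k => integrable_sq_grad_heat hd0 hlam P k y e
  set W : ℕ → ℝ := fun j => ((2 : ℝ) ^ (j * (d - 1)))⁻¹ * Real.exp (-((2 ^ j)⁻¹ * ρ / 2)) with hW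
  have hW0 : ∀ j, 0 < W j := fun j => by
    have := Real.exp_pos (-((2 ^ j)⁻¹ * ρ / 2) : ℝ)
    simp only [hW]; positivity
  have ha' : ∀ a : CoeffField d lam, ∀ e, 0 ≤ a.toReal e ∧ a.toReal e ≤ 1 := fun a e =>
    ⟨hlam.le.trans (unifElliptic_toReal a e).1, (unifElliptic_toReal a e).2⟩
  set Q : CoeffField d lam → ℕ → ℝ := fun a j =>
    ∑ n ∈ Finset.Ico (4 ^ (j + 1)) (4 ^ (j + 2)), grad (heat a.toReal n y) e ^ 2 with hQ
  have hQint : ∀ j, Integrable (fun a => Q a j) P := fun j =>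
    integrable_finsetSum _ fun n _ => hint n
  have hpt : ∀ a : CoeffField d lam,
      (∑ n ∈ Finset.range (4 ^ (J + 1)), grad (heat a.toReal n y) e) ^ 2 ≤
      2 * (4 * 5 ^ (d - 1) * V) ^ 2 + 2 * ((∑ j ∈ Finset.range J, W j) *
        ∑ j ∈ Finset.range J, (W j)⁻¹ * (12 * 4 ^ j) * Q a j) := fun a => by
    rw [sum_range_four_pow]
    set f0 := ∑ n ∈ Finset.range 4, grad (heat a.toReal n y) e with hf0
    set F : ℕ → ℝ := fun j =>
      ∑ n ∈ Finset.Ico (4 ^ (j + 1)) (4 ^ (j + 2)), grad (heat a.toReal n y) e with hF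
    have k1 : f0 ^ 2 ≤ (4 * 5 ^ (d - 1) * V) ^ 2 := by
      rw [← sq_abs]
      refine pow_le_pow_left₀ (abs_nonneg _) ((Finset.abs_sum_le_sum_abs _ _).trans ?_) 2
      refine (Finset.sum_le_sum fun n hn => abs_grad_heat_le_of_lt_four hd0 (ha' a)
        (Finset.mem_range.1 hn) (d - 1) y e).trans (le_of_eq ?_)
      rw [Finset.sum_const, Finset.card_range, nsmul_eq_mul, ← hρ, ← hV]
      push_cast; ring
    have k2 : ∀ j, F j ^ 2 ≤ (12 * 4 ^ j) * Q a j := fun j => by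
      have h1 := sq_sum_le_card_mul_sum_sq (s := Finset.Ico (4 ^ (j + 1)) (4 ^ (j + 2)))
        (f := fun n => grad (heat a.toReal n y) e)
      rw [Nat.card_Ico] at h1
      have h2 : (4 : ℕ) ^ (j + 2) - 4 ^ (j + 1) = 12 * 4 ^ j := by
        rw [pow_add, pow_succ]; omega
      rw [h2] at h1
      exact_mod_cast h1
    have k3 : (∑ j ∈ Finset.range J, F j) ^ 2 ≤ (∑ j ∈ Finset.range J, W j) *
        ∑ j ∈ Finset.range J, (W j)⁻¹ * (12 * 4 ^ j) * Q a j := by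
      have hQ0 : ∀ j, 0 ≤ Q a j := fun j => Finset.sum_nonneg fun n _ => sq_nonneg _
      refine Finset.sum_sq_le_sum_mul_sum_of_sq_le_mul _ (fun j _ => (hW0 j).le)
        (fun j _ => mul_nonneg (mul_nonneg (inv_nonneg.2 (hW0 j).le) (by positivity)) (hQ0 j))
        fun j _ => ?_
      rw [mul_assoc (W j)⁻¹, mul_inv_cancel_left₀ (hW0 j).ne']
      exact k2 j
    have k4 := add_sq_le (a := f0) (b := ∑ j ∈ Finset.range J, F j)
    linarith
  have hR : Integrable (fun a => ∑ j ∈ Finset.range J, (W j)⁻¹ * (12 * 4 ^ j) * Q a j) P :=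
    integrable_finsetSum _ fun j _ => (hQint j).const_mul _
  refine (integral_mono_of_nonneg (ae_of_all _ fun a => sq_nonneg _)
    ((integrable_const _).add ((hR.const_mul _).const_mul _)) (ae_of_all _ hpt)).trans ?_
  rw [integral_add' (integrable_const _) ((hR.const_mul _).const_mul _), integral_const_mul,
    integral_const_mul, integral_const_mul, integral_finsetSum _ fun j _ => (hQint j).const_mul _]
  simp only [integral_const, probReal_univ, smul_eq_mul, one_mul, integral_const_mul]
  have hterm : ∀ j, (W j)⁻¹ * (12 * 4 ^ j) * ∫ a, Q a j ∂P ≤ 12 * B * W j := fun j => by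
    have h1 := h P hP e y j
    rw [← integral_finsetSum _ fun n _ => hint n] at h1
    have h2 : (4 : ℝ) ^ j * (B * (((2 : ℝ) ^ (j * d))⁻¹) ^ 2 *
        Real.exp (-((2 ^ j)⁻¹ * nrm (e.1 - y)))) = B * W j ^ 2 := by
      have e1 : Real.exp (-((2 ^ j)⁻¹ * ρ / 2)) ^ 2 = Real.exp (-((2 ^ j)⁻¹ * ρ)) := by
        rw [← Real.exp_nat_mul]; congr 1; push_cast; ring
      have e2 : (4 : ℝ) ^ j * (((2 : ℝ) ^ (j * d))⁻¹) ^ 2 = (((2 : ℝ) ^ (j * (d - 1)))⁻¹) ^ 2 := by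
        obtain ⟨p, rfl⟩ : ∃ p, d = p + 1 := ⟨d - 1, by omega⟩
        rw [Nat.add_sub_cancel, mul_add, mul_one, pow_add,
          show (4 : ℝ) = 2 ^ 2 by norm_num, ← pow_mul, mul_comm 2 j, pow_mul]
        field_simp
      simp only [hW]
      rw [mul_pow, e1, ← e2]; ring
    rw [mul_comm (W j)⁻¹, mul_right_comm, ← div_eq_mul_inv, div_le_iff₀ (hW0 j)]
    calc _ = 12 * (4 ^ j * ∫ a, Q a j ∂P) := by ring
      _ ≤ 12 * (4 ^ j * (B * (((2 : ℝ) ^ (j * d))⁻¹) ^ 2 *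
        Real.exp (-((2 ^ j)⁻¹ * nrm (e.1 - y))))) := by gcongr
      _ = _ := by rw [h2]; ring
  have hWs : ∑ j ∈ Finset.range J, W j ≤ S * V := hsum ρ J
  have hWs0 : 0 ≤ ∑ j ∈ Finset.range J, W j := Finset.sum_nonneg fun j _ => (hW0 j).le
  have h3 : ∑ j ∈ Finset.range J, (W j)⁻¹ * (12 * 4 ^ j) * ∫ a, Q a j ∂P ≤
      12 * B * ∑ j ∈ Finset.range J, W j := by
    rw [Finset.mul_sum]; exact Finset.sum_le_sum fun j _ => hterm j
  calc _ ≤ 2 * (4 * 5 ^ (d - 1) * V) ^ 2 + 2 * ((∑ j ∈ Finset.range J, W j) *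
        (12 * B * ∑ j ∈ Finset.range J, W j)) := by gcongr
    _ ≤ 2 * (4 * 5 ^ (d - 1) * V) ^ 2 + 2 * ((S * V) * (12 * B * (S * V))) := by gcongr
    _ = _ := by ring

/-- Here the triangle inequality suffices, since the blocks already control first moments summed
over time. The dyadic sum has exponent d. -/
theorem exists_annealed_sum_mixed_le (hd : 0 < d) {lam : ℝ} (hlam : 0 < lam) :
    ∃ C : ℝ, 0 < C ∧ ∀ (P : Measure (CoeffField d lam)) [IsProbabilityMeasure P], Stationary P →
      ∀ (e b : Edge d) (J : ℕ),
        ∫ a, |∑ n ∈ Finset.range (4 ^ (J + 1)), grad (fun y => grad (heat a.toReal n y) e) b| ∂P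
          ≤ C * (((nrm (e.1 - b.1) : ℝ) + 1) ^ d)⁻¹ := by
  obtain ⟨B, hB, h⟩ := exists_annealed_block_mixed_le hd hlam
  obtain ⟨S, hS, hsum⟩ := exists_dyadic_sum_le d hd
  refine ⟨4 * (2 * 6 ^ d) + B * S, by positivity, fun P _ hP e b J => ?_⟩
  set ρ := nrm (e.1 - b.1) with hρ
  set V : ℝ := (((ρ : ℝ) + 1) ^ d)⁻¹ with hV
  have ha' : ∀ a : CoeffField d lam, ∀ e, 0 ≤ a.toReal e ∧ a.toReal e ≤ 1 := fun a e =>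
    ⟨hlam.le.trans (unifElliptic_toReal a e).1, (unifElliptic_toReal a e).2⟩
  have hint : ∀ n, Integrable (fun a : CoeffField d lam =>
      |grad (fun y => grad (heat a.toReal n y) e) b|) P := fun n => by
    refine Integrable.of_bound (((measurable_grad_heat n _ e).sub
      (measurable_grad_heat n _ e)).abs).aestronglyMeasurable 2 (ae_of_all _ fun a => ?_)
    rw [Real.norm_eq_abs, abs_abs, grad]
    refine (abs_sub _ _).trans ((add_le_add (abs_grad_heat_le hd (ha' a) n _ e)
      (abs_grad_heat_le hd (ha' a) n _ e)).trans (by norm_num))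
  have hpt : ∀ a : CoeffField d lam,
      |∑ n ∈ Finset.range (4 ^ (J + 1)), grad (fun y => grad (heat a.toReal n y) e) b| ≤
      4 * (2 * 6 ^ d) * V + ∑ j ∈ Finset.range J, ∑ n ∈ Finset.Ico (4 ^ (j + 1)) (4 ^ (j + 2)),
        |grad (fun y => grad (heat a.toReal n y) e) b| := fun a => by
    refine (Finset.abs_sum_le_sum_abs _ _).trans ?_
    rw [sum_range_four_pow]
    refine add_le_add_left ?_ _
    refine (Finset.sum_le_sum fun n hn => abs_gradGrad_heat_le_of_lt_four hd (ha' a)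
      (Finset.mem_range.1 hn) d e b).trans (le_of_eq ?_)
    rw [Finset.sum_const, Finset.card_range, nsmul_eq_mul, ← hρ, ← hV]
    push_cast; ring
  have hR : Integrable (fun a : CoeffField d lam => ∑ j ∈ Finset.range J,
      ∑ n ∈ Finset.Ico (4 ^ (j + 1)) (4 ^ (j + 2)),
        |grad (fun y => grad (heat a.toReal n y) e) b|) P :=
    integrable_finsetSum _ fun j _ => integrable_finsetSum _ fun n _ => hint n
  refine (integral_mono_of_nonneg (ae_of_all _ fun a => abs_nonneg _)
    ((integrable_const _).add hR) (ae_of_all _ hpt)).trans ?_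
  rw [integral_add' (integrable_const _) hR,
    integral_finsetSum _ fun j _ => integrable_finsetSum _ fun n _ => hint n]
  simp only [integral_finsetSum _ fun n _ => hint n, integral_const, probReal_univ,
    smul_eq_mul, one_mul]
  have h1 : ∑ j ∈ Finset.range J, ∑ n ∈ Finset.Ico (4 ^ (j + 1)) (4 ^ (j + 2)),
      ∫ a, |grad (fun y => grad (heat a.toReal n y) e) b| ∂P ≤ B * (S * V) := by
    refine (Finset.sum_le_sum fun j _ => h P hP e b j).trans ?_
    simp only [mul_assoc]
    rw [← Finset.mul_sum]
    refine mul_le_mul_of_nonneg_left (le_trans (le_of_eq ?_) (hsum ρ J)) hB.le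
    exact Finset.sum_congr rfl fun j _ => by simp only [hρ]
  linarith

/-! ### Hole filling in two dimensions -/

theorem int_Icc_succ {m n : ℤ} (h : m ≤ n + 1) :
    Finset.Icc m (n + 1) = insert (n + 1) (Finset.Icc m n) := by
  ext s; simp only [Finset.mem_Icc, Finset.mem_insert]; omega

theorem int_Ico_succ {m n : ℤ} (h : m ≤ n) :
    Finset.Ico m (n + 1) = insert n (Finset.Ico m n) := by
  ext s; simp only [Finset.mem_Ico, Finset.mem_insert]; omega

theorem sum_Icc_abel (φ α : ℤ → ℝ) (m n : ℤ) (h : m ≤ n) :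
    ∑ s ∈ Finset.Icc m n, φ s * (α (s - 1) * (φ s - φ (s - 1)) - α s * (φ (s + 1) - φ s)) =
      ∑ s ∈ Finset.Ico m n, α s * (φ (s + 1) - φ s) ^ 2
        + φ m * α (m - 1) * (φ m - φ (m - 1)) - φ n * α n * (φ (n + 1) - φ n) := by
  induction n, h using Int.leInduction with
  | base => simp; ring
  | succ n hn ih =>
    rw [int_Icc_succ (by omega), int_Ico_succ hn, Finset.sum_insert (by simp),
      Finset.sum_insert (by simp), ih]
    simp only [add_sub_cancel_right]
    ring

theorem sub_eq_sum_Ico_int (φ : ℤ → ℝ) (m n : ℤ) (h : m ≤ n) :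
    φ n - φ m = ∑ s ∈ Finset.Ico m n, (φ (s + 1) - φ s) := by
  induction n, h using Int.leInduction with
  | base => simp
  | succ n hn ih =>
    rw [int_Ico_succ hn, Finset.sum_insert (by simp), ← ih]
    ring

/-- One-dimensional Cauchy–Schwarz along a segment. On the sides of a square it bounds the
oscillation by the energy of the boundary layer, and this is what ties the hole filling to dimension
two. -/
theorem sq_sub_le_sum_Ico (φ : ℤ → ℝ) (ρ : ℕ) {p q : ℤ} (hp : p ∈ Finset.Icc (-ρ : ℤ) ρ)
    (hq : q ∈ Finset.Icc (-ρ : ℤ) ρ) :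
    (φ p - φ q) ^ 2 ≤ 2 * ρ * ∑ s ∈ Finset.Ico (-ρ : ℤ) ρ, (φ (s + 1) - φ s) ^ 2 := by
  wlog hpq : q ≤ p generalizing p q
  · have := this hq hp (by omega)
    rwa [← neg_sub, neg_sq] at this
  rw [Finset.mem_Icc] at hp hq
  rw [sub_eq_sum_Ico_int φ q p hpq]
  refine sq_sum_le_card_mul_sum_sq.trans ?_
  refine mul_le_mul ?_ (Finset.sum_le_sum_of_subset_of_nonneg
    (Finset.Ico_subset_Ico hq.1 hp.2) fun _ _ _ => sq_nonneg _)
    (Finset.sum_nonneg fun _ _ => sq_nonneg _) (by positivity)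
  rw [Int.card_Ico]
  have : (p - q).toNat ≤ 2 * ρ := by omega
  exact_mod_cast this

/-- The sum of the squared increments of `U` over the four edges at `(s, t)`. -/
def crossEnergy (U : ℤ → ℤ → ℝ) (s t : ℤ) : ℝ :=
  (U (s + 1) t - U s t) ^ 2 + (U s t - U (s - 1) t) ^ 2 +
    ((U s (t + 1) - U s t) ^ 2 + (U s t - U s (t - 1)) ^ 2)

theorem crossEnergy_nonneg (U : ℤ → ℤ → ℝ) (s t : ℤ) : 0 ≤ crossEnergy U s t := by
  unfold crossEnergy; positivity

/-- The sum of `f` over the square of radius `ρ`. -/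
noncomputable def squareSum (f : ℤ → ℤ → ℝ) (ρ : ℕ) : ℝ :=
  ∑ s ∈ Finset.Icc (-ρ : ℤ) ρ, ∑ t ∈ Finset.Icc (-ρ : ℤ) ρ, f s t

theorem squareSum_swap (f : ℤ → ℤ → ℝ) (ρ : ℕ) :
    squareSum (fun s t => f t s) ρ = squareSum f ρ := Finset.sum_comm

theorem squareSum_nonneg {f : ℤ → ℤ → ℝ} (hf : ∀ s t, 0 ≤ f s t) (ρ : ℕ) : 0 ≤ squareSum f ρ :=
  Finset.sum_nonneg fun s _ => Finset.sum_nonneg fun t _ => hf s t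

theorem squareSum_mono {f : ℤ → ℤ → ℝ} (hf : ∀ s t, 0 ≤ f s t) : Monotone (squareSum f) := by
  intro ρ ρ' h
  have hsub : Finset.Icc (-ρ : ℤ) ρ ⊆ Finset.Icc (-ρ' : ℤ) ρ' :=
    Finset.Icc_subset_Icc (by omega) (by omega)
  refine (Finset.sum_le_sum fun s _ =>
    Finset.sum_le_sum_of_subset_of_nonneg hsub fun t _ _ => hf s t).trans ?_
  exact Finset.sum_le_sum_of_subset_of_nonneg hsub fun s _ _ =>
    Finset.sum_nonneg fun t _ => hf s t

theorem crossEnergy_swap (U : ℤ → ℤ → ℝ) (s t : ℤ) :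
    crossEnergy (fun s t => U t s) s t = crossEnergy U t s := by
  simp only [crossEnergy]; ring

theorem int_Icc_center_succ (ρ : ℕ) : Finset.Icc (-((ρ + 1 : ℕ) : ℤ)) ((ρ + 1 : ℕ) : ℤ) =
    insert ((ρ : ℤ) + 1) (insert (-(ρ : ℤ) - 1) (Finset.Icc (-(ρ : ℤ)) ρ)) := by
  ext s; simp only [Finset.mem_Icc, Finset.mem_insert]; omega

/-- Each vertical side of a square carries at most the sum over its boundary layer. -/
theorem side_le {f : ℤ → ℤ → ℝ} (hf : ∀ s t, 0 ≤ f s t) (ρ : ℕ) {s : ℤ}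
    (hs : s = ρ + 1 ∨ s = -(ρ : ℤ) - 1) :
    ∑ t ∈ Finset.Icc (-((ρ + 1 : ℕ) : ℤ)) ((ρ + 1 : ℕ) : ℤ), f s t ≤
      squareSum f (ρ + 1) - squareSum f ρ := by
  set I := Finset.Icc (-((ρ + 1 : ℕ) : ℤ)) ((ρ + 1 : ℕ) : ℤ) with hI
  have h1 : squareSum f (ρ + 1) = ∑ t ∈ I, f (ρ + 1) t + (∑ t ∈ I, f (-(ρ : ℤ) - 1) t +
      ∑ s ∈ Finset.Icc (-(ρ : ℤ)) ρ, ∑ t ∈ I, f s t) := by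
    have h0 : squareSum f (ρ + 1) = ∑ s ∈ insert ((ρ : ℤ) + 1) (insert (-(ρ : ℤ) - 1)
        (Finset.Icc (-(ρ : ℤ)) ρ)), ∑ t ∈ I, f s t := by
      rw [← int_Icc_center_succ ρ]; rfl
    rw [h0, Finset.sum_insert (by simp; omega), Finset.sum_insert (by simp)]
  have h2 : squareSum f ρ ≤ ∑ s ∈ Finset.Icc (-(ρ : ℤ)) ρ, ∑ t ∈ I, f s t :=
    Finset.sum_le_sum fun s _ => Finset.sum_le_sum_of_subset_of_nonneg
      (Finset.Icc_subset_Icc (by omega) (by omega)) fun t _ _ => hf s t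
  have h3 : ∀ s, 0 ≤ ∑ t ∈ I, f s t := fun s => Finset.sum_nonneg fun t _ => hf s t
  rcases hs with rfl | rfl
  · linarith [h3 (-(ρ : ℤ) - 1)]
  · linarith [h3 (ρ + 1)]

theorem sum_Ico_sq_le_cross (U : ℤ → ℤ → ℝ) (ρ : ℕ) (s : ℤ) :
    ∑ t ∈ Finset.Ico (-ρ : ℤ) ρ, (U s (t + 1) - U s t) ^ 2 ≤
      ∑ t ∈ Finset.Icc (-ρ : ℤ) ρ, crossEnergy U s t := by
  refine (Finset.sum_le_sum_of_subset_of_nonneg Finset.Ico_subset_Icc_self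
    fun _ _ _ => sq_nonneg _).trans (Finset.sum_le_sum fun t _ => ?_)
  rw [crossEnergy]
  nlinarith [sq_nonneg (U (s + 1) t - U s t), sq_nonneg (U s t - U (s - 1) t),
    sq_nonneg (U s t - U s (t - 1))]

/-- Oscillation bound on a vertical line. -/
theorem sq_sub_vertical_le (U : ℤ → ℤ → ℝ) (ρ : ℕ) (s : ℤ) {p q : ℤ}
    (hp : p ∈ Finset.Icc (-ρ : ℤ) ρ) (hq : q ∈ Finset.Icc (-ρ : ℤ) ρ) :
    (U s p - U s q) ^ 2 ≤ 2 * ρ * ∑ t ∈ Finset.Icc (-ρ : ℤ) ρ, crossEnergy U s t :=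
  (sq_sub_le_sum_Ico (U s) ρ hp hq).trans
    (mul_le_mul_of_nonneg_left (sum_Ico_sq_le_cross U ρ s) (by positivity))

/-- Oscillation bound on a horizontal line. -/
theorem sq_sub_horizontal_le (U : ℤ → ℤ → ℝ) (ρ : ℕ) (t : ℤ) {p q : ℤ}
    (hp : p ∈ Finset.Icc (-ρ : ℤ) ρ) (hq : q ∈ Finset.Icc (-ρ : ℤ) ρ) :
    (U p t - U q t) ^ 2 ≤ 2 * ρ * ∑ s ∈ Finset.Icc (-ρ : ℤ) ρ, crossEnergy U s t := by
  have := sq_sub_vertical_le (fun s t => U t s) ρ t hp hq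
  simpa only [crossEnergy_swap] using this

/-- The energy of the edges inside the square controls the energy on the smaller square. -/
theorem squareSum_le_two_mul_inside (U : ℤ → ℤ → ℝ) (ρ : ℕ) :
    squareSum (fun s t => (U s (t + 1) - U s t) ^ 2 + (U s t - U s (t - 1)) ^ 2) ρ ≤
      2 * ∑ s ∈ Finset.Icc (-((ρ + 1 : ℕ) : ℤ)) ((ρ + 1 : ℕ) : ℤ),
        ∑ t ∈ Finset.Ico (-((ρ + 1 : ℕ) : ℤ)) ((ρ + 1 : ℕ) : ℤ), (U s (t + 1) - U s t) ^ 2 := by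
  rw [Finset.mul_sum]
  refine (Finset.sum_le_sum fun s _ => ?_).trans (Finset.sum_le_sum_of_subset_of_nonneg
    (Finset.Icc_subset_Icc (by omega) (by omega)) fun s _ _ =>
      mul_nonneg (by norm_num) (Finset.sum_nonneg fun _ _ => sq_nonneg _))
  rw [Finset.sum_add_distrib, two_mul]
  refine add_le_add (Finset.sum_le_sum_of_subset_of_nonneg (fun t ht => ?_)
    fun _ _ _ => sq_nonneg _) ?_
  · rw [Finset.mem_Icc] at ht; rw [Finset.mem_Ico]; omega
  · have e : ∑ t ∈ Finset.Icc (-(ρ : ℤ)) ρ, (U s t - U s (t - 1)) ^ 2 =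
        ∑ t ∈ (Finset.Icc (-(ρ : ℤ)) ρ).map ⟨fun t => t - 1, sub_left_injective⟩,
          (U s (t + 1) - U s t) ^ 2 := by
      rw [Finset.sum_map]; simp
    rw [e]
    refine Finset.sum_le_sum_of_subset_of_nonneg (fun t ht => ?_) fun _ _ _ => sq_nonneg _
    simp only [Finset.mem_map, Finset.mem_Icc, Function.Embedding.coeFn_mk] at ht
    obtain ⟨t', h1, rfl⟩ := ht
    rw [Finset.mem_Ico]; omega

/-- Young's inequality with parameter r for a boundary flux: w is the oscillation on the side and D
the outward increment. Summed over the ~ r boundary points, both terms become of order r times the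
layer energy. -/
theorem abs_mul_mul_le {w α D r V : ℝ} (hr : 0 < r) (hα0 : 0 ≤ α) (hα1 : α ≤ 1)
    (hw : w ^ 2 ≤ 8 * r * V) : |w * α * D| ≤ 4 * V + r / 2 * D ^ 2 := by
  have h1 : |w * α * D| ≤ |w| * |D| := by
    rw [abs_mul, abs_mul, abs_of_nonneg hα0]
    gcongr
    exact mul_le_of_le_one_right (abs_nonneg _) hα1
  have h2 : |w| * |D| ≤ w ^ 2 / (2 * r) + r / 2 * D ^ 2 := by
    rw [← sq_abs w, ← sq_abs D]
    have : 0 ≤ (|w| - r * |D|) ^ 2 / (2 * r) := by positivity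
    have e : (|w| - r * |D|) ^ 2 / (2 * r)
      = |w| ^ 2 / (2 * r) + r / 2 * |D| ^ 2 - |w| * |D| := by field_simp; ring
    linarith
  have h3 : w ^ 2 / (2 * r) ≤ 4 * V := by
    rw [div_le_iff₀ (by positivity)]; linarith
  linarith

/-- Testing with `U - c` on a square, one direction. -/
theorem inside_le_of_direction {lam : ℝ} {U β : ℤ → ℤ → ℝ} (hβ : ∀ s t, lam ≤ β s t ∧ β s t ≤ 1)
    (hlam : 0 < lam) (ρ : ℕ) (hρ : 1 ≤ ρ) {c V : ℝ} (hV : 0 ≤ V)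
    (hW : ∀ s ∈ Finset.Icc (-ρ : ℤ) ρ, (U s ρ - c) ^ 2 ≤ 8 * ρ * V ∧
      (U s (-ρ) - c) ^ 2 ≤ 8 * ρ * V)
    (hT : ∑ s ∈ Finset.Icc (-ρ : ℤ) ρ, (U s (ρ + 1) - U s ρ) ^ 2 ≤ V)
    (hB : ∑ s ∈ Finset.Icc (-ρ : ℤ) ρ, (U s (-ρ) - U s (-ρ - 1)) ^ 2 ≤ V) :
    lam * ∑ s ∈ Finset.Icc (-ρ : ℤ) ρ, ∑ t ∈ Finset.Ico (-ρ : ℤ) ρ, (U s (t + 1) - U s t) ^ 2 ≤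
      squareSum (fun s t => (U s t - c) * (β s (t - 1) * (U s t - U s (t - 1))
        - β s t * (U s (t + 1) - U s t))) ρ + 25 * ρ * V := by
  have hr : (0 : ℝ) < ρ := by exact_mod_cast hρ
  have hr1 : (1 : ℝ) ≤ ρ := by exact_mod_cast hρ
  have hrow : ∀ s ∈ Finset.Icc (-ρ : ℤ) ρ,
      lam * ∑ t ∈ Finset.Ico (-ρ : ℤ) ρ, (U s (t + 1) - U s t) ^ 2 ≤
      ∑ t ∈ Finset.Icc (-ρ : ℤ) ρ, (U s t - c) * (β s (t - 1) * (U s t - U s (t - 1))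
        - β s t * (U s (t + 1) - U s t)) + (8 * V + (ρ / 2 * (U s (ρ + 1) - U s ρ) ^ 2
        + ρ / 2 * (U s (-ρ) - U s (-ρ - 1)) ^ 2)) := fun s hs => by
    have h := sum_Icc_abel (fun t => U s t - c) (β s) (-ρ) ρ (by omega)
    simp only [sub_sub_sub_cancel_right] at h
    rw [h]
    have h1 : lam * ∑ t ∈ Finset.Ico (-ρ : ℤ) ρ, (U s (t + 1) - U s t) ^ 2 ≤
        ∑ t ∈ Finset.Ico (-ρ : ℤ) ρ, β s t * (U s (t + 1) - U s t) ^ 2 := by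
      rw [Finset.mul_sum]
      exact Finset.sum_le_sum fun t _ => mul_le_mul_of_nonneg_right (hβ s t).1 (sq_nonneg _)
    have h2 := abs_mul_mul_le (D := U s (ρ + 1) - U s ρ) hr (hlam.le.trans (hβ s ρ).1)
      (hβ s ρ).2 (hW s hs).1
    have h3 := abs_mul_mul_le (D := U s (-ρ) - U s (-ρ - 1)) hr
      (hlam.le.trans (hβ s (-ρ - 1)).1) (hβ s (-ρ - 1)).2 (hW s hs).2
    linarith [le_abs_self ((U s ρ - c) * β s ρ * (U s (ρ + 1) - U s ρ)),
      neg_abs_le ((U s (-ρ) - c) * β s (-ρ - 1) * (U s (-ρ) - U s (-ρ - 1)))]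
  rw [Finset.mul_sum]
  refine (Finset.sum_le_sum hrow).trans ?_
  rw [Finset.sum_add_distrib, Finset.sum_add_distrib, Finset.sum_add_distrib, Finset.sum_const,
    ← Finset.mul_sum, ← Finset.mul_sum, Int.card_Icc, nsmul_eq_mul]
  -- There are 2ρ + 1 ≤ 3ρ rows, contributing 24ρV, and the two boundary increments add ρ/2·V each.
  -- Together they make 25ρV.
  have hc : (((ρ : ℤ) + 1 - -ρ).toNat : ℝ) ≤ 3 * ρ := by
    have : ((ρ : ℤ) + 1 - -ρ).toNat ≤ 3 * ρ := by omega
    exact_mod_cast this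
  have h4 : (((ρ : ℤ) + 1 - -ρ).toNat : ℝ) * (8 * V) ≤ 3 * ρ * (8 * V) := by gcongr
  have h5 := mul_le_mul_of_nonneg_left hT (by positivity : (0 : ℝ) ≤ ρ / 2)
  have h6 := mul_le_mul_of_nonneg_left hB (by positivity : (0 : ℝ) ≤ ρ / 2)
  rw [squareSum]
  linarith

/-- The operator `∇^* a ∇` in two dimensions, in coordinates. -/
def planarOp (α β U : ℤ → ℤ → ℝ) (s t : ℤ) : ℝ :=
  (α (s - 1) t * (U s t - U (s - 1) t) - α s t * (U (s + 1) t - U s t)) +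
    (β s (t - 1) * (U s t - U s (t - 1)) - β s t * (U s (t + 1) - U s t))

/-- The differential inequality for the energy on squares. -/
theorem hole_filling_layer {lam : ℝ} (hlam : 0 < lam) (hlam1 : lam ≤ 1) {U α β : ℤ → ℤ → ℝ}
    (hα : ∀ s t, lam ≤ α s t ∧ α s t ≤ 1) (hβ : ∀ s t, lam ≤ β s t ∧ β s t ≤ 1) (n : ℕ) :
    lam * squareSum (crossEnergy U) n ≤
      208 * (n + 1) * (squareSum (crossEnergy U) (n + 1) - squareSum (crossEnergy U) n) +
      48 / lam * (n + 1) ^ 2 * squareSum (fun s t => planarOp α β U s t ^ 2) (n + 1) := by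
  set ρ : ℕ := n + 1 with hρ
  have hr1 : (1 : ℝ) ≤ ρ := by rw [hρ]; push_cast; linarith [(Nat.cast_nonneg n : (0 : ℝ) ≤ n)]
  have hr : (0 : ℝ) < ρ := by linarith
  have hρ' : ((n : ℝ) + 1) = ρ := by rw [hρ]; push_cast; ring
  have hρZ : (n : ℤ) + 1 = (ρ : ℤ) := by rw [hρ]; push_cast; ring
  have hρZ' : -(n : ℤ) - 1 = -(ρ : ℤ) := by rw [hρ]; push_cast; ring
  rw [hρ']
  set F := squareSum (crossEnergy U) ρ with hF
  set F' := squareSum (crossEnergy U) n with hF'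
  set V := F - F' with hV
  have hg0 := crossEnergy_nonneg U
  have hF'0 : 0 ≤ F' := Finset.sum_nonneg fun s _ => Finset.sum_nonneg fun t _ => hg0 s t
  have hV0 : 0 ≤ V := sub_nonneg.2 (squareSum_mono hg0 (by omega))
  have sideV : ∀ s : ℤ, (s = ρ ∨ s = -ρ) →
      ∑ t ∈ Finset.Icc (-ρ : ℤ) ρ, crossEnergy U s t ≤ V := fun s hs =>
    side_le hg0 n (by rw [hρZ, hρZ']; exact hs)
  have sideH : ∀ t : ℤ, (t = ρ ∨ t = -ρ) →
      ∑ s ∈ Finset.Icc (-ρ : ℤ) ρ, crossEnergy U s t ≤ V := fun t ht => by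
    have := side_le (f := fun s t => crossEnergy U t s) (fun s t => hg0 t s) n (s := t)
      (by rw [hρZ, hρZ']; exact ht)
    rwa [squareSum_swap (crossEnergy U), squareSum_swap (crossEnergy U)] at this
  have hρm : (ρ : ℤ) ∈ Finset.Icc (-ρ : ℤ) ρ := by rw [Finset.mem_Icc]; omega
  have hρm' : (-ρ : ℤ) ∈ Finset.Icc (-ρ : ℤ) ρ := by rw [Finset.mem_Icc]; omega
  -- The test function is U minus its value at a corner: every boundary point is reached from the
  -- corner along at most two sides, each of squared oscillation at most 2ρV.
  set c := U ρ ρ with hc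
  have osc : ∀ x w z : ℝ, (x - w) ^ 2 ≤ 2 * ρ * V → (w - z) ^ 2 ≤ 2 * ρ * V →
      (x - z) ^ 2 ≤ 8 * ρ * V := fun x w z h1 h2 => by
    nlinarith [sq_nonneg ((x - w) - (w - z))]
  have vert : ∀ s : ℤ, (s = ρ ∨ s = -ρ) → ∀ p ∈ Finset.Icc (-ρ : ℤ) ρ,
      (U s p - U s ρ) ^ 2 ≤ 2 * ρ * V := fun s hs p hp =>
    (sq_sub_vertical_le U ρ s hp hρm).trans
      (mul_le_mul_of_nonneg_left (sideV s hs) (by positivity))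
  have horiz : ∀ t : ℤ, (t = ρ ∨ t = -ρ) → ∀ p ∈ Finset.Icc (-ρ : ℤ) ρ,
      (U p t - U ρ t) ^ 2 ≤ 2 * ρ * V := fun t ht p hp =>
    (sq_sub_horizontal_le U ρ t hp hρm).trans
      (mul_le_mul_of_nonneg_left (sideH t ht) (by positivity))
  have hV8 : 2 * ρ * V ≤ 8 * ρ * V := by
    have : 0 ≤ ρ * V := by positivity
    linarith
  have wV : ∀ s ∈ Finset.Icc (-ρ : ℤ) ρ, (U s ρ - c) ^ 2 ≤ 8 * ρ * V ∧
      (U s (-ρ) - c) ^ 2 ≤ 8 * ρ * V := fun s hs =>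
    ⟨(horiz ρ (Or.inl rfl) s hs).trans hV8,
      osc _ _ _ (horiz (-ρ) (Or.inr rfl) s hs) (vert ρ (Or.inl rfl) _ hρm')⟩
  have wH : ∀ t ∈ Finset.Icc (-ρ : ℤ) ρ, (U ρ t - c) ^ 2 ≤ 8 * ρ * V ∧
      (U (-ρ) t - c) ^ 2 ≤ 8 * ρ * V := fun t ht =>
    ⟨(vert ρ (Or.inl rfl) t ht).trans hV8,
      osc _ _ _ (vert (-ρ) (Or.inr rfl) t ht) (horiz ρ (Or.inl rfl) _ hρm')⟩
  have gle : ∀ s t, (U s (t + 1) - U s t) ^ 2 ≤ crossEnergy U s t ∧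
      (U s t - U s (t - 1)) ^ 2 ≤ crossEnergy U s t ∧
      (U (s + 1) t - U s t) ^ 2 ≤ crossEnergy U s t ∧
      (U s t - U (s - 1) t) ^ 2 ≤ crossEnergy U s t := fun s t => by
    have h1 := sq_nonneg (U (s + 1) t - U s t)
    have h2 := sq_nonneg (U s t - U (s - 1) t)
    have h3 := sq_nonneg (U s (t + 1) - U s t)
    have h4 := sq_nonneg (U s t - U s (t - 1))
    rw [crossEnergy]
    refine ⟨?_, ?_, ?_, ?_⟩ <;> linarith
  have dirV := inside_le_of_direction hβ hlam ρ (by omega) hV0 wV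
    ((Finset.sum_le_sum fun s _ => (gle s ρ).1).trans (sideH ρ (Or.inl rfl)))
    ((Finset.sum_le_sum fun s _ => (gle s (-ρ)).2.1).trans (sideH (-ρ) (Or.inr rfl)))
  have dirH := inside_le_of_direction (U := fun s t => U t s) (β := fun s t => α t s)
    (fun s t => hα t s) hlam ρ (by omega) hV0 wH
    ((Finset.sum_le_sum fun t _ => (gle ρ t).2.2.1).trans (sideV ρ (Or.inl rfl)))
    ((Finset.sum_le_sum fun t _ => (gle (-ρ) t).2.2.2).trans (sideV (-ρ) (Or.inr rfl)))
  have inV := squareSum_le_two_mul_inside U n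
  have inH := squareSum_le_two_mul_inside (fun s t => U t s) n
  rw [← hρ] at inV inH
  set EV := ∑ s ∈ Finset.Icc (-ρ : ℤ) ρ, ∑ t ∈ Finset.Ico (-ρ : ℤ) ρ, (U s (t + 1) - U s t) ^ 2
  set EH := ∑ s ∈ Finset.Icc (-ρ : ℤ) ρ, ∑ t ∈ Finset.Ico (-ρ : ℤ) ρ, (U (t + 1) s - U t s) ^ 2
  have hsplit : F' = squareSum (fun s t => (U s (t + 1) - U s t) ^ 2
        + (U s t - U s (t - 1)) ^ 2) n +
      squareSum (fun s t => (U (t + 1) s - U t s) ^ 2 + (U t s - U (t - 1) s) ^ 2) n := by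
    rw [squareSum_swap (fun s t => (U (s + 1) t - U s t) ^ 2 + (U s t - U (s - 1) t) ^ 2) n, hF',
      squareSum, squareSum, squareSum, ← Finset.sum_add_distrib]
    refine Finset.sum_congr rfl fun s _ => ?_
    rw [← Finset.sum_add_distrib]
    exact Finset.sum_congr rfl fun t _ => by rw [crossEnergy]; ring
  have hop : squareSum (fun s t => (U s t - c) * (β s (t - 1) * (U s t - U s (t - 1))
        - β s t * (U s (t + 1) - U s t))) ρ
      + squareSum (fun s t => (U t s - c) * (α (t - 1) s * (U t s - U (t - 1) s)
        - α t s * (U (t + 1) s - U t s))) ρ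
      = squareSum (fun s t => (U s t - c) * planarOp α β U s t) ρ := by
    rw [squareSum_swap (fun s t => (U s t - c) * (α (s - 1) t * (U s t - U (s - 1) t)
        - α s t * (U (s + 1) t - U s t))) ρ,
      squareSum, squareSum, squareSum, ← Finset.sum_add_distrib]
    refine Finset.sum_congr rfl fun s _ => ?_
    rw [← Finset.sum_add_distrib]
    exact Finset.sum_congr rfl fun t _ => by rw [planarOp]; ring
  set H := squareSum (fun s t => planarOp α β U s t ^ 2) ρ with hH
  have hcard : (((ρ : ℤ) + 1 - -ρ).toNat : ℝ) ≤ 3 * ρ := by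
    have : ((ρ : ℤ) + 1 - -ρ).toNat ≤ 3 * ρ := by omega
    exact_mod_cast this
  have hF0 : 0 ≤ F := by linarith
  -- A Poincaré inequality: from an interior point go vertically to the top side, then along it to
  -- the corner.
  have hW2 : squareSum (fun s t => (U s t - c) ^ 2) ρ ≤ 12 * ρ ^ 2 * F + 36 * ρ ^ 3 * V := by
    have hpt : ∀ s ∈ Finset.Icc (-ρ : ℤ) ρ, ∀ t ∈ Finset.Icc (-ρ : ℤ) ρ, (U s t - c) ^ 2 ≤
        4 * ρ * ∑ t' ∈ Finset.Icc (-ρ : ℤ) ρ, crossEnergy U s t' + 4 * ρ * V :=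
      fun s hs t ht => by
      have h1 := sq_sub_vertical_le U ρ s ht hρm
      have h2 := horiz ρ (Or.inl rfl) s hs
      nlinarith [sq_nonneg ((U s t - U s ρ) - (U s ρ - c))]
    refine (Finset.sum_le_sum fun s hs => Finset.sum_le_sum fun t ht => hpt s hs t ht).trans ?_
    simp only [Finset.sum_const, Int.card_Icc, nsmul_eq_mul, ← Finset.mul_sum,
      Finset.sum_add_distrib]
    have e : ∑ i ∈ Finset.Icc (-ρ : ℤ) ρ, ∑ t' ∈ Finset.Icc (-ρ : ℤ) ρ, crossEnergy U i t' = F :=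
      rfl
    rw [e]
    set N : ℝ := (((ρ : ℤ) + 1 - -ρ).toNat : ℝ)
    have hN0 : (0 : ℝ) ≤ N := Nat.cast_nonneg _
    calc _ = N * (4 * ρ * F) + N * (N * (4 * ρ * V)) := by ring
      _ ≤ 3 * ρ * (4 * ρ * F) + 3 * ρ * (3 * ρ * (4 * ρ * V)) := by gcongr
      _ = _ := by ring
  -- The coefficient lam/(48ρ²) turns the leading 12ρ²F of the Poincaré bound into lam·F/4. After
  -- the factor 2 from the two directions, half of lam·F' can be absorbed on the left.
  have hYoung : squareSum (fun s t => (U s t - c) * planarOp α β U s t) ρ ≤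
      lam / (48 * ρ ^ 2) * squareSum (fun s t => (U s t - c) ^ 2) ρ + 12 * ρ ^ 2 / lam * H := by
    rw [hH, squareSum, squareSum, squareSum, Finset.mul_sum, Finset.mul_sum,
      ← Finset.sum_add_distrib]
    refine Finset.sum_le_sum fun s _ => ?_
    rw [Finset.mul_sum, Finset.mul_sum, ← Finset.sum_add_distrib]
    refine Finset.sum_le_sum fun t _ => ?_
    set w := U s t - c
    set h := planarOp α β U s t
    have h0 : 0 ≤ (lam * w - 24 * ρ ^ 2 * h) ^ 2 / (48 * ρ ^ 2 * lam) := by positivity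
    have e : (lam * w - 24 * ρ ^ 2 * h) ^ 2 / (48 * ρ ^ 2 * lam)
      = lam / (48 * ρ ^ 2) * w ^ 2 + 12 * ρ ^ 2 / lam * h ^ 2 - w * h := by
      field_simp; ring
    linarith
  have hW3 : lam / (48 * ρ ^ 2) * squareSum (fun s t => (U s t - c) ^ 2) ρ ≤
      lam / 4 * F + lam * ρ * V := by
    refine (mul_le_mul_of_nonneg_left hW2 (by positivity)).trans ?_
    have e : lam / (48 * ρ ^ 2) * (12 * ρ ^ 2 * F + 36 * ρ ^ 3 * V)
      = lam / 4 * F + 3 / 4 * (lam * ρ * V) := by field_simp; ring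
    have : 0 ≤ lam * ρ * V := by positivity
    linarith
  have hFV : F = F' + V := by rw [hV]; ring
  have hlV : lam * V ≤ ρ * V := mul_le_mul_of_nonneg_right (hlam1.trans hr1) hV0
  have hlV' : lam * ρ * V ≤ 1 * ρ * V := by gcongr
  have hρV : 0 ≤ ρ * V := by positivity
  have hFE : lam * F' ≤ 2 * (lam * EV) + 2 * (lam * EH) := by
    have : F' ≤ 2 * EV + 2 * EH := by linarith
    have := mul_le_mul_of_nonneg_left this hlam.le
    linarith
  have e48 : 48 / lam * ρ ^ 2 * H = 4 * (12 * ρ ^ 2 / lam * H) := by ring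
  rw [e48]
  rw [hFV, mul_add] at hW3
  linarith

/-- Summing the layer inequality over n from r to 2r telescopes to lam·F(r) ≤ 416(F(2r) - F(r)) +
error. Adding 416·F(r) to both sides fills the hole and produces the factor 416/(416 + lam) < 1. -/
theorem hole_filling_double {lam : ℝ} (hlam : 0 < lam) (hlam1 : lam ≤ 1) {U α β : ℤ → ℤ → ℝ}
    (hα : ∀ s t, lam ≤ α s t ∧ α s t ≤ 1) (hβ : ∀ s t, lam ≤ β s t ∧ β s t ≤ 1) {H : ℝ}
    (hH : ∀ ρ, squareSum (fun s t => planarOp α β U s t ^ 2) ρ ≤ H) (r : ℕ) (hr : 1 ≤ r) :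
    squareSum (crossEnergy U) r ≤ 416 / (416 + lam) *
      (squareSum (crossEnergy U) (2 * r) + 192 / lam * r ^ 2 * H) := by
  set F := squareSum (crossEnergy U) with hF
  have hmono : Monotone F := squareSum_mono (crossEnergy_nonneg U)
  have hH0 : 0 ≤ H := (squareSum_nonneg
    (f := fun s t => planarOp α β U s t ^ 2) (fun _ _ => sq_nonneg _) 0).trans (hH 0)
  have hr' : (1 : ℝ) ≤ r := by exact_mod_cast hr
  have hlayer : ∀ n ∈ Finset.Ico r (2 * r), lam * F r ≤ 416 * r * (F (n + 1) - F n) +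
      192 / lam * r ^ 2 * H := fun n hn => by
    rw [Finset.mem_Ico] at hn
    have h1 := hole_filling_layer hlam hlam1 (U := U) hα hβ n
    have h2 : lam * F r ≤ lam * F n := mul_le_mul_of_nonneg_left (hmono hn.1) hlam.le
    have h3 : (n : ℝ) + 1 ≤ 2 * r := by exact_mod_cast hn.2
    have h4 : 0 ≤ F (n + 1) - F n := sub_nonneg.2 (hmono (Nat.le_succ n))
    have h5 : 208 * ((n : ℝ) + 1) * (F (n + 1) - F n) ≤ 208 * (2 * r) * (F (n + 1) - F n) := by
      gcongr
    have h6 : 48 / lam * ((n : ℝ) + 1) ^ 2 * squareSum (fun s t => planarOp α β U s t ^ 2) (n + 1)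
        ≤ 48 / lam * (2 * r) ^ 2 * H := by
      refine mul_le_mul (by gcongr) (hH _) (squareSum_nonneg (fun _ _ => sq_nonneg _) _)
        (by positivity)
    rw [← hF] at h1
    have h7 : 48 / lam * (2 * (r : ℝ)) ^ 2 * H = 192 / lam * r ^ 2 * H := by ring
    have h8 : 208 * (2 * (r : ℝ)) * (F (n + 1) - F n) = 416 * r * (F (n + 1) - F n) := by ring
    rw [h7] at h6
    rw [h8] at h5
    linarith
  have hsum := Finset.sum_le_sum hlayer
  rw [Finset.sum_const, Nat.card_Ico, nsmul_eq_mul, Finset.sum_add_distrib, Finset.sum_const,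
    Nat.card_Ico, nsmul_eq_mul, ← Finset.mul_sum, Finset.sum_Ico_sub F (by omega),
    show 2 * r - r = r by omega] at hsum
  have h7 : lam * F r ≤ 416 * (F (2 * r) - F r) + 192 / lam * r ^ 2 * H := by
    have hr0 : (0 : ℝ) < r := by linarith
    refine le_of_mul_le_mul_left ?_ hr0
    linarith
  rw [div_mul_eq_mul_div, le_div_iff₀ (by positivity)]
  have h8 : 0 ≤ 192 / lam * r ^ 2 * H := by positivity
  linarith

theorem hole_filling {lam : ℝ} (hlam : 0 < lam) (hlam1 : lam ≤ 1) {U α β : ℤ → ℤ → ℝ}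
    (hα : ∀ s t, lam ≤ α s t ∧ α s t ≤ 1) (hβ : ∀ s t, lam ≤ β s t ∧ β s t ≤ 1) {H E : ℝ}
    (hH : ∀ ρ, squareSum (fun s t => planarOp α β U s t ^ 2) ρ ≤ H)
    (hE : ∀ ρ, squareSum (crossEnergy U) ρ ≤ E) (K : ℕ) :
    squareSum (crossEnergy U) 1 ≤ (416 / (416 + lam)) ^ K * (E + 192 / lam * 4 ^ K * H) := by
  set θ : ℝ := 416 / (416 + lam) with hθ
  have hθ0 : 0 < θ := by positivity
  have hθ2 : 1 ≤ 2 * θ := by rw [hθ, mul_div_assoc', le_div_iff₀ (by positivity)]; linarith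
  have hH0 : 0 ≤ H := (squareSum_nonneg
    (f := fun s t => planarOp α β U s t ^ 2) (fun _ _ => sq_nonneg _) 0).trans (hH 0)
  have main : ∀ K : ℕ, squareSum (crossEnergy U) 1 ≤
      θ ^ K * (squareSum (crossEnergy U) (2 ^ K) + 192 / lam * 4 ^ K * H) := by
    intro K
    induction K with
    | zero =>
      have : 0 ≤ 192 / lam * 4 ^ 0 * H := by positivity
      simp only [pow_zero, one_mul] at this ⊢
      linarith
    | succ K ih =>
      have h := hole_filling_double hlam hlam1 hα hβ hH (2 ^ K) Nat.one_le_two_pow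
      have e : ((2 ^ K : ℕ) : ℝ) ^ 2 = 4 ^ K := by
        push_cast; rw [← pow_mul, mul_comm, pow_mul]; norm_num
      rw [e, show 2 * 2 ^ K = 2 ^ (K + 1) by ring] at h
      refine ih.trans ?_
      rw [pow_succ θ, mul_assoc (θ ^ K)]
      refine mul_le_mul_of_nonneg_left ?_ (pow_nonneg hθ0.le K)
      -- Since θ ≥ 1/2, an error X at scale 2^K is at most 2θX. The old and new errors thus amount
      -- to 3θX, below the θ·4X allowed at the next scale.
      have h2 : 192 / lam * 4 ^ K * H ≤ 2 * θ * (192 / lam * 4 ^ K * H) :=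
        le_mul_of_one_le_left (by positivity) hθ2
      have h3 : 192 / lam * 4 ^ (K + 1) * H = 4 * (192 / lam * 4 ^ K * H) := by
        rw [pow_succ]; ring
      rw [h3]
      have h4 : 0 ≤ θ * (192 / lam * 4 ^ K * H) := by positivity
      linarith
  refine (main K).trans ?_
  gcongr
  exact hE _

/-! ### Quenched summability of the gradients -/

theorem sum_Ico_le_of_dissipation {f g : ℕ → ℝ} {c : ℝ} (hf : ∀ n, 0 ≤ f n)
    (h : ∀ n, f (n + 1) + c * g n ≤ f n) {M N : ℕ} (hMN : M ≤ N) :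
    c * ∑ n ∈ Finset.Ico M N, g n ≤ f M := by
  have key : c * ∑ n ∈ Finset.Ico M N, g n ≤ f M - f N := by
    induction N, hMN using Nat.le_induction with
    | base => simp
    | succ N hN ih =>
      rw [Finset.sum_Ico_succ_top hN, mul_add]
      linarith [h N]
  linarith [hf N]

/-- The plane through `x₀`, in coordinates. -/
def planePoint (x₀ : Vertex 2) (s t : ℤ) : Vertex 2 := ![x₀ 0 + s, x₀ 1 + t]

theorem planePoint_add_zero (x₀ : Vertex 2) (s t : ℤ) :
    planePoint x₀ (s + 1) t = planePoint x₀ s t + basisVec 0 := by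
  funext i; fin_cases i <;> simp [planePoint, basisVec, add_assoc]

theorem planePoint_sub_zero (x₀ : Vertex 2) (s t : ℤ) :
    planePoint x₀ (s - 1) t = planePoint x₀ s t - basisVec 0 := by
  rw [eq_sub_iff_add_eq, ← planePoint_add_zero, sub_add_cancel]

theorem planePoint_add_one (x₀ : Vertex 2) (s t : ℤ) :
    planePoint x₀ s (t + 1) = planePoint x₀ s t + basisVec 1 := by
  funext i; fin_cases i <;> simp [planePoint, basisVec, add_assoc]

theorem planePoint_sub_one (x₀ : Vertex 2) (s t : ℤ) :
    planePoint x₀ s (t - 1) = planePoint x₀ s t - basisVec 1 := by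
  rw [eq_sub_iff_add_eq, ← planePoint_add_one, sub_add_cancel]

theorem squareSum_planePoint_le (x₀ : Vertex 2) {f : Vertex 2 → ℝ} (hf : ∀ x, 0 ≤ f x)
    (hs : Summable f) (ρ : ℕ) : squareSum (fun s t => f (planePoint x₀ s t)) ρ ≤ ∑' x, f x := by
  have hinj : Function.Injective fun p : ℤ × ℤ => planePoint x₀ p.1 p.2 := fun p q h => by
    have h0 := congrFun h 0
    have h1 := congrFun h 1
    simp [planePoint] at h0 h1
    exact Prod.ext h0 h1
  rw [squareSum, ← Finset.sum_product']
  have := hs.sum_le_tsum ((Finset.Icc (-ρ : ℤ) ρ ×ˢ Finset.Icc (-ρ : ℤ) ρ).map ⟨_, hinj⟩)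
    (fun x _ => hf x)
  rwa [Finset.sum_map] at this

/-- Bounds the gradient at one edge by the global energy times θ^K, with A u treated as a right-hand
side. For u = p_n with n ~ 4^K both terms in the bracket have the same size after summation over a
block. -/
theorem sq_grad_le_hole_filling {lam : ℝ} (hlam : 0 < lam) {a : Edge 2 → ℝ}
    (ha : UnifElliptic lam a) {u : Vertex 2 → ℝ} (hu : (Function.support u).Finite) (e : Edge 2)
    (K : ℕ) : grad u e ^ 2 ≤ (416 / (416 + lam)) ^ K *
      (2 / lam * energy a u + 192 / lam * 4 ^ K * ∑' x, ellipticOp a u x ^ 2) := by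
  have hlam1 : lam ≤ 1 := (ha e).1.trans (ha e).2
  obtain ⟨x₀, i⟩ := e
  set U : ℤ → ℤ → ℝ := fun s t => u (planePoint x₀ s t) with hU
  set α : ℤ → ℤ → ℝ := fun s t => a (planePoint x₀ s t, 0) with hα
  set β : ℤ → ℤ → ℝ := fun s t => a (planePoint x₀ s t, 1) with hβ
  have hop : ∀ s t, planarOp α β U s t = ellipticOp a u (planePoint x₀ s t) := fun s t => by
    simp only [planarOp, ellipticOp_apply, hU, hα, hβ, planePoint_add_zero, planePoint_sub_zero,
      planePoint_add_one, planePoint_sub_one, Fin.sum_univ_two]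
  set G : Vertex 2 → ℝ := fun x => ∑ i, (grad u (x, i) ^ 2 + grad u (x - basisVec i, i) ^ 2)
    with hG
  have hcross : ∀ s t, crossEnergy U s t = G (planePoint x₀ s t) := fun s t => by
    simp only [crossEnergy, hU, hG, grad, planePoint_add_zero, planePoint_sub_zero,
      planePoint_add_one, planePoint_sub_one, Fin.sum_univ_two, sub_add_cancel]
  have s1 : ∀ i, Summable fun x => grad u (x, i) ^ 2 := fun i =>
    summable_of_hasFiniteSupport (finite_support_of_local hu fun x h h' _ => by simp [grad, h, h'])
  have s2 : ∀ i, Summable fun x => grad u (x - basisVec i, i) ^ 2 := fun i =>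
    summable_of_hasFiniteSupport (finite_support_of_local hu fun x h _ h' => by simp [grad, h, h'])
  have hG0 : ∀ x, 0 ≤ G x := fun x => Finset.sum_nonneg fun i _ => by positivity
  have hGs : Summable G := summable_sum fun i _ => (s1 i).add (s2 i)
  have hGsum : ∑' x, G x ≤ 2 / lam * energy a u := by
    have h1 : ∑' x, G x = 2 * ∑' x, ∑ i, grad u (x, i) ^ 2 := by
      rw [hG, Summable.tsum_finsetSum fun i _ => (s1 i).add (s2 i),
        Summable.tsum_finsetSum fun i _ => s1 i, Finset.mul_sum]
      refine Finset.sum_congr rfl fun i _ => ?_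
      rw [(s1 i).tsum_add (s2 i), ← tsum_add_right (fun x => grad u (x - basisVec i, i) ^ 2)
        (basisVec i)]
      simp only [add_sub_cancel_right]
      ring
    have h2 : lam * ∑' x, ∑ i, grad u (x, i) ^ 2 ≤ energy a u := by
      rw [energy, ← tsum_mul_left]
      refine Summable.tsum_le_tsum (fun x => ?_) ((summable_sum fun i _ => s1 i).mul_left _)
        (summable_of_hasFiniteSupport
        (finite_support_of_local hu fun x h h' _ => by simp [grad, h, h']))
      rw [Finset.mul_sum]
      exact Finset.sum_le_sum fun i _ => mul_le_mul_of_nonneg_right (ha _).1 (sq_nonneg _)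
    rw [h1, div_mul_eq_mul_div, le_div_iff₀ hlam]
    linarith
  have hHs : Summable fun x => ellipticOp a u x ^ 2 :=
    summable_of_hasFiniteSupport (finite_support_of_local (ellipticOp_finite (a := a) hu)
      fun x h _ _ => by simp [h])
  have main := hole_filling hlam hlam1 (U := U) (α := α) (β := β) (fun s t => ha _)
    (fun s t => ha _) (H := ∑' x, ellipticOp a u x ^ 2) (E := 2 / lam * energy a u)
    (fun ρ => by
      simp only [hop]
      exact squareSum_planePoint_le x₀ (f := fun x => ellipticOp a u x ^ 2)
        (fun x => sq_nonneg _) hHs ρ)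
    (fun ρ => by
      have : crossEnergy U = fun s t => G (planePoint x₀ s t) := by
        funext s t; exact hcross s t
      rw [this]
      exact (squareSum_planePoint_le x₀ hG0 hGs ρ).trans hGsum) K
  refine le_trans ?_ main
  have h0 : crossEnergy U 0 0 ≤ squareSum (crossEnergy U) 1 := by
    have : squareSum (crossEnergy U) 0 = crossEnergy U 0 0 := by simp [squareSum]
    rw [← this]
    exact squareSum_mono (crossEnergy_nonneg U) (by omega)
  refine le_trans ?_ h0
  have hx : planePoint x₀ 0 0 = x₀ := by
    funext i; fin_cases i <;> simp [planePoint]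
  rw [hcross, hx]
  refine le_trans ?_ (Finset.single_le_sum (f := fun i => grad u (x₀, i) ^ 2
    + grad u (x₀ - basisVec i, i) ^ 2) (fun i _ => by positivity) (Finset.mem_univ i))
  exact le_add_of_nonneg_right (sq_nonneg _)

/-- A block of squared gradients is at most Cθ^j 4^{-j}: the energies sum to order 4^{-j} and the
squares of A p_n to order 4^{-2j}, the latter multiplied by 4^j. Cauchy–Schwarz over 12·4^j times
leaves the summable √θ^j, where θ = 1 would only just fail. -/
theorem summable_abs_grad_heat_two {lam : ℝ} (hlam : 0 < lam) {a : Edge 2 → ℝ}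
    (ha : UnifElliptic lam a) (y : Vertex 2) (e : Edge 2) :
    Summable fun n => |grad (heat a n y) e| := by
  have hd : 0 < 2 := by norm_num
  have ha' : ∀ e, 0 ≤ a e ∧ a e ≤ 1 := fun e => ⟨hlam.le.trans (ha e).1, (ha e).2⟩
  obtain ⟨K, hK, hon⟩ := exists_heat_sq_le hd hlam
  set θ : ℝ := 416 / (416 + lam) with hθ
  have hθ0 : 0 < θ := by positivity
  have hθ1 : θ < 1 := by rw [hθ, div_lt_one (by positivity)]; linarith
  set m : ℕ → ℝ := fun n => ∑' x, heat a n y x ^ 2 with hm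
  set En : ℕ → ℝ := fun n => energy a (heat a n y) with hEn
  set H : ℕ → ℝ := fun n => ∑' x, ellipticOp a (heat a n y) x ^ 2 with hH
  have hm0 : ∀ n, 0 ≤ m n := fun n => tsum_nonneg fun x => sq_nonneg _
  have hE0 : ∀ n, 0 ≤ En n := fun n => energy_nonneg ha' _
  have hH0 : ∀ n, 0 ≤ H n := fun n => tsum_nonneg fun x => sq_nonneg _
  have d1 : ∀ n, m (n + 1) + 1 / 16 * En n ≤ m n := fun n => by
    have := tsum_sq_step hd ha' (heat_finite a n y)
    rw [← heat_succ] at this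
    norm_num at this
    simp only [hm, hEn]
    linarith
  have d2 : ∀ n, En (n + 1) + 1 / 8 * H n ≤ En n := fun n => by
    have := energy_step hd ha' (heat_finite a n y)
    rw [← heat_succ] at this
    norm_num at this
    simp only [hH, hEn]
    linarith
  have hEanti : Antitone En := antitone_nat_of_succ_le fun n => by linarith [d2 n, hH0 n]
  have hmj : ∀ j n, 4 ^ j ≤ n → m n ≤ K * ((4 : ℝ) ^ j)⁻¹ := fun j n hn => by
    have := hon a ha y j n hn
    rwa [mul_comm j 2, pow_mul, show (2 : ℝ) ^ 2 = 4 by norm_num] at this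
  -- The energy is nonincreasing, so its value at the end of a block is at most its average over the
  -- block, which the dissipation of the ℓ² norm bounds.
  have hEj : ∀ j, En (4 ^ (j + 1)) ≤ 16 * K * ((4 : ℝ) ^ j)⁻¹ * ((4 : ℝ) ^ j)⁻¹ := fun j => by
    have hle : 4 ^ j ≤ 4 ^ (j + 1) := Nat.pow_le_pow_right (by norm_num) (by omega)
    have h1 := sum_Ico_le_of_dissipation hm0 d1 hle
    have h2 : (4 : ℝ) ^ j * En (4 ^ (j + 1)) ≤ ∑ n ∈ Finset.Ico (4 ^ j) (4 ^ (j + 1)), En n := by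
      have h3 := Finset.card_nsmul_le_sum (Finset.Ico (4 ^ j) (4 ^ (j + 1))) En
        (En (4 ^ (j + 1))) fun n hn => hEanti (Finset.mem_Ico.1 hn).2.le
      rw [Nat.card_Ico, nsmul_eq_mul] at h3
      refine le_trans (mul_le_mul_of_nonneg_right ?_ (hE0 _)) h3
      have : 4 ^ j ≤ 4 ^ (j + 1) - 4 ^ j := by rw [pow_succ]; omega
      exact_mod_cast this
    have h4 := hmj j _ le_rfl
    rw [← div_eq_mul_inv _ ((4 : ℝ) ^ j), le_div_iff₀ (by positivity)]
    linarith
  have hblock : ∀ j, ∑ n ∈ Finset.Ico (4 ^ (j + 1)) (4 ^ (j + 2)), grad (heat a n y) e ^ 2 ≤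
      θ ^ j * ((32 / lam * K + 24576 / lam * K) * ((4 : ℝ) ^ j)⁻¹) := fun j => by
    have hle : 4 ^ (j + 1) ≤ 4 ^ (j + 2) := Nat.pow_le_pow_right (by norm_num) (by omega)
    refine (Finset.sum_le_sum fun n _ =>
      sq_grad_le_hole_filling hlam ha (heat_finite a n y) e j).trans ?_
    rw [← Finset.mul_sum, Finset.sum_add_distrib, ← Finset.mul_sum, ← Finset.mul_sum]
    refine mul_le_mul_of_nonneg_left ?_ (by positivity)
    have h1 := sum_Ico_le_of_dissipation hm0 d1 hle
    have h2 := sum_Ico_le_of_dissipation hE0 d2 hle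
    have h3 := hmj j (4 ^ (j + 1)) (Nat.pow_le_pow_right (by norm_num) (by omega))
    have h4 := hEj j
    have h5 : ∑ n ∈ Finset.Ico (4 ^ (j + 1)) (4 ^ (j + 2)), En n ≤ 16 * (K * ((4 : ℝ) ^ j)⁻¹) := by
      linarith
    have h6 : ∑ n ∈ Finset.Ico (4 ^ (j + 1)) (4 ^ (j + 2)), H n ≤
        8 * (16 * K * ((4 : ℝ) ^ j)⁻¹ * ((4 : ℝ) ^ j)⁻¹) := by linarith
    calc _ ≤ 2 / lam * (16 * (K * ((4 : ℝ) ^ j)⁻¹)) + 192 / lam * 4 ^ j *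
          (8 * (16 * K * ((4 : ℝ) ^ j)⁻¹ * ((4 : ℝ) ^ j)⁻¹)) := by gcongr
      _ = _ := by field_simp; ring
  set D : ℝ := 12 * (32 / lam * K + 24576 / lam * K) with hD
  have hD0 : 0 ≤ D := by positivity
  refine summable_of_four_pow_blocks (fun n => abs_nonneg _)
    ((summable_geometric_of_lt_one (Real.sqrt_nonneg θ)
      (by rwa [Real.sqrt_lt' one_pos, one_pow])).mul_left (Real.sqrt D)) fun j => ?_
  have h1 := sq_sum_le_card_mul_sum_sq (s := Finset.Ico (4 ^ (j + 1)) (4 ^ (j + 2)))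
    (f := fun n => |grad (heat a n y) e|)
  simp only [sq_abs] at h1
  have h2 : (4 : ℕ) ^ (j + 2) - 4 ^ (j + 1) = 12 * 4 ^ j := by rw [pow_add, pow_succ]; omega
  rw [Nat.card_Ico, h2] at h1
  refine abs_le_of_sq_le_sq' (a := ∑ n ∈ Finset.Ico (4 ^ (j + 1)) (4 ^ (j + 2)),
    |grad (heat a n y) e|) ?_ (by positivity) |>.2
  rw [mul_pow, Real.sq_sqrt hD0, ← pow_mul, mul_comm j 2, pow_mul, Real.sq_sqrt hθ0.le]
  refine h1.trans ((mul_le_mul_of_nonneg_left (hblock j) (by positivity)).trans (le_of_eq ?_))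
  rw [hD]; push_cast; field_simp

/-- In dimension `d > 2` the transition probabilities are summable in time, uniformly in space. -/
theorem exists_summable_heat_bound (hd : 2 < d) {lam : ℝ} (hlam : 0 < lam) {a : Edge d → ℝ}
    (ha : UnifElliptic lam a) (y : Vertex d) :
    ∃ b : ℕ → ℝ, Summable b ∧ ∀ n x, heat a n y x ≤ b n := by
  have hd0 : 0 < d := by omega
  have ha' : ∀ e, 0 ≤ a e ∧ a e ≤ 1 := fun e => ⟨hlam.le.trans (ha e).1, (ha e).2⟩
  obtain ⟨K, hK, hon⟩ := exists_heat_sq_le hd0 hlam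
  have hbdd : ∀ n, BddAbove (Set.range fun x => heat a n y x) := fun n =>
    ⟨1, by rintro _ ⟨x, rfl⟩; exact heat_le_one hd0 ha' n y x⟩
  refine ⟨fun n => ⨆ x, heat a n y x, ?_, fun n x => le_ciSup (hbdd n) x⟩
  refine summable_of_four_pow_blocks
    (fun n => (heat_nonneg hd0 ha' n y y).trans (le_ciSup (hbdd n) y))
    ((summable_geometric_two).mul_left (12 * K)) fun j => ?_
  have hn : ∀ n ∈ Finset.Ico (4 ^ (j + 1)) (4 ^ (j + 2)),
      ⨆ x, heat a n y x ≤ K * ((2 : ℝ) ^ (j * d))⁻¹ := fun n hn => by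
    rw [Finset.mem_Ico, pow_succ] at hn
    refine ciSup_le fun x => ?_
    -- Chapman–Kolmogorov and Young's inequality reduce the sup norm to two on-diagonal ℓ² bounds,
    -- both at times at least 4^j.
    obtain ⟨k, rfl⟩ : ∃ k, n = k + 4 ^ j := ⟨n - 4 ^ j, by omega⟩
    have s : ∀ (k : ℕ) (x : Vertex d), Summable fun z => heat a k x z ^ 2 := fun k x =>
      summable_of_hasFiniteSupport (finite_support_of_local (heat_finite a k x)
        fun x h _ _ => by simp [h])
    rw [← tsum_heat_mul_heat a k (4 ^ j) x y]
    have h1 : ∑' z, heat a k x z * heat a (4 ^ j) y z ≤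
        ∑' z, (1 / 2 * heat a k x z ^ 2 + 1 / 2 * heat a (4 ^ j) y z ^ 2) := by
      refine (summable_heat_mul a _ y _).tsum_le_tsum (fun z => ?_)
        (((s k x).mul_left _).add ((s _ y).mul_left _))
      nlinarith [sq_nonneg (heat a k x z - heat a (4 ^ j) y z)]
    rw [((s k x).mul_left _).tsum_add ((s _ y).mul_left _), tsum_mul_left, tsum_mul_left] at h1
    have h2 := hon a ha x j k (by omega)
    have h3 := hon a ha y j (4 ^ j) le_rfl
    linarith
  refine (Finset.sum_le_card_nsmul _ _ _ hn).trans ?_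
  have h2 : (4 : ℕ) ^ (j + 2) - 4 ^ (j + 1) = 12 * 4 ^ j := by rw [pow_add, pow_succ]; omega
  rw [Nat.card_Ico, h2, nsmul_eq_mul]
  push_cast
  -- The block has 12·4^j times, so the bound is of order 2^{j(2-d)}, and d ≥ 3 makes this
  -- geometric.
  have h3 : (4 : ℝ) ^ j * ((2 : ℝ) ^ (j * d))⁻¹ ≤ (1 / 2) ^ j := by
    rw [← div_eq_mul_inv, div_le_iff₀ (by positivity), one_div, inv_pow,
      ← div_eq_inv_mul, le_div_iff₀ (by positivity), show (4 : ℝ) = 2 ^ 2 by norm_num, ← pow_mul,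
      ← pow_add]
    exact pow_le_pow_right₀ (by norm_num) (by nlinarith)
  calc _ = 12 * K * ((4 : ℝ) ^ j * ((2 : ℝ) ^ (j * d))⁻¹) := by ring
    _ ≤ _ := by gcongr

theorem summable_grad_heat (hd : 2 ≤ d) {lam : ℝ} (hlam : 0 < lam) {a : Edge d → ℝ}
    (ha : UnifElliptic lam a) (y : Vertex d) (e : Edge d) :
    Summable fun n => |grad (heat a n y) e| := by
  rcases hd.eq_or_lt with rfl | hd
  · exact summable_abs_grad_heat_two hlam ha y e
  · obtain ⟨b, hb, hle⟩ := exists_summable_heat_bound hd hlam ha y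
    have ha' : ∀ e, 0 ≤ a e ∧ a e ≤ 1 := fun e => ⟨hlam.le.trans (ha e).1, (ha e).2⟩
    refine Summable.of_nonneg_of_le (fun n => abs_nonneg _) (fun n => ?_) hb
    have h1 := heat_nonneg (by omega) ha' n y e.1
    have h2 := heat_nonneg (by omega) ha' n y (e.1 + basisVec e.2)
    have h3 := hle n e.1
    have h4 := hle n (e.1 + basisVec e.2)
    rw [grad, abs_le]
    constructor <;> linarith

/-! ### The Green function as a sum of transition probabilities -/

theorem hasSum_ellipticOp (a : Edge d → ℝ) {f : ℕ → Vertex d → ℝ} {g : Vertex d → ℝ}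
    (h : ∀ x, HasSum (fun n => f n x) (g x)) (x : Vertex d) :
    HasSum (fun n => ellipticOp a (f n) x) (ellipticOp a g x) := by
  simp only [ellipticOp_apply]
  exact hasSum_sum fun i _ =>
    (((h _).sub (h _)).mul_left _).sub (((h _).sub (h _)).mul_left _)

/-- The resolvent `(c + ∇^* a ∇)⁻¹ δ_y` as a power series in the transition operator. -/
noncomputable def resolventSeries (c : ℝ) (a : Edge d → ℝ) (y x : Vertex d) : ℝ :=
  (4 * d : ℝ)⁻¹ * (1 + (4 * d : ℝ)⁻¹ * c)⁻¹ *
    ∑' n, ((1 + (4 * d : ℝ)⁻¹ * c)⁻¹) ^ n * heat a n y x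

/-- Applying c + A = κ⁻¹((1 + κc) - P) to the series turns the n-th term into s^n p_n - s^{n+1}
p_{n+1}, and the sum telescopes to p_0 = δ_y. The case c = 0 is included whenever the series
converges. -/
theorem resolventSeries_solves (hd : 0 < d) {c : ℝ} (hc : 0 ≤ c) (a : Edge d → ℝ) (y : Vertex d)
    (hs : ∀ x, Summable fun n => ((1 + (4 * d : ℝ)⁻¹ * c)⁻¹) ^ n * heat a n y x) (x : Vertex d) :
    c * resolventSeries c a y x + ellipticOp a (resolventSeries c a y) x = dirac (x - y) := by
  have hd' : (0 : ℝ) < d := Nat.cast_pos.2 hd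
  set κ : ℝ := (4 * d : ℝ)⁻¹ with hκ
  have hκ0 : 0 < κ := by positivity
  set s : ℝ := (1 + κ * c)⁻¹ with hsdef
  have hs1 : s * (1 + κ * c) = 1 := inv_mul_cancel₀ (by positivity)
  have h1 : ∀ x, HasSum (fun n => κ * s * (s ^ n * heat a n y x)) (resolventSeries c a y x) :=
    fun x => (hs x).hasSum.mul_left _
  have h2 := ((h1 x).mul_left c).add (hasSum_ellipticOp a h1 x)
  have h3 : ∀ n, c * (κ * s * (s ^ n * heat a n y x)) +
      ellipticOp a (fun x => κ * s * (s ^ n * heat a n y x)) x =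
      s ^ n * heat a n y x - s ^ (n + 1) * heat a (n + 1) y x := fun n => by
    have e : (fun x => κ * s * (s ^ n * heat a n y x))
        = fun x => (κ * s * s ^ n) * heat a n y x := by funext x; ring
    rw [e, ellipticOp_const_mul, heat_succ, step, ← hκ, pow_succ]
    linear_combination (s ^ n * heat a n y x) * hs1
  simp only [h3] at h2
  have hsx := hs x
  have h4 : HasSum (fun n => s ^ n * heat a n y x - s ^ (n + 1) * heat a (n + 1) y x)
      (dirac (x - y)) := by
    have h5 := hsx.hasSum.sub ((summable_nat_add_iff 1).2 hsx).hasSum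
    rw [hsx.tsum_eq_zero_add] at h5
    simpa [heat_zero] using h5
  exact h2.unique h4

/-- Maximum principle. -/
theorem nonpos_of_solves (hd : 0 < d) {a : Edge d → ℝ} (ha : ∀ e, 0 < a e) {c : ℝ} (hc : 0 ≤ c)
    {w : Vertex d → ℝ} (hw : ∀ x, c * w x + ellipticOp a w x = 0)
    (hlim : Tendsto w cofinite (𝓝 0)) (x : Vertex d) : w x ≤ 0 := by
  by_contra hcon
  push Not at hcon
  have hfin : ∀ t > 0, {z | t ≤ w z}.Finite := fun t ht => by
    have := hlim.eventually_lt_const ht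
    rw [eventually_cofinite] at this
    simpa using this
  obtain ⟨x₁, hx₁, hmax⟩ := Set.exists_max_image _ w (hfin _ hcon) ⟨x, le_refl (w x)⟩
  have hM : 0 < w x₁ := hcon.trans_le hx₁
  have hle : ∀ z, w z ≤ w x₁ := fun z => by
    by_cases h : w x ≤ w z
    · exact hmax z h
    · exact (not_le.1 h).le.trans hx₁
  set i₀ : Fin d := ⟨0, hd⟩
  -- At a positive maximum all terms of the equation are nonnegative and add up to zero, so each
  -- vanishes and the maximum is also attained at the next vertex in direction e_{i₀}.
  have hstep : ∀ z, w z = w x₁ → w (z + basisVec i₀) = w x₁ := fun z hz => by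
    have h1 := hw z
    have h2 : ∀ i : Fin d, 0 ≤ a (z - basisVec i, i) * (w z - w (z - basisVec i))
        - a (z, i) * (w (z + basisVec i) - w z) := fun i => by
      have h3 := mul_nonneg (ha (z - basisVec i, i)).le
        (by rw [hz]; linarith [hle (z - basisVec i)] : 0 ≤ w z - w (z - basisVec i))
      have h4 := mul_nonneg (ha (z, i)).le
        (by rw [hz]; linarith [hle (z + basisVec i)] : 0 ≤ w z - w (z + basisVec i))
      linarith
    have h5 : 0 ≤ c * w z := mul_nonneg hc (by rw [hz]; exact hM.le)
    rw [ellipticOp_apply] at h1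
    have h6 := (Finset.sum_eq_zero_iff_of_nonneg fun i _ => h2 i).1
      (le_antisymm (by linarith) (Finset.sum_nonneg fun i _ => h2 i)) i₀ (Finset.mem_univ _)
    have h7 := mul_nonneg (ha (z - basisVec i₀, i₀)).le
        (by rw [hz]; linarith [hle (z - basisVec i₀)] : 0 ≤ w z - w (z - basisVec i₀))
    have h8 : 0 ≤ a (z, i₀) * (w (z + basisVec i₀) - w z) := by linarith
    have h9 := nonneg_of_mul_nonneg_right h8 (ha _)
    linarith [hle (z + basisVec i₀)]
  have hall : ∀ n : ℕ, w (x₁ + n • basisVec i₀) = w x₁ := fun n => by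
    induction n with
    | zero => simp
    | succ n ih => rw [succ_nsmul, ← add_assoc]; exact hstep _ ih
  have hinj : Function.Injective fun n : ℕ => x₁ + n • (basisVec i₀ : Vertex d) := fun m n h => by
    have := congrFun (add_left_cancel h) i₀
    simpa [basisVec] using this
  -- The maximum is attained along a whole half-line, which contradicts the decay of w at infinity.
  refine Set.infinite_range_of_injective hinj ((hfin _ hM).subset ?_)
  rintro _ ⟨n, rfl⟩
  exact (hall n).ge

theorem eq_of_solves (hd : 0 < d) {a : Edge d → ℝ} (ha : ∀ e, 0 < a e) {c : ℝ} (hc : 0 ≤ c)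
    {f : Vertex d → ℝ} {g g' : Vertex d → ℝ} (hg : ∀ x, c * g x + ellipticOp a g x = f x)
    (hg' : ∀ x, c * g' x + ellipticOp a g' x = f x) (hlim : Tendsto g cofinite (𝓝 0))
    (hlim' : Tendsto g' cofinite (𝓝 0)) : g = g' := by
  have key : ∀ {g g' : Vertex d → ℝ}, (∀ x, c * g x + ellipticOp a g x = f x) →
      (∀ x, c * g' x + ellipticOp a g' x = f x) → Tendsto g cofinite (𝓝 0) →
      Tendsto g' cofinite (𝓝 0) → ∀ x, g x ≤ g' x := fun {g g'} hg hg' hl hl' x => by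
    have := nonpos_of_solves hd ha hc (w := fun x => g x - g' x) (fun x => by
      rw [ellipticOp_sub]; linarith [hg x, hg' x]) (by simpa using hl.sub hl') x
    linarith
  funext x
  exact le_antisymm (key hg hg' hlim hlim' x) (key hg' hg hlim' hlim x)

theorem resolventSeries_zero (a : Edge d → ℝ) (y x : Vertex d) :
    resolventSeries 0 a y x = (4 * d : ℝ)⁻¹ * ∑' n, heat a n y x := by
  simp [resolventSeries]

/-- Each p_n has finite support and so vanishes at infinity; the time-summable bound, uniform in
space, carries this to the series by dominated convergence. -/
theorem isGreen_resolventSeries (hd : 2 < d) {lam : ℝ} (hlam : 0 < lam) {a : Edge d → ℝ}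
    (ha : UnifElliptic lam a) (y : Vertex d) : IsGreen a y (resolventSeries 0 a y) := by
  have hd0 : 0 < d := by omega
  have ha' : ∀ e, 0 ≤ a e ∧ a e ≤ 1 := fun e => ⟨hlam.le.trans (ha e).1, (ha e).2⟩
  obtain ⟨b, hb, hle⟩ := exists_summable_heat_bound hd hlam ha y
  have hbd : ∀ n x, ‖heat a n y x‖ ≤ b n := fun n x => by
    rw [Real.norm_eq_abs, abs_of_nonneg (heat_nonneg hd0 ha' n y x)]; exact hle n x
  refine ⟨fun x => ?_, ?_⟩
  · have := resolventSeries_solves hd0 le_rfl a y (fun x => by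
      simpa using Summable.of_norm_bounded hb fun n => hbd n x) x
    simpa using this
  · have h : Tendsto (fun x => ∑' n, heat a n y x) cofinite (𝓝 (∑' _ : ℕ, (0 : ℝ))) := by
      refine tendsto_tsum_of_dominated_convergence hb (fun n => ?_)
        (Eventually.of_forall fun x n => hbd n x)
      refine tendsto_const_nhds.congr' ?_
      have := (heat_finite a n y).compl_mem_cofinite
      filter_upwards [this] with x hx
      exact (Function.notMem_support.1 hx).symm
    have e : resolventSeries 0 a y = fun x => (4 * d : ℝ)⁻¹ * ∑' n, heat a n y x :=
      funext fun x => resolventSeries_zero a y x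
    rw [e]
    simpa using h.const_mul ((4 * d : ℝ)⁻¹)

theorem existsUnique_isGreen (hd : 2 < d) {lam : ℝ} (hlam : 0 < lam) {a : Edge d → ℝ}
    (ha : UnifElliptic lam a) (y : Vertex d) : ∃! g, IsGreen a y g := by
  have h := isGreen_resolventSeries hd hlam ha y
  refine ⟨_, h, fun g hg => ?_⟩
  exact eq_of_solves (by omega) (fun e => hlam.trans_le (ha e).1) le_rfl
    (fun x => by simpa using hg.1 x) (fun x => by simpa using h.1 x) hg.2 h.2

theorem green_eq (hd : 2 < d) {lam : ℝ} (hlam : 0 < lam) {a : Edge d → ℝ}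
    (ha : UnifElliptic lam a) (x y : Vertex d) : green a x y = resolventSeries 0 a y x := by
  have h : ∃ g, IsGreen a y g := ⟨_, isGreen_resolventSeries hd hlam ha y⟩
  rw [green, dif_pos h]
  exact congrFun ((existsUnique_isGreen hd hlam ha y).unique h.choose_spec
    (isGreen_resolventSeries hd hlam ha y)) x

theorem inv_one_add_mem (hd : 0 < d) {c : ℝ} (hc : 0 < c) :
    0 < (1 + (4 * d : ℝ)⁻¹ * c)⁻¹ ∧ (1 + (4 * d : ℝ)⁻¹ * c)⁻¹ < 1 := by
  have hd' : (0 : ℝ) < d := Nat.cast_pos.2 hd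
  have : 0 < (4 * d : ℝ)⁻¹ * c := by positivity
  exact ⟨by positivity, inv_lt_one_of_one_lt₀ (by linarith)⟩

theorem summable_pow_mul_heat (hd : 0 < d) {a : Edge d → ℝ} (ha : ∀ e, 0 ≤ a e ∧ a e ≤ 1)
    {s : ℝ} (hs0 : 0 ≤ s) (hs1 : s < 1) (y x : Vertex d) :
    Summable fun n => s ^ n * heat a n y x :=
  Summable.of_nonneg_of_le (fun n => mul_nonneg (pow_nonneg hs0 n) (heat_nonneg hd ha n y x))
    (fun n => mul_le_of_le_one_right (pow_nonneg hs0 n) (heat_le_one hd ha n y x))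
    (summable_geometric_of_lt_one hs0 hs1)

theorem isMassiveGreen_resolventSeries (hd : 0 < d) {a : Edge d → ℝ}
    (ha : ∀ e, 0 ≤ a e ∧ a e ≤ 1) {T : ℝ} (hT : 0 < T) (y : Vertex d) :
    IsMassiveGreen T a y (resolventSeries (1 / T) a y) := by
  obtain ⟨hs0, hs1⟩ := inv_one_add_mem hd (one_div_pos.2 hT)
  have hd' : (0 : ℝ) < d := Nat.cast_pos.2 hd
  have hsum := fun x => summable_pow_mul_heat hd ha hs0.le hs1 y x
  refine ⟨resolventSeries_solves hd (one_div_pos.2 hT).le a y hsum, ?_⟩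
  refine Summable.mul_left _ ?_
  set s := (1 + (4 * d : ℝ)⁻¹ * (1 / T))⁻¹
  refine summable_of_sum_le (c := ∑' n, s ^ n)
    (fun x => tsum_nonneg fun n => mul_nonneg (pow_nonneg hs0.le n) (heat_nonneg hd ha n y x))
    fun F => ?_
  rw [← Summable.tsum_finsetSum fun x _ => hsum x]
  refine (summable_sum fun x _ => hsum x).tsum_le_tsum (fun n => ?_)
    (summable_geometric_of_lt_one hs0.le hs1)
  rw [← Finset.mul_sum]
  refine mul_le_of_le_one_right (pow_nonneg hs0.le n) ?_
  rw [← tsum_heat a n y]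
  have hfs : Summable (heat a n y) := summable_of_hasFiniteSupport (heat_finite a n y)
  exact hfs.sum_le_tsum F fun x _ => heat_nonneg hd ha n y x

theorem existsUnique_isMassiveGreen (hd : 0 < d) {lam : ℝ} (hlam : 0 < lam) {a : Edge d → ℝ}
    (ha : UnifElliptic lam a) {T : ℝ} (hT : 0 < T) (y : Vertex d) :
    ∃! g, IsMassiveGreen T a y g := by
  have ha' : ∀ e, 0 ≤ a e ∧ a e ≤ 1 := fun e => ⟨hlam.le.trans (ha e).1, (ha e).2⟩
  have h := isMassiveGreen_resolventSeries hd ha' hT y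
  refine ⟨_, h, fun g hg => ?_⟩
  exact eq_of_solves hd (fun e => hlam.trans_le (ha e).1) (one_div_pos.2 hT).le hg.1 h.1
    hg.2.tendsto_cofinite_zero h.2.tendsto_cofinite_zero

theorem massiveGreen_eq (hd : 0 < d) {lam : ℝ} (hlam : 0 < lam) {a : Edge d → ℝ}
    (ha : UnifElliptic lam a) {T : ℝ} (hT : 0 < T) (x y : Vertex d) :
    massiveGreen T a x y = resolventSeries (1 / T) a y x := by
  have ha' : ∀ e, 0 ≤ a e ∧ a e ≤ 1 := fun e => ⟨hlam.le.trans (ha e).1, (ha e).2⟩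
  have hg := isMassiveGreen_resolventSeries hd ha' hT y
  have h : ∃ g, IsMassiveGreen T a y g := ⟨_, hg⟩
  rw [massiveGreen, dif_pos h]
  exact congrFun ((existsUnique_isMassiveGreen hd hlam ha hT y).unique h.choose_spec hg) x

/-- As T → ∞ the parameter s increases to 1, and |∇p_n| dominates the terms s^n ∇p_n. Absolute
summability of the gradients is needed here, since for d = 2 no summable bound on p_n itself is at
hand. -/
theorem tendsto_grad_massiveGreen (hd : 2 ≤ d) {lam : ℝ} (hlam : 0 < lam) {a : Edge d → ℝ}
    (ha : UnifElliptic lam a) (y : Vertex d) (e : Edge d) :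
    Tendsto (fun T : ℝ => grad (fun x => massiveGreen T a x y) e) atTop
      (𝓝 ((4 * d : ℝ)⁻¹ * ∑' n, grad (heat a n y) e)) := by
  have hd0 : 0 < d := by omega
  have ha' : ∀ e, 0 ≤ a e ∧ a e ≤ 1 := fun e => ⟨hlam.le.trans (ha e).1, (ha e).2⟩
  set s : ℝ → ℝ := fun T => (1 + (4 * d : ℝ)⁻¹ * (1 / T))⁻¹ with hs
  have hlim : Tendsto s atTop (𝓝 1) := by
    have h1 : Tendsto (fun T : ℝ => 1 + (4 * d : ℝ)⁻¹ * (1 / T)) atTop (𝓝 1) := by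
      simpa using (tendsto_inv_atTop_zero.const_mul ((4 * d : ℝ)⁻¹)).const_add 1
    have h2 := h1.inv₀ one_ne_zero
    rw [inv_one] at h2
    exact h2
  have heq : ∀ T : ℝ, 0 < T → grad (fun x => massiveGreen T a x y) e =
      (4 * d : ℝ)⁻¹ * s T * ∑' n, s T ^ n * grad (heat a n y) e := fun T hT => by
    obtain ⟨hs0, hs1⟩ := inv_one_add_mem hd0 (one_div_pos.2 hT)
    have hsum := fun x => summable_pow_mul_heat hd0 ha' hs0.le hs1 y x
    simp only [grad, massiveGreen_eq hd0 hlam ha hT, resolventSeries, mul_sub, hs]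
    rw [(hsum _).tsum_sub (hsum _), mul_sub]
  have hsumm := summable_grad_heat hd hlam ha y e
  have hdom : Tendsto (fun T => ∑' n, s T ^ n * grad (heat a n y) e) atTop
      (𝓝 (∑' n, grad (heat a n y) e)) := by
    refine tendsto_tsum_of_dominated_convergence hsumm (fun n => ?_) ?_
    · simpa using (hlim.pow n).mul_const (grad (heat a n y) e)
    · filter_upwards [eventually_gt_atTop 0] with T hT n
      obtain ⟨hs0, hs1⟩ := inv_one_add_mem hd0 (one_div_pos.2 hT)
      rw [norm_mul, Real.norm_eq_abs, Real.norm_eq_abs, abs_of_nonneg (pow_nonneg hs0.le n)]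
      exact mul_le_of_le_one_left (abs_nonneg _) (pow_le_one₀ hs0.le hs1.le)
  have hfin : Tendsto (fun T => (4 * d : ℝ)⁻¹ * s T * ∑' n, s T ^ n * grad (heat a n y) e) atTop
      (𝓝 ((4 * d : ℝ)⁻¹ * ∑' n, grad (heat a n y) e)) := by
    simpa using (hlim.const_mul ((4 * d : ℝ)⁻¹)).mul hdom
  refine hfin.congr' ?_
  filter_upwards [eventually_gt_atTop 0] with T hT
  exact (heq T hT).symm

theorem greenWellDefined (hd : 2 ≤ d) {lam : ℝ} (hlam : 0 < lam) {a : Edge d → ℝ}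
    (ha : UnifElliptic lam a) : GreenWellDefined a :=
  ⟨fun h y => existsUnique_isGreen h hlam ha y, fun _ y =>
    ⟨fun _ hT => existsUnique_isMassiveGreen (by omega) hlam ha hT y, fun e =>
      ⟨_, tendsto_grad_massiveGreen hd hlam ha y e⟩⟩⟩

/-- Gives both definitions of ∇G, the massive limit for d = 2 and the decaying solution for d > 2,
one common series. The annealed estimates need no further case distinction. -/
theorem gradGreen_eq (hd : 2 ≤ d) {lam : ℝ} (hlam : 0 < lam) {a : Edge d → ℝ}
    (ha : UnifElliptic lam a) (e : Edge d) (y : Vertex d) :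
    gradGreen a e y = (4 * d : ℝ)⁻¹ * ∑' n, grad (heat a n y) e := by
  rw [gradGreen]
  split_ifs with h2
  · exact (tendsto_grad_massiveGreen hd hlam ha y e).limUnder_eq
  · have hd2 : 2 < d := by omega
    have ha' : ∀ e, 0 ≤ a e ∧ a e ≤ 1 := fun e => ⟨hlam.le.trans (ha e).1, (ha e).2⟩
    obtain ⟨b, hb, hle⟩ := exists_summable_heat_bound hd2 hlam ha y
    have hsum : ∀ x, Summable fun n => heat a n y x := fun x =>
      Summable.of_nonneg_of_le (fun n => heat_nonneg (by omega) ha' n y x) (fun n => hle n x) hb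
    simp only [grad, green_eq hd2 hlam ha, resolventSeries_zero]
    rw [(hsum _).tsum_sub (hsum _), mul_sub]

theorem hasSum_gradGreen (hd : 2 ≤ d) {lam : ℝ} (hlam : 0 < lam) {a : Edge d → ℝ}
    (ha : UnifElliptic lam a) (e : Edge d) (y : Vertex d) :
    HasSum (fun n => (4 * d : ℝ)⁻¹ * grad (heat a n y) e) (gradGreen a e y) := by
  rw [gradGreen_eq hd hlam ha]
  exact (summable_grad_heat hd hlam ha y e).of_abs.hasSum.mul_left _

theorem hasSum_gradGradGreen (hd : 2 ≤ d) {lam : ℝ} (hlam : 0 < lam) {a : Edge d → ℝ}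
    (ha : UnifElliptic lam a) (e b : Edge d) :
    HasSum (fun n => (4 * d : ℝ)⁻¹ * grad (fun y => grad (heat a n y) e) b)
      (gradGradGreen a e b) := by
  have := (hasSum_gradGreen hd hlam ha e (b.1 + basisVec b.2)).sub
    (hasSum_gradGreen hd hlam ha e b.1)
  simp only [← mul_sub] at this
  exact this

theorem tendsto_four_pow_atTop : Tendsto (fun J : ℕ => 4 ^ (J + 1)) atTop atTop :=
  (tendsto_pow_atTop_atTop_of_one_lt (by norm_num : 1 < 4)).comp (tendsto_add_atTop_nat 1)

/-! ### Distances and the final estimates -/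

theorem norm_vertexPoint_sub_le (x y : Vertex d) :
    ‖vertexPoint x - vertexPoint y‖ ≤ nrm (x - y) := by
  have h1 : vertexPoint x - vertexPoint y
      = ∑ i, EuclideanSpace.single i (((x - y) i : ℤ) : ℝ) := by
    ext j
    simp [vertexPoint, Finset.sum_apply, Pi.single_apply]
  rw [h1]
  refine (norm_sum_le _ _).trans (le_of_eq ?_)
  rw [nrm]
  push_cast
  refine Finset.sum_congr rfl fun i _ => ?_
  rw [PiLp.norm_single, Real.norm_eq_abs, Nat.cast_natAbs, Int.cast_abs]

theorem norm_edgeMidpoint_sub_le (e : Edge d) :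
    ‖edgeMidpoint e - vertexPoint e.1‖ ≤ 1 / 2 := by
  have h := norm_vertexPoint_sub_le (e.1 + basisVec e.2) e.1
  rw [add_sub_cancel_left, nrm_basisVec, Nat.cast_one] at h
  rw [edgeMidpoint, midpoint_sub_left, norm_smul]
  norm_num
  linarith

theorem norm_edge_vertex_le (e : Edge d) (y : Vertex d) :
    ‖edgeMidpoint e - vertexPoint y‖ + 1 ≤ 2 * ((nrm (e.1 - y) : ℝ) + 1) := by
  have h1 := norm_edgeMidpoint_sub_le e
  have h2 := norm_vertexPoint_sub_le e.1 y
  have h3 := norm_sub_le_norm_sub_add_norm_sub (edgeMidpoint e) (vertexPoint e.1) (vertexPoint y)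
  linarith [(Nat.cast_nonneg _ : (0 : ℝ) ≤ nrm (e.1 - y))]

theorem norm_edge_edge_le (e b : Edge d) :
    ‖edgeMidpoint e - edgeMidpoint b‖ + 1 ≤ 2 * ((nrm (e.1 - b.1) : ℝ) + 1) := by
  have h1 := norm_edgeMidpoint_sub_le e
  have h2 := norm_vertexPoint_sub_le e.1 b.1
  have h3 := norm_sub_le_norm_sub_add_norm_sub (edgeMidpoint e) (vertexPoint e.1)
    (edgeMidpoint b)
  have h4 := norm_sub_le_norm_sub_add_norm_sub (vertexPoint e.1) (vertexPoint b.1)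
    (edgeMidpoint b)
  have h5 := norm_edgeMidpoint_sub_le b
  rw [norm_sub_rev] at h5
  linarith [(Nat.cast_nonneg _ : (0 : ℝ) ≤ nrm (e.1 - b.1))]

theorem inv_pow_le_two_pow_mul {r s : ℝ} (hr : 0 < r) (hs : 0 < s) (h : s ≤ 2 * r) (p : ℕ) :
    (r ^ p)⁻¹ ≤ 2 ^ p * (s ^ p)⁻¹ := by
  rw [← div_eq_mul_inv, ← one_div, div_le_div_iff₀ (by positivity) (by positivity), one_mul,
    ← mul_pow]
  exact pow_le_pow_left₀ hs.le h p

/-- The partial sums up to 4^{J+1} have second moments bounded uniformly in J and converge for every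
field, so Fatou's lemma applies. The factor 2^{d-1} passes from the ℓ¹ distance of base points to
the Euclidean distance from the mid-point. -/
theorem exists_annealed_gradGreen_le (hd : 2 ≤ d) {lam : ℝ} (hlam : 0 < lam) :
    ∃ C : ℝ, 0 < C ∧ ∀ (P : Measure (CoeffField d lam)) [IsProbabilityMeasure P], Stationary P →
      ∀ (e : Edge d) (y : Vertex d),
        Integrable (fun a : CoeffField d lam => |gradGreen a.toReal e y| ^ 2) P ∧
        Real.sqrt (∫ a : CoeffField d lam, |gradGreen a.toReal e y| ^ 2 ∂P)
          ≤ C * ((‖edgeMidpoint e - vertexPoint y‖ + 1) ^ (d - 1))⁻¹ := by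
  obtain ⟨C, hC, h⟩ := exists_annealed_sum_sq_le hd hlam
  have hd' : (0 : ℝ) < d := Nat.cast_pos.2 (by omega)
  have hd0 : 0 < d := by omega
  set κ : ℝ := (4 * d : ℝ)⁻¹ with hκ
  have hκ0 : 0 < κ := by positivity
  refine ⟨κ * Real.sqrt C * 2 ^ (d - 1), by positivity, fun P _ hP e y => ?_⟩
  set V : ℝ := (((nrm (e.1 - y) : ℝ) + 1) ^ (d - 1))⁻¹ with hV
  have hV0 : 0 ≤ V := by positivity
  have ha' : ∀ a : CoeffField d lam, ∀ e, 0 ≤ a.toReal e ∧ a.toReal e ≤ 1 := fun a e =>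
    ⟨hlam.le.trans (unifElliptic_toReal a e).1, (unifElliptic_toReal a e).2⟩
  have hm : ∀ J : ℕ, Measurable fun a : CoeffField d lam =>
      ∑ n ∈ Finset.range (4 ^ (J + 1)), grad (heat a.toReal n y) e := fun J =>
    Finset.measurable_fun_sum _ fun n _ => measurable_grad_heat n y e
  have key := integrable_of_tendsto_of_integral_le (μ := P)
    (f := fun J a => κ ^ 2 * (∑ n ∈ Finset.range (4 ^ (J + 1)), grad (heat a.toReal n y) e) ^ 2)
    (g := fun a => |gradGreen a.toReal e y| ^ 2) (B := κ ^ 2 * (C * V ^ 2))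
    (fun J => ((hm J).pow_const 2).const_mul _)
    (fun J => by
      refine Integrable.const_mul (Integrable.of_bound
        ((hm J).pow_const 2).aestronglyMeasurable ((4 ^ (J + 1) : ℕ) ^ 2)
        (ae_of_all _ fun a => ?_)) _
      rw [Real.norm_eq_abs, abs_pow]
      refine pow_le_pow_left₀ (abs_nonneg _) ((Finset.abs_sum_le_sum_abs _ _).trans ?_) 2
      refine (Finset.sum_le_sum fun n _ => abs_grad_heat_le hd0 (ha' a) n y e).trans ?_
      simp)
    (fun J a => by positivity)
    (fun a => by
      have h1 := ((hasSum_gradGreen hd hlam (unifElliptic_toReal a) e y).tendsto_sum_nat).comp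
        tendsto_four_pow_atTop
      have h2 := h1.pow 2
      rw [sq_abs]
      refine h2.congr fun J => ?_
      simp only [Function.comp, ← Finset.mul_sum, mul_pow, hκ])
    (fun J => by
      rw [integral_const_mul]
      exact mul_le_mul_of_nonneg_left (h P hP e y J) (sq_nonneg _))
  refine ⟨key.1, ?_⟩
  have h1 : Real.sqrt (∫ a : CoeffField d lam, |gradGreen a.toReal e y| ^ 2 ∂P) ≤
      κ * Real.sqrt C * V := by
    refine (Real.sqrt_le_sqrt key.2).trans (le_of_eq ?_)
    rw [Real.sqrt_mul (sq_nonneg _), Real.sqrt_sq hκ0.le, Real.sqrt_mul hC.le, Real.sqrt_sq hV0,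
      mul_assoc]
  refine h1.trans ?_
  rw [mul_assoc _ (2 ^ (d - 1))]
  exact mul_le_mul_of_nonneg_left (inv_pow_le_two_pow_mul (by positivity) (by positivity)
    (norm_edge_vertex_le e y) _) (by positivity)

theorem exists_annealed_gradGradGreen_le (hd : 2 ≤ d) {lam : ℝ} (hlam : 0 < lam) :
    ∃ C : ℝ, 0 < C ∧ ∀ (P : Measure (CoeffField d lam)) [IsProbabilityMeasure P], Stationary P →
      ∀ e b : Edge d,
        Integrable (fun a : CoeffField d lam => |gradGradGreen a.toReal e b|) P ∧
        ∫ a : CoeffField d lam, |gradGradGreen a.toReal e b| ∂P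
          ≤ C * ((‖edgeMidpoint e - edgeMidpoint b‖ + 1) ^ d)⁻¹ := by
  have hd0 : 0 < d := by omega
  obtain ⟨C, hC, h⟩ := exists_annealed_sum_mixed_le hd0 hlam
  have hd' : (0 : ℝ) < d := Nat.cast_pos.2 (by omega)
  set κ : ℝ := (4 * d : ℝ)⁻¹ with hκ
  have hκ0 : 0 < κ := by positivity
  refine ⟨κ * C * 2 ^ d, by positivity, fun P _ hP e b => ?_⟩
  have ha' : ∀ a : CoeffField d lam, ∀ e, 0 ≤ a.toReal e ∧ a.toReal e ≤ 1 := fun a e =>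
    ⟨hlam.le.trans (unifElliptic_toReal a e).1, (unifElliptic_toReal a e).2⟩
  have hm : ∀ J : ℕ, Measurable fun a : CoeffField d lam =>
      ∑ n ∈ Finset.range (4 ^ (J + 1)), grad (fun y => grad (heat a.toReal n y) e) b := fun J =>
    Finset.measurable_fun_sum _ fun n _ =>
      (measurable_grad_heat n _ e).sub (measurable_grad_heat n _ e)
  have key := integrable_of_tendsto_of_integral_le (μ := P)
    (f := fun J a => κ *
      |∑ n ∈ Finset.range (4 ^ (J + 1)), grad (fun y => grad (heat a.toReal n y) e) b|)
    (g := fun a => |gradGradGreen a.toReal e b|)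
    (B := κ * (C * (((nrm (e.1 - b.1) : ℝ) + 1) ^ d)⁻¹))
    (fun J => (hm J).abs.const_mul _)
    (fun J => by
      refine Integrable.const_mul (Integrable.of_bound (hm J).abs.aestronglyMeasurable
        ((4 ^ (J + 1) : ℕ) * 2) (ae_of_all _ fun a => ?_)) _
      rw [Real.norm_eq_abs, abs_abs]
      refine (Finset.abs_sum_le_sum_abs _ _).trans ((Finset.sum_le_sum fun n _ =>
        (abs_sub _ _).trans (add_le_add (abs_grad_heat_le hd0 (ha' a) n _ e)
          (abs_grad_heat_le hd0 (ha' a) n _ e))).trans ?_)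
      simp [one_add_one_eq_two])
    (fun J a => by positivity)
    (fun a => by
      have h1 := ((hasSum_gradGradGreen hd hlam (unifElliptic_toReal a) e b).tendsto_sum_nat).comp
        tendsto_four_pow_atTop
      refine h1.abs.congr fun J => ?_
      simp only [Function.comp, ← Finset.mul_sum, abs_mul, hκ]
      rw [abs_of_pos hκ0])
    (fun J => by
      rw [integral_const_mul]
      exact mul_le_mul_of_nonneg_left (h P hP e b J) hκ0.le)
  refine ⟨key.1, key.2.trans ?_⟩
  rw [← mul_assoc, mul_assoc _ (2 ^ d)]
  exact mul_le_mul_of_nonneg_left (inv_pow_le_two_pow_mul (by positivity) (by positivity)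
    (norm_edge_edge_le e b) _) (by positivity)

end AnnealedGreen

theorem proposition1p2 (d : ℕ) (hd : 2 ≤ d) (lam : ℝ) (hlam0 : 0 < lam) (hlam1 : lam < 1) :
    (∀ a : CoeffField d lam, GreenWellDefined a.toReal) ∧
    ∃ C : ℝ, ∀ (P : Measure (CoeffField d lam)) [IsProbabilityMeasure P], Stationary P →
      (∀ (e : Edge d) (y : Vertex d),
        Integrable (fun a : CoeffField d lam => |gradGreen a.toReal e y| ^ 2) P ∧
        Real.sqrt (∫ a : CoeffField d lam, |gradGreen a.toReal e y| ^ 2 ∂P)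
          ≤ C * (‖edgeMidpoint e - vertexPoint y‖ + 1) ^ (1 - (d : ℤ))) ∧
      (∀ e b : Edge d,
        Integrable (fun a : CoeffField d lam => |gradGradGreen a.toReal e b|) P ∧
        ∫ a : CoeffField d lam, |gradGradGreen a.toReal e b| ∂P
          ≤ C * (‖edgeMidpoint e - edgeMidpoint b‖ + 1) ^ (-(d : ℤ))) := by
  refine ⟨fun a => greenWellDefined hd hlam0 (unifElliptic_toReal a), ?_⟩
  obtain ⟨C₁, hC₁, h₁⟩ := exists_annealed_gradGreen_le hd hlam0
  obtain ⟨C₂, hC₂, h₂⟩ := exists_annealed_gradGradGreen_le hd hlam0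
  refine ⟨max C₁ C₂, fun P _ hP => ⟨fun e y => ⟨(h₁ P hP e y).1, ?_⟩,
    fun e b => ⟨(h₂ P hP e b).1, ?_⟩⟩⟩
  · have e1 : (1 - (d : ℤ)) = -((d - 1 : ℕ) : ℤ) := by omega
    rw [e1, zpow_neg, zpow_natCast]
    exact (h₁ P hP e y).2.trans
      (mul_le_mul_of_nonneg_right (le_max_left _ _) (by positivity))
  · rw [zpow_neg, zpow_natCast]
    exact (h₂ P hP e b).2.trans
      (mul_le_mul_of_nonneg_right (le_max_right _ _) (by positivity))
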